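/- **Setting.** Let $F$ be a totally real number field, $K/F$ a totally imaginary quadratic extension, $B$ a quaternion algebra over $F$ with an $F$-embedding $K\hookrightarrow B$, and $\mathcal P$ a prime of $F$ above an odd rational prime, at which $B$ is split. Write $\hat F$ for the finite adeles of $F$, $\hat B=\hat F\otimes_F B$, $\hat K=\hat F\otimes_F K$, $G(\mathbb A_f)=\hat B^\times\supset T(\mathbb A_f)=\hat K^\times$, $G(\mathbb Q)=B^\times$, $T(\mathbb Q)=K^\times$. Let $\varpi$ be a uniformizer of $F_{\mathcal P}$ and let $\alpha\in O_{K,\mathcal P}$ be such that $\{1,\alpha\}$ is an $O_{F,\mathcal P}$-basis of $O_{K,\mathcal P}$. Identify $B_{\mathcal P}=M_2(F_{\mathcal P})$ in such a way that $a+b\alpha\in K_{\mathcal P}$ becomes $\begin{pmatrix}a+b\operatorname{Tr}\alpha&b\\-b\operatorname{N}\alpha&a\end{pmatrix}$. Let $\delta\ge 0$, $h\in GL_2(F_{\mathcal P})$, and let $R\subset B$ be an $O_F$-order with $R_{\mathcal P}=h\,\{\begin{pmatrix}a&b\\c&d\end{pmatrix}\in M_2(O_{F,\mathcal P}): b\in\mathcal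 P^\delta\}\,h^{-1}$. Put $H=\hat R^\times$. For an open subgroup $U$ of $H$ let $M_U=G(\mathbb Q)\backslash G(\mathbb A_f)/U$, $CM_U=T(\mathbb Q)\backslash G(\mathbb A_f)/U$ and $\mathrm{red}:CM_U\to M_U$ the natural map. For $n\ge0$ let $O_{\mathcal P^n}=O_F+\mathcal P^nO_K$, and let $CM_U(\mathcal P^n)$ be the set of $[g]\in CM_U$ with $T(\mathbb A_f)\cap gUg^{-1}=\hat O_{\mathcal P^n}^\times$. Let $G(n)=\hat K^\times/K^\times\hat O_{\mathcal P^n}^\times$ (the Galois group over $K$ of the ring class field of conductor $\mathcal P^n$), which acts on $CM_U(\mathcal P^n)$ by $[\beta].[g]=[\beta g]$. Let $G(\infty)=\varprojlim G(n)$, let $G_0(n)$ be the image in $G(n)$ of the torsion subgroup of $G(\infty)$, and put $H(n)=G(n)/G_0(n)$ and $Z(n,m)=\ker(H(n)\to H(n-m))$. Let $A$ be a commutative ring, $\theta:M_H\to A$ any function, $\psi=\theta\circ\mathrm{red}$ on $CM_H$, and $m\ge1$. For $a\in O_{F,\mathcal P}$ let $\alpha_{a,m}\in G(\mathbb A_f)$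 have component $h\begin{pmatrix}1&a\varpi^{\delta-m}\\0&1\end{pmatrix}h^{-1}$ at $\mathcal P$ and $1$ elsewhere, and put $(\alpha_{a,m}\cdot\theta)(g)=\theta(g\alpha_{a,m})$. For $n>m$ let $\tau_a\in Z(n,m)$ be the class of the element of $T(\mathbb A_f)$ with component $1+a\alpha\varpi^{n-m}$ at $\mathcal P$ and $1$ elsewhere; it depends only on $a$ modulo $\mathcal P^m$. For a character $\chi_1:H(n)\to A^\times$ put $$\theta_m=\sum_{a\in O_{F,\mathcal P}/\mathcal P^m}\chi_1(\tau_a)\,(\alpha_{a,m}\cdot\theta).$$ Let $K_1(\mathcal P^k)$ (resp. $K^1(\mathcal P^k)$) be the group of $\begin{pmatrix}a&b\\c&d\end{pmatrix}\in GL_2(O_{F,\mathcal P})$ with $a\equiv d$ and $c\equiv0$ (resp. $b\equiv0$) modulo $\mathcal P^k$. Let $H_m\subset H$ be the subgroup which agrees with $H$ outside $\mathcal P$ and whose component at $\mathcal P$ is $R_{\mathcal P}^\times\cap hK_1(\mathcal P^{2m-\delta})h^{-1}$ if $\delta<m$, $R_{\mathcal P}^\times\cap hK_1(\mathcal P^{m})h^{-1}$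 if $m\le\delta<2m$, and $R_{\mathcal P}^\times\cap hK^1(\mathcal P^{m})h^{-1}$ if $\delta\ge 2m$. **Statement.** There is an $O_F$-order $R_m\subset R$ with $H_m=\hat R_m^\times$. Moreover, there is $n_0$ such that for every $n\ge n_0$ the projection $G(n)\to H(n)$ induces an isomorphism $\ker(G(n)\to G(n-m))\cong Z(n,m)$, through which $Z(n,m)$ acts on $CM_H(\mathcal P^n)$, and the following hold for every character $\chi_1:H(n)\to A^\times$. 1. $\theta_m$ is right invariant under $H_m$, and induces a function on $M_{H_m}$; let $\psi_m$ be its composite with $\mathrm{red}:CM_{H_m}\to M_{H_m}$. 2. Let $x\in CM_H(\mathcal P^n)$; if $\delta\ge1$, assume that $x=\sigma.z$ for some $\sigma\in G(n)$ and some $z=[g_0]\in CM_H(\mathcal P^n)$ such that $g_0$ has component $\begin{pmatrix}\varpi^{n-\delta}&0\\0&1\end{pmatrix}h^{-1}$ at $\mathcal P$. Then there is $x_m\in CM_{H_m}(\mathcal P^n)$ such that $$\psi_m(x_m)=\sum_{\tau\in Z(n,m)}\chi_1(\tau)\,\psi(\tau.x).$$ -/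

import Mathlib

open scoped TensorProduct NumberField
open IsDedekindDomain NumberField

noncomputable section

namespace CMPoints

/-! ### Adelic points of `F`-algebras and of their orders -/

/-- The finite adeles `F̂` of the number field `F`. -/
abbrev FinAdeles (F : Type*) [Field F] [NumberField F] := FiniteAdeleRing (𝓞 F) F

/-- `Â = F̂ ⊗_F A` for an `F`-algebra `A`.
For `A = B` its units are `G(𝔸_f)`, for `A = K` they are `T(𝔸_f)`. -/
abbrev Hat (F : Type*) [Field F] [NumberField F] (A : Type*) [Ring A] [Algebra F A] :=
  FinAdeles F ⊗[F] A

/-- `A_𝒫 = F_𝒫 ⊗_F A` for an `F`-algebra `A`. -/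
abbrev AtP {F : Type*} [Field F] [NumberField F] (P : HeightOneSpectrum (𝓞 F))
    (A : Type*) [Ring A] [Algebra F A] :=
  P.adicCompletion F ⊗[F] A

/-- The integral finite adeles `Ô_F`. -/
def intAdeles (F : Type*) [Field F] [NumberField F] : Subring (FinAdeles F) where
  carrier := {x | ∀ v : HeightOneSpectrum (𝓞 F), x v ∈ v.adicCompletionIntegers F}
  mul_mem' hx hy v := mul_mem (hx v) (hy v)
  one_mem' v := one_mem (v.adicCompletionIntegers F)
  add_mem' hx hy v := add_mem (hx v) (hy v)
  zero_mem' v := zero_mem (v.adicCompletionIntegers F)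
  neg_mem' hx v := neg_mem (hx v)

section Algebras

variable {F : Type*} [Field F] [NumberField F] {A : Type*} [Ring A] [Algebra F A]

/-- An `O_F`-order of the `F`-algebra `A`: an `O_F`-subalgebra which is a finitely generated
`O_F`-module and spans `A` over `F`. -/
def IsOrder (R : Subalgebra (𝓞 F) A) : Prop :=
  (Subalgebra.toSubmodule R).FG ∧ Submodule.span F (R : Set A) = ⊤

/-- `R̂ = Ô_F ⊗ R`, as the subring `Ô_F · R` of `Â`. -/
def hatOrder (R : Subalgebra (𝓞 F) A) : Subring (Hat F A) :=
  Subring.closure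
    ((fun x : FinAdeles F => x ⊗ₜ[F] (1 : A)) '' (intAdeles F : Set (FinAdeles F)) ∪
      (fun r : A => (1 : FinAdeles F) ⊗ₜ[F] r) '' (R : Set A))

/-- The subgroup `R̂ˣ` of `Âˣ`. -/
def hatUnits (R : Subalgebra (𝓞 F) A) : Subgroup (Hat F A)ˣ :=
  (hatOrder R).toSubmonoid.units

/-- `R_𝒫 = O_{F,𝒫} ⊗ R`, as the subring `O_{F,𝒫} · R` of `A_𝒫`. -/
def locOrder (P : HeightOneSpectrum (𝓞 F)) (R : Subalgebra (𝓞 F) A) : Subring (AtP P A) :=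
  Subring.closure
    ((fun x : P.adicCompletion F => x ⊗ₜ[F] (1 : A)) ''
        (P.adicCompletionIntegers F : Set (P.adicCompletion F)) ∪
      (fun r : A => (1 : P.adicCompletion F) ⊗ₜ[F] r) '' (R : Set A))

variable (F A) in
/-- The diagonal image of the group of rational points `Aˣ` in `Âˣ`. -/
def rationalUnits : Subgroup (Hat F A)ˣ :=
  (Units.map
    ((Algebra.TensorProduct.includeRight : A →ₐ[F] Hat F A) : A →* Hat F A)).range

/-- The `𝒫`-component of a finite adele. -/
def evalAt (P : HeightOneSpectrum (𝓞 F)) : FinAdeles F →ₐ[F] P.adicCompletion F where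
  toFun x := x P
  map_one' := rfl
  map_mul' _ _ := rfl
  map_zero' := rfl
  map_add' _ _ := rfl
  commutes' _ := rfl

/-- The `𝒫`-component `Â → A_𝒫`. -/
def toP (P : HeightOneSpectrum (𝓞 F)) : Hat F A →ₐ[F] AtP P A :=
  Algebra.TensorProduct.map (evalAt P) (AlgHom.id F A)

open Classical in
/-- The finite adele with component `x` at `𝒫` and `0` elsewhere. -/
def singleAt (P : HeightOneSpectrum (𝓞 F)) : P.adicCompletion F →ₗ[F] FinAdeles F where
  toFun x := ⟨Pi.single P x, (RestrictedProduct.single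
    (fun v : HeightOneSpectrum (𝓞 F) => v.adicCompletionIntegers F) P x).2⟩
  map_add' x y := by
    apply FiniteAdeleRing.ext
    intro v
    exact congrFun (Pi.single_add P x y) v
  map_smul' c x := by
    apply FiniteAdeleRing.ext
    intro v
    simp only [Algebra.smul_def, RingHom.id_apply]
    change Pi.single P _ v = (algebraMap F (FinAdeles F) c) v * Pi.single P x v
    by_cases hv : v = P
    · subst hv
      simp only [Pi.single_eq_same]
      rfl
    · simp [Pi.single_eq_of_ne hv]

lemma singleAt_mul (P : HeightOneSpectrum (𝓞 F)) (x y : P.adicCompletion F) :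
    singleAt P (x * y) = singleAt P x * singleAt P y := by
  classical
  apply FiniteAdeleRing.ext
  intro v
  change (Pi.single P (x * y) : ∀ v : HeightOneSpectrum (𝓞 F), v.adicCompletion F) v
    = (Pi.single P x : ∀ v : HeightOneSpectrum (𝓞 F), v.adicCompletion F) v *
      (Pi.single P y : ∀ v : HeightOneSpectrum (𝓞 F), v.adicCompletion F) v
  by_cases hv : v = P
  · subst hv
    simp only [Pi.single_eq_same]
  · simp [Pi.single_eq_of_ne hv]

/-- Extension by zero `A_𝒫 → Â`. -/
def fromP (P : HeightOneSpectrum (𝓞 F)) : AtP P A →ₗ[F] Hat F A :=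
  TensorProduct.map (singleAt P) LinearMap.id

lemma fromP_mul (P : HeightOneSpectrum (𝓞 F)) (x y : AtP P A) :
    fromP P (x * y) = fromP P x * fromP P y := by
  induction x using TensorProduct.induction_on with
  | zero => simp
  | add x₁ x₂ h₁ h₂ => simp only [add_mul, map_add, h₁, h₂]
  | tmul a b =>
    induction y using TensorProduct.induction_on with
    | zero => simp
    | add y₁ y₂ h₁ h₂ => simp only [mul_add, map_add, h₁, h₂]
    | tmul c d => simp [fromP, singleAt_mul]

/-- The map `A_𝒫ˣ → Âˣ` sending `u` to `(1, …, 1, u, 1, …, 1)`, with `u` at the place `𝒫`. -/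
def localUnit (P : HeightOneSpectrum (𝓞 F)) : (AtP P A)ˣ →* (Hat F A)ˣ :=
  MonoidHom.toHomUnits
    { toFun := fun u => 1 + fromP P ((u : AtP P A) - 1)
      map_one' := by simp
      map_mul' := fun u v => by
        have h : ((u * v : (AtP P A)ˣ) : AtP P A) - 1
            = (u - 1) * (v - 1) + (u - 1) + (v - 1) := by
          push_cast
          noncomm_ring
        rw [h, map_add, map_add, fromP_mul]
        noncomm_ring }

end Algebras

/-! ### Ring class groups of `𝒫`-power conductor -/

section RingClass

variable {F : Type*} [Field F] [NumberField F] (K : Type*) [Field K] [NumberField K] [Algebra F K]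
  (P : HeightOneSpectrum (𝓞 F))

/-- The `O_F`-order `O_{𝒫ⁿ} = O_F + 𝒫ⁿ O_K` of conductor `𝒫ⁿ` in `K`
(it is generated as an `O_F`-algebra by the ideal `𝒫ⁿ O_K`). -/
def condOrder (n : ℕ) : Subalgebra (𝓞 F) K :=
  Algebra.adjoin (𝓞 F)
    {x : K | ∃ b ∈ (P.asIdeal ^ n).map (algebraMap (𝓞 F) (𝓞 K)), (b : K) = x}

lemma condOrder_anti {k n : ℕ} (h : k ≤ n) : condOrder K P n ≤ condOrder K P k := by
  apply Algebra.adjoin_mono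
  rintro x ⟨b, hb, rfl⟩
  exact ⟨b, Ideal.map_mono (Ideal.pow_le_pow_right h) hb, rfl⟩

/-- The subgroup `Kˣ · Ô_{𝒫ⁿ}ˣ` of `K̂ˣ`. -/
def ringClassSubgroup (n : ℕ) : Subgroup (Hat F K)ˣ :=
  rationalUnits F K ⊔ hatUnits (condOrder K P n)

lemma ringClassSubgroup_anti {k n : ℕ} (h : k ≤ n) :
    ringClassSubgroup K P n ≤ ringClassSubgroup K P k := by
  refine sup_le_sup le_rfl (Submonoid.units_mono ?_)
  exact Subring.closure_mono
    (Set.union_subset_union le_rfl (Set.image_mono (condOrder_anti K P h)))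

variable (F) in
lemma torus_mul_comm (s t : (Hat F K)ˣ) : s * t = t * s :=
  Units.ext (mul_comm (G := FinAdeles F ⊗[F] K) (s : Hat F K) (t : Hat F K))

instance (n : ℕ) : (ringClassSubgroup K P n).Normal where
  conj_mem t ht s := by
    rw [torus_mul_comm F K s t, mul_assoc, mul_inv_cancel, mul_one]
    exact ht

/-- `G(n) = Gal(K[𝒫ⁿ]/K)`, identified by the reciprocity map with
`𝔸_Kˣ / Kˣ K_∞ˣ Ô_{𝒫ⁿ}ˣ = K̂ˣ / Kˣ Ô_{𝒫ⁿ}ˣ`. -/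
abbrev GalGroup (n : ℕ) := (Hat F K)ˣ ⧸ ringClassSubgroup K P n

instance (n : ℕ) : CommGroup (GalGroup K P n) :=
  { (inferInstance : Group (GalGroup K P n)) with
    mul_comm := fun a b => by
      induction a using QuotientGroup.induction_on
      induction b using QuotientGroup.induction_on
      rw [← QuotientGroup.mk_mul, ← QuotientGroup.mk_mul, torus_mul_comm] }

/-- The projection `G(n) → G(k)` for `k ≤ n`. -/
def galProj {k n : ℕ} (h : k ≤ n) : GalGroup K P n →* GalGroup K P k :=
  QuotientGroup.map _ _ (MonoidHom.id _) (ringClassSubgroup_anti K P h)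

/-- `G(∞) = lim G(n)`, as a subgroup of the product of the `G(n)`. -/
def GalInf : Subgroup (∀ n : ℕ, GalGroup K P n) where
  carrier := {s | ∀ (k n : ℕ) (h : k ≤ n), galProj K P h (s n) = s k}
  mul_mem' hs ht k n h := by simp [hs k n h, ht k n h]
  one_mem' k n h := by simp
  inv_mem' hs k n h := by simp [hs k n h]

/-- `G₀(n)`, the image in `G(n)` of the torsion subgroup `G₀` of `G(∞)`. -/
def torsionImage (n : ℕ) : Subgroup (GalGroup K P n) :=
  (CommGroup.torsion (GalInf K P)).map
    ((Pi.evalMonoidHom (fun n : ℕ => GalGroup K P n) n).comp (GalInf K P).subtype)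

lemma torsionImage_le {k n : ℕ} (h : k ≤ n) :
    torsionImage K P n ≤ (torsionImage K P k).comap (galProj K P h) := by
  rintro _ ⟨s, hs, rfl⟩
  exact ⟨s, hs, (s.2 k n h).symm⟩

/-- `H(n) = G(n) / G₀(n)`. -/
abbrev AntiGroup (n : ℕ) := GalGroup K P n ⧸ torsionImage K P n

/-- The projection `H(n) → H(k)` for `k ≤ n`. -/
def antiProj {k n : ℕ} (h : k ≤ n) : AntiGroup K P n →* AntiGroup K P k :=
  QuotientGroup.map _ _ (galProj K P h) (torsionImage_le K P h)

/-- `Z(n,m) = ker (H(n) → H(n-m))`. -/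
def Z (n m : ℕ) : Subgroup (AntiGroup K P n) := (antiProj K P (Nat.sub_le n m)).ker

/-- `ker (G(n) → G(n-m))`. -/
def galKer (n m : ℕ) : Subgroup (GalGroup K P n) := (galProj K P (Nat.sub_le n m)).ker

end RingClass

/-! ### CM points and the Galois action -/

section CM

variable {F : Type*} [Field F] [NumberField F] {K : Type*} [Field K] [NumberField K] [Algebra F K]
  {B : Type*} [Ring B] [Algebra F B]

/-- The inclusion `T(𝔸_f) → G(𝔸_f)` induced by the embedding `ι : K → B`. -/
def torusMap (ι : K →ₐ[F] B) : (Hat F K)ˣ →* (Hat F B)ˣ :=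
  Units.map ((Algebra.TensorProduct.map (AlgHom.id F (FinAdeles F)) ι : Hat F K →ₐ[F] Hat F B) :
    Hat F K →* Hat F B)

/-- `T(ℚ) = Kˣ` as a subgroup of `G(𝔸_f)`. -/
def rationalTorus (ι : K →ₐ[F] B) : Subgroup (Hat F B)ˣ :=
  (rationalUnits F K).map (torusMap ι)

/-- `M_H = G(ℚ) \ G(𝔸_f) / H`. -/
def MSpace (H : Subgroup (Hat F B)ˣ) :=
  DoubleCoset.Quotient (rationalUnits F B : Set (Hat F B)ˣ) (H : Set (Hat F B)ˣ)

/-- The class of `g` in `M_H`. -/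
def MSpace.mk (H : Subgroup (Hat F B)ˣ) (g : (Hat F B)ˣ) : MSpace H :=
  DoubleCoset.mk (rationalUnits F B) H g

/-- `CM_H = T(ℚ) \ G(𝔸_f) / H`. -/
def CMSpace (ι : K →ₐ[F] B) (H : Subgroup (Hat F B)ˣ) :=
  DoubleCoset.Quotient (rationalTorus ι : Set (Hat F B)ˣ) (H : Set (Hat F B)ˣ)

/-- The class of `g` in `CM_H`. -/
def CMSpace.mk (ι : K →ₐ[F] B) (H : Subgroup (Hat F B)ˣ) (g : (Hat F B)ˣ) : CMSpace ι H :=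
  DoubleCoset.mk (rationalTorus ι) H g

lemma CMSpace.mk_eq {ι : K →ₐ[F] B} {H : Subgroup (Hat F B)ˣ} {a b : (Hat F B)ˣ} :
    CMSpace.mk ι H a = CMSpace.mk ι H b ↔
      ∃ t ∈ rationalUnits F K, ∃ u ∈ H, b = torusMap ι t * a * u := by
  refine (DoubleCoset.eq (rationalTorus ι) H a b).trans ?_
  constructor
  · rintro ⟨_, ⟨t, ht, rfl⟩, u, hu, h⟩
    exact ⟨t, ht, u, hu, h⟩
  · rintro ⟨t, ht, u, hu, h⟩
    exact ⟨_, ⟨t, ht, rfl⟩, u, hu, h⟩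

lemma rationalTorus_le (ι : K →ₐ[F] B) : rationalTorus ι ≤ rationalUnits F B := by
  rintro _ ⟨_, ⟨k, rfl⟩, rfl⟩
  refine ⟨Units.map (ι : K →* B) k, ?_⟩
  ext
  simp [torusMap]

/-- The reduction map `red : CM_H → M_H`, `[g] ↦ [g]`. -/
def red (ι : K →ₐ[F] B) (H : Subgroup (Hat F B)ˣ) : CMSpace ι H → MSpace H :=
  Quotient.map' id fun a b h => by
    rw [DoubleCoset.rel_iff] at h ⊢
    obtain ⟨t, ht, u, hu, h⟩ := h
    exact ⟨t, rationalTorus_le ι ht, u, hu, h⟩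

/-- The action of `T(𝔸_f)` on `CM_H` by left multiplication. -/
instance (ι : K →ₐ[F] B) (H : Subgroup (Hat F B)ˣ) : MulAction (Hat F K)ˣ (CMSpace ι H) where
  smul t := Quotient.map' (fun g => torusMap ι t * g) fun a b h => by
    rw [DoubleCoset.rel_iff] at h ⊢
    obtain ⟨_, ⟨s, hs, rfl⟩, u, hu, rfl⟩ := h
    refine ⟨_, ⟨s, hs, rfl⟩, u, hu, ?_⟩
    simp only [← mul_assoc, ← map_mul, torus_mul_comm F K t s]
  one_smul x := by
    induction x using Quotient.inductionOn'
    change CMSpace.mk ι H _ = CMSpace.mk ι H _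
    simp
  mul_smul s t x := by
    induction x using Quotient.inductionOn'
    change CMSpace.mk ι H _ = CMSpace.mk ι H _
    simp [mul_assoc]

lemma smul_mk (ι : K →ₐ[F] B) (H : Subgroup (Hat F B)ˣ) (t : (Hat F K)ˣ) (g : (Hat F B)ˣ) :
    t • CMSpace.mk ι H g = CMSpace.mk ι H (torusMap ι t * g) := rfl

variable (P : HeightOneSpectrum (𝓞 F))

/-- `T(𝔸_f) ∩ g H g⁻¹ = Ô_{𝒫ⁿ}ˣ`. -/
def HasConductor (ι : K →ₐ[F] B) (H : Subgroup (Hat F B)ˣ) (n : ℕ) (g : (Hat F B)ˣ) : Prop :=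
  ∀ t : (Hat F K)ˣ, g⁻¹ * torusMap ι t * g ∈ H ↔ t ∈ hatUnits (condOrder K P n)

/-- The set `CM_H(𝒫ⁿ)` of CM points of conductor `𝒫ⁿ`. -/
def CMSet (ι : K →ₐ[F] B) (H : Subgroup (Hat F B)ˣ) (n : ℕ) : Set (CMSpace ι H) :=
  {x | ∃ g, CMSpace.mk ι H g = x ∧ HasConductor P ι H n g}

variable {P}

lemma HasConductor.smul {ι : K →ₐ[F] B} {H : Subgroup (Hat F B)ˣ} {n : ℕ} {g : (Hat F B)ˣ}
    (h : HasConductor P ι H n g) (s : (Hat F K)ˣ) :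
    HasConductor P ι H n (torusMap ι s * g) := by
  intro t
  rw [← h t]
  have : (torusMap ι s * g)⁻¹ * torusMap ι t * (torusMap ι s * g) = g⁻¹ * torusMap ι t * g := by
    have h2 : torusMap ι t * torusMap ι s = torusMap ι s * torusMap ι t := by
      rw [← map_mul, torus_mul_comm F K t s, map_mul]
    rw [mul_inv_rev, mul_assoc, mul_assoc, ← mul_assoc (torusMap ι t), h2]
    group
  rw [this]

/-- The action of `T(𝔸_f)` on `CM_H(𝒫ⁿ)`. -/
instance (ι : K →ₐ[F] B) (H : Subgroup (Hat F B)ˣ) (n : ℕ) :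
    MulAction (Hat F K)ˣ (CMSet P ι H n) where
  smul t x := ⟨t • x.1, by
    obtain ⟨_, g, rfl, hg⟩ := x
    exact ⟨_, (smul_mk ι H t g).symm, hg.smul t⟩⟩
  one_smul x := Subtype.ext (one_smul _ x.1)
  mul_smul s t x := Subtype.ext (mul_smul s t x.1)

/-- The action of `G(n)` on `CM_H(𝒫ⁿ)`: the class of `β ∈ T(𝔸_f)` sends `[g]` to `[β g]`. -/
def galAction (ι : K →ₐ[F] B) (H : Subgroup (Hat F B)ˣ) (n : ℕ) :
    GalGroup K P n →* Equiv.Perm (CMSet P ι H n) :=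
  QuotientGroup.lift _ (MulAction.toPermHom (Hat F K)ˣ (CMSet P ι H n)) <| by
    intro t ht
    have key : ringClassSubgroup K P n ≤
        (MulAction.toPermHom (Hat F K)ˣ (CMSet P ι H n)).ker := by
      refine sup_le ?_ ?_
      · intro t ht
        ext ⟨_, g, rfl, hg⟩
        change t • CMSpace.mk ι H g = CMSpace.mk ι H g
        rw [smul_mk, eq_comm, CMSpace.mk_eq]
        exact ⟨t, ht, 1, one_mem H, by simp⟩
      · intro t ht
        ext ⟨_, g, rfl, hg⟩
        change t • CMSpace.mk ι H g = CMSpace.mk ι H g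
        rw [smul_mk, eq_comm, CMSpace.mk_eq]
        exact ⟨1, one_mem _, _, (hg t).2 ht, by simp [mul_assoc]⟩
    exact key ht

end CM

/-! ### Local data at `𝒫` -/

section Local

variable {F : Type*} [Field F] [NumberField F] (P : HeightOneSpectrum (𝓞 F))

/-- The ideal `𝒫ᵏ` of `O_{F,𝒫}`. -/
def pPow (k : ℕ) : Ideal (P.adicCompletionIntegers F) :=
  IsLocalRing.maximalIdeal (P.adicCompletionIntegers F) ^ k

/-- `M⁰(𝒫ᵏ)`: the matrices over `O_{F,𝒫}` with `b ≡ 0 mod 𝒫ᵏ`. -/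
def M0 (k : ℕ) : Subring (Matrix (Fin 2) (Fin 2) (P.adicCompletionIntegers F)) where
  carrier := {M | M 0 1 ∈ pPow P k}
  mul_mem' {M N} hM hN := by
    simp only [Set.mem_ofPred_eq, Matrix.mul_apply, Fin.sum_univ_two] at *
    exact add_mem (Ideal.mul_mem_left _ _ hN) (Ideal.mul_mem_right _ _ hM)
  one_mem' := by simp
  add_mem' {M N} hM hN := (pPow P k).add_mem hM hN
  zero_mem' := by simp
  neg_mem' {M} hM := (pPow P k).neg_mem hM

/-- The matrices over `O_{F,𝒫}` with `c ≡ 0` and `a ≡ d mod 𝒫ᵏ`. -/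
def lowerRing (k : ℕ) : Subring (Matrix (Fin 2) (Fin 2) (P.adicCompletionIntegers F)) where
  carrier := {M | M 1 0 ∈ pPow P k ∧ M 0 0 - M 1 1 ∈ pPow P k}
  mul_mem' {M N} hM hN := by
    simp only [Set.mem_ofPred_eq, Matrix.mul_apply, Fin.sum_univ_two] at *
    refine ⟨add_mem (Ideal.mul_mem_right _ _ hM.1) (Ideal.mul_mem_left _ _ hN.1), ?_⟩
    have : M 0 0 * N 0 0 + M 0 1 * N 1 0 - (M 1 0 * N 0 1 + M 1 1 * N 1 1)
        = (M 0 0 - M 1 1) * N 0 0 + M 1 1 * (N 0 0 - N 1 1) + M 0 1 * N 1 0 - M 1 0 * N 0 1 := by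
      ring
    rw [this]
    exact sub_mem (add_mem (add_mem (Ideal.mul_mem_right _ _ hM.2)
      (Ideal.mul_mem_left _ _ hN.2)) (Ideal.mul_mem_left _ _ hN.1)) (Ideal.mul_mem_right _ _ hM.1)
  one_mem' := by simp
  add_mem' {M N} hM hN := by
    refine ⟨add_mem hM.1 hN.1, ?_⟩
    have : (M + N) 0 0 - (M + N) 1 1 = (M 0 0 - M 1 1) + (N 0 0 - N 1 1) := by
      simp only [Matrix.add_apply]
      ring
    rw [this]
    exact add_mem hM.2 hN.2
  zero_mem' := by simp
  neg_mem' {M} hM := by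
    refine ⟨neg_mem (S := Ideal _) hM.1, ?_⟩
    have : (-M) 0 0 - (-M) 1 1 = -(M 0 0 - M 1 1) := by
      simp only [Matrix.neg_apply]
      ring
    rw [this]
    exact neg_mem (S := Ideal _) hM.2

/-- The matrices over `O_{F,𝒫}` with `b ≡ 0` and `a ≡ d mod 𝒫ᵏ`. -/
def upperRing (k : ℕ) : Subring (Matrix (Fin 2) (Fin 2) (P.adicCompletionIntegers F)) where
  carrier := {M | M 0 1 ∈ pPow P k ∧ M 0 0 - M 1 1 ∈ pPow P k}
  mul_mem' {M N} hM hN := by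
    simp only [Set.mem_ofPred_eq, Matrix.mul_apply, Fin.sum_univ_two] at *
    refine ⟨add_mem (Ideal.mul_mem_left _ _ hN.1) (Ideal.mul_mem_right _ _ hM.1), ?_⟩
    have : M 0 0 * N 0 0 + M 0 1 * N 1 0 - (M 1 0 * N 0 1 + M 1 1 * N 1 1)
        = (M 0 0 - M 1 1) * N 0 0 + M 1 1 * (N 0 0 - N 1 1) + M 0 1 * N 1 0 - M 1 0 * N 0 1 := by
      ring
    rw [this]
    exact sub_mem (add_mem (add_mem (Ideal.mul_mem_right _ _ hM.2)
      (Ideal.mul_mem_left _ _ hN.2)) (Ideal.mul_mem_right _ _ hM.1)) (Ideal.mul_mem_left _ _ hN.1)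
  one_mem' := by simp
  add_mem' {M N} hM hN := by
    refine ⟨add_mem hM.1 hN.1, ?_⟩
    have : (M + N) 0 0 - (M + N) 1 1 = (M 0 0 - M 1 1) + (N 0 0 - N 1 1) := by
      simp only [Matrix.add_apply]
      ring
    rw [this]
    exact add_mem hM.2 hN.2
  zero_mem' := by simp
  neg_mem' {M} hM := by
    refine ⟨neg_mem (S := Ideal _) hM.1, ?_⟩
    have : (-M) 0 0 - (-M) 1 1 = -(M 0 0 - M 1 1) := by
      simp only [Matrix.neg_apply]
      ring
    rw [this]
    exact neg_mem (S := Ideal _) hM.2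

/-- `K₁(𝒫ᵏ) ⊆ GL₂(O_{F,𝒫})`: the matrices with `c ≡ 0` and `a ≡ d mod 𝒫ᵏ`. -/
def lowerK (k : ℕ) : Subgroup (GL (Fin 2) (P.adicCompletionIntegers F)) :=
  (lowerRing P k).toSubmonoid.units

/-- `K¹(𝒫ᵏ) ⊆ GL₂(O_{F,𝒫})`: the matrices with `b ≡ 0` and `a ≡ d mod 𝒫ᵏ`. -/
def upperK (k : ℕ) : Subgroup (GL (Fin 2) (P.adicCompletionIntegers F)) :=
  (upperRing P k).toSubmonoid.units

/-- The congruence subgroup of `GL₂(O_{F,𝒫})` whose conjugate by `h_𝒫` cuts out `H_m` inside `H`. -/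
def levelK (δ m : ℕ) : Subgroup (GL (Fin 2) (P.adicCompletionIntegers F)) :=
  if δ < m then lowerK P (2 * m - δ)
  else if δ < 2 * m then lowerK P m
  else upperK P m

variable {P} {K : Type*} [Field K] [NumberField K] [Algebra F K]
  {B : Type*} [Ring B] [Algebra F B]

/-- The choices made at `𝒫`: a uniformizer `ϖ`; an element `α ∈ O_{K,𝒫}` such that `{1, α}` is an
`O_{F,𝒫}`-basis of `O_{K,𝒫}`; an identification `φ : B_𝒫 ≃ M₂(F_𝒫)` under which
`a + b α ∈ K_𝒫 ⊆ B_𝒫` becomes `!![a + b Tr α, b; -b N α, a]`; and a matrix `h ∈ GL₂(F_𝒫)`. -/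
structure LocalData (ι : K →ₐ[F] B) (P : HeightOneSpectrum (𝓞 F)) where
  ϖ : P.adicCompletionIntegers F
  irreducible_ϖ : Irreducible ϖ
  α : AtP P K
  α_mem : α ∈ locOrder P (integralClosure (𝓞 F) K)
  basis : ∀ y ∈ locOrder P (integralClosure (𝓞 F) K),
    ∃! c : P.adicCompletionIntegers F × P.adicCompletionIntegers F,
      y = (c.1 : P.adicCompletion F) • (1 : AtP P K) + (c.2 : P.adicCompletion F) • α
  φ : AtP P B ≃ₐ[P.adicCompletion F] Matrix (Fin 2) (Fin 2) (P.adicCompletion F)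
  φ_α : φ (Algebra.TensorProduct.map (AlgHom.id F (P.adicCompletion F)) ι α) =
    !![Algebra.trace (P.adicCompletion F) (AtP P K) α, 1;
       -Algebra.norm (P.adicCompletion F) α, 0]
  h : GL (Fin 2) (P.adicCompletion F)

namespace LocalData

variable {ι : K →ₐ[F] B} (L : LocalData ι P)

/-- `R_𝒫 = h M⁰(𝒫^δ) h⁻¹` under the identification `φ`. -/
def IsEichler (δ : ℕ) (R : Subalgebra (𝓞 F) B) : Prop :=
  ∀ y : AtP P B, y ∈ locOrder P R ↔
    ∃ M ∈ M0 P δ, L.φ y = (L.h : Matrix (Fin 2) (Fin 2) (P.adicCompletion F)) *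
      M.map (P.adicCompletionIntegers F).subtype *
        ((L.h⁻¹ : GL (Fin 2) (P.adicCompletion F)) : Matrix (Fin 2) (Fin 2) (P.adicCompletion F))

/-- The `𝒫`-component `G(𝔸_f) → B_𝒫ˣ = GL₂(F_𝒫)`. -/
def comp : (Hat F B)ˣ →* GL (Fin 2) (P.adicCompletion F) :=
  (Units.map (L.φ : AtP P B →* Matrix (Fin 2) (Fin 2) (P.adicCompletion F))).comp
    (Units.map ((toP P : Hat F B →ₐ[F] AtP P B) : Hat F B →* AtP P B))

/-- The subgroup `H_m` of `H = R̂ˣ`: it agrees with `H` outside `𝒫`, and at `𝒫` it is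
`R_𝒫ˣ ∩ h K₁(𝒫^{2m-δ}) h⁻¹` if `δ < m`, `R_𝒫ˣ ∩ h K₁(𝒫^m) h⁻¹` if `m ≤ δ < 2m`, and
`R_𝒫ˣ ∩ h K¹(𝒫^m) h⁻¹` otherwise. -/
def levelH (δ m : ℕ) (R : Subalgebra (𝓞 F) B) : Subgroup (Hat F B)ˣ :=
  hatUnits R ⊓
    ((((levelK P δ m).map
      (Matrix.GeneralLinearGroup.map (P.adicCompletionIntegers F).subtype)).map
        (MulAut.conj L.h).toMonoidHom).comap L.comp)

/-- `α_{a,m} ∈ G(𝔸_f)`: the element with component `h !![1, a ϖ^{δ-m}; 0, 1] h⁻¹` at `𝒫` and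
`1` elsewhere. -/
def unip (δ m : ℕ) (a : P.adicCompletionIntegers F) : (Hat F B)ˣ :=
  localUnit P <|
    Units.map (L.φ.symm : Matrix (Fin 2) (Fin 2) (P.adicCompletion F) →* AtP P B) <|
      L.h * Matrix.GeneralLinearGroup.upperRightHom
        ((a : P.adicCompletion F) * (L.ϖ : P.adicCompletion F) ^ ((δ : ℤ) - (m : ℤ))) * L.h⁻¹

open Classical in
/-- `λ_{a,𝒫} = 1 + a α ϖ^{n-m}` as an element of `K_𝒫ˣ` (for `n > m` it is a unit). -/
def lamLoc (n m : ℕ) (a : P.adicCompletionIntegers F) : (AtP P K)ˣ :=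
  if hu : IsUnit (1 + ((a : P.adicCompletion F) * (L.ϖ : P.adicCompletion F) ^ (n - m)) • L.α)
  then hu.unit else 1

/-- `τ_a`: the class of `λ_a = (1, …, λ_{a,𝒫}, …, 1) ∈ T(𝔸_f)` in `H(n)`. -/
def tau (n m : ℕ) (a : P.adicCompletionIntegers F) : AntiGroup K P n :=
  QuotientGroup.mk (QuotientGroup.mk (localUnit P (L.lamLoc n m a)) : GalGroup K P n)

/-- `θ_m = ∑_{a ∈ O_{F,𝒫}/𝒫^m} χ₁(τ_a) (α_{a,m} · θ)` as a function on `G(𝔸_f)`, where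
`(α · θ)(g) = θ(g α)`. Neither `χ₁(τ_a)` nor `α_{a,m} · θ` depends on the representative of `a`. -/
def thetaM (δ n m : ℕ) {R : Subalgebra (𝓞 F) B} {A : Type*} [CommRing A]
    (θ : MSpace (hatUnits R) → A) (χ₁ : AntiGroup K P n →* Aˣ) (g : (Hat F B)ˣ) : A :=
  ∑ᶠ c : P.adicCompletionIntegers F ⧸ pPow P m,
    let a := Function.surjInv (Ideal.Quotient.mk_surjective (I := pPow P m)) c
    (χ₁ (L.tau n m a) : A) * θ (MSpace.mk (hatUnits R) (g * L.unip δ m a))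

/-- `x ∈ CM_H(𝒫ⁿ)` is of the form `σ.z` with `σ ∈ G(n)` and `z = [g₀] ∈ CM_H(𝒫ⁿ)` such that the
`𝒫`-component of `g₀` is `k_𝒫 h_𝒫⁻¹`, where `k_𝒫 = !![ϖ^{n-δ}, 0; 0, 1]`. -/
def InBaseOrbit (δ n : ℕ) {H : Subgroup (Hat F B)ˣ} (x : CMSet P ι H n) : Prop :=
  ∃ (g₀ : (Hat F B)ˣ) (hg₀ : HasConductor P ι H n g₀),
    (L.comp g₀ : Matrix (Fin 2) (Fin 2) (P.adicCompletion F)) =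
        !![(L.ϖ : P.adicCompletion F) ^ ((n : ℤ) - (δ : ℤ)), 0; 0, 1] *
          ((L.h⁻¹ : GL (Fin 2) (P.adicCompletion F)) :
            Matrix (Fin 2) (Fin 2) (P.adicCompletion F)) ∧
      ∃ σ : GalGroup K P n, x = galAction ι H n σ ⟨CMSpace.mk ι H g₀, g₀, rfl, hg₀⟩

end LocalData

end Local

end CMPoints

end

/-! Everything happens at `P`. Write `y = X y + Y y · α` for `y ∈ K_P`; locally the order of
conductor `P ^ k` is given by `X y` integral and `Y y ∈ P ^ k` (`mem_locOrder_condOrder`). At a base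
point `g₀` with component `diag(ϖ^(n-δ), 1) h⁻¹`, conjugating `λ_a = 1 + a α ϖ^(n-m)` by `g₀` and
then by `h` gives a matrix with upper right entry `a ϖ^(δ-m)`, the entry of the unipotent matrix in
`α_{a,m}`. The quotient of the two lies in `R_P^×` (`IsEichler.unip_inv_mul_mem`), so `λ_a g₀ ∈ g₀
α_{a,m} H`. The torus being commutative, the same holds for every translate `s g₀` by a torus
element. Hence `θ(s g₀ α_{a,m})` is the value of `ψ` at `τ_a.[s g₀]`, and the sum over `a` defining
`θ_m` is the twisted sum over `Z(n,m)`. The point `x_m` is the class of the same adelic element `s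
g₀`: the units of `O_{P^n}`, seen from `g₀`, already satisfy the congruences of `H_m`
(`IsEichler.hasConductor_levelH`).

Invariance of `θ_m` under `H_m` holds term by term, because `α_{a,m}⁻¹ H_m α_{a,m} ⊆ H`
(`isM0_conj_unipotent`). The order `R_m` is cut out of `R` by the congruences at `P`; it contains
`P^(2m) R`, which makes it an order with the prescribed completions.

Two facts on ring class groups are needed. For large conductor the global units of `O_{P^k}` come
from `O_F` (`LocalData.exists_conductor`, from finiteness of the torsion of `O_K^×`), so the kernel
of `G(n) → G(n-m)` is a quotient of local units, parametrized by `a` modulo `P^m`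
(`lamKer_bijective`). Moreover a torsion element of `G(∞)` which dies at a high level is trivial,
since taking `q`-th powers of local units near `O_{F,P}^×` shifts the valuation of `Y` by at most
that of `q` (`LocalData.exists_torsionFree`). This identifies that kernel with `Z(n,m)`.

For `δ = 0` the base point condition is automatic: in odd residue characteristic a lattice of `K_P`
whose units of multipliers are those of `O_{P^n}` is a multiple of `O_{P^n}` (`exists_eq_emb_mul`),
so each CM point is a torus translate of a base point. -/

noncomputable section

namespace CMPoints

set_option linter.unusedSectionVars false

/-! ### Fractional ideals, uniformizers and approximation at `P`. -/

section LocalField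

variable {F : Type*} [Field F] [NumberField F] (P : HeightOneSpectrum (𝓞 F))

/-- The fractional ideal `𝒫ⁿ` of `F_𝒫`, for `n ∈ ℤ`. -/
def pBall (n : ℤ) : AddSubgroup (P.adicCompletion F) where
  carrier := {x | Valued.v x ≤ WithZero.exp (-n)}
  zero_mem' := by simp
  add_mem' {x y} hx hy := by
    rw [Set.mem_ofPred_eq] at *
    exact (Valuation.map_add _ _ _).trans (max_le hx hy)
  neg_mem' hx := by simpa [Valuation.map_neg] using hx

variable {P}

lemma mem_pBall {n : ℤ} {x : P.adicCompletion F} :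
    x ∈ pBall P n ↔ Valued.v x ≤ WithZero.exp (-n) := by
  change x ∈ {x | Valued.v x ≤ WithZero.exp (-n)} ↔ _
  rw [Set.mem_ofPred_eq]

lemma pBall_anti {a b : ℤ} (h : a ≤ b) {x : P.adicCompletion F} (hx : x ∈ pBall P b) :
    x ∈ pBall P a :=
  mem_pBall.2 (le_trans (mem_pBall.1 hx) (WithZero.exp_le_exp.2 (by omega)))

lemma pBall_mul {a b c : ℤ} (h : c ≤ a + b) {x y : P.adicCompletion F} (hx : x ∈ pBall P a)
    (hy : y ∈ pBall P b) : x * y ∈ pBall P c := by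
  refine pBall_anti h ?_
  rw [mem_pBall] at *
  rw [map_mul, neg_add, WithZero.exp_add]
  exact mul_le_mul' hx hy

lemma mem_pBall_zero {x : P.adicCompletion F} :
    x ∈ pBall P 0 ↔ x ∈ P.adicCompletionIntegers F := by
  rw [mem_pBall, HeightOneSpectrum.mem_adicCompletionIntegers]
  simp

lemma coe_mem_pBall_zero (x : P.adicCompletionIntegers F) : (x : P.adicCompletion F) ∈ pBall P 0 :=
  mem_pBall_zero.2 x.2

/-- An irreducible element generates the maximal ideal, so it divides a global element of valuation
one; being a nonunit itself, it must have the same valuation. -/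
lemma valued_uniformizer {ϖ : P.adicCompletionIntegers F} (h : Irreducible ϖ) :
    Valued.v (ϖ : P.adicCompletion F) = WithZero.exp (-1 : ℤ) := by
  obtain ⟨π, hπ⟩ := P.intValuation_exists_uniformizer
  have hv : Valued.v (algebraMap F (P.adicCompletion F) (π : F)) = WithZero.exp (-1 : ℤ) :=
    (P.valuedAdicCompletion_eq_valuation' _).trans ((P.valuation_of_algebraMap π).trans hπ)
  have hmem : algebraMap F (P.adicCompletion F) (π : F) ∈ P.adicCompletionIntegers F := by
    rw [HeightOneSpectrum.mem_adicCompletionIntegers, hv, ← WithZero.exp_zero,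
      WithZero.exp_le_exp]
    omega
  have hnu : ¬ IsUnit (⟨_, hmem⟩ : P.adicCompletionIntegers F) := by
    rw [HeightOneSpectrum.adicCompletionIntegers.isUnit_iff_valued_eq_one]
    change ¬ Valued.v (algebraMap F (P.adicCompletion F) (π : F)) = 1
    rw [hv, ← WithZero.exp_zero, WithZero.exp_inj]
    omega
  have hdvd : ϖ ∣ ⟨_, hmem⟩ := by
    rw [← Ideal.mem_span_singleton, ← h.maximalIdeal_eq]
    exact hnu
  have h1 : WithZero.exp (-1 : ℤ) ≤ Valued.v (ϖ : P.adicCompletion F) := by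
    obtain ⟨c, hc⟩ := hdvd
    have hc' : algebraMap F (P.adicCompletion F) (π : F) = (ϖ : P.adicCompletion F) * c :=
      congrArg Subtype.val hc
    rw [← hv, hc', map_mul]
    exact mul_le_of_le_one_right' c.2
  have h2 : Valued.v (ϖ : P.adicCompletion F) < 1 := by
    refine lt_of_le_of_ne ϖ.2 fun h1 => h.not_isUnit ?_
    exact HeightOneSpectrum.adicCompletionIntegers.isUnit_iff_valued_eq_one.2 h1
  have h0 : Valued.v (ϖ : P.adicCompletion F) ≠ 0 := by
    rw [Valuation.ne_zero_iff]
    exact fun h0 => h.ne_zero (Subtype.ext h0)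
  refine le_antisymm ?_ h1
  rw [← WithZero.exp_log h0, ← WithZero.exp_zero, WithZero.exp_lt_exp] at h2
  rw [← WithZero.exp_log h0, WithZero.exp_le_exp]
  omega

lemma valued_uniformizer_zpow {ϖ : P.adicCompletionIntegers F} (h : Irreducible ϖ) (k : ℤ) :
    Valued.v ((ϖ : P.adicCompletion F) ^ k) = WithZero.exp (-k) := by
  rw [map_zpow₀, valued_uniformizer h, ← WithZero.exp_zsmul]
  simp

lemma uniformizer_ne_zero {ϖ : P.adicCompletionIntegers F} (h : Irreducible ϖ) :
    (ϖ : P.adicCompletion F) ≠ 0 := fun h0 => h.ne_zero (Subtype.ext h0)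

lemma uniformizer_zpow_mem {ϖ : P.adicCompletionIntegers F} (h : Irreducible ϖ) (k : ℤ) :
    (ϖ : P.adicCompletion F) ^ k ∈ pBall P k :=
  mem_pBall.2 (valued_uniformizer_zpow h k).le

lemma uniformizer_pow_mem {ϖ : P.adicCompletionIntegers F} (h : Irreducible ϖ) (k : ℕ) :
    (ϖ : P.adicCompletion F) ^ k ∈ pBall P k := by
  simpa using uniformizer_zpow_mem h k

/-- An element whose valuation is exactly `n` generates `𝒫ⁿ`. -/
lemma div_mem_pBall {n k : ℤ} {x g : P.adicCompletion F} (hx : x ∈ pBall P n)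
    (hg : Valued.v g = WithZero.exp (-k)) : x / g ∈ pBall P (n - k) := by
  rw [mem_pBall] at *
  rw [map_div₀, hg, div_le_iff₀ (by simp), ← WithZero.exp_add]
  convert hx using 2
  omega

lemma inv_mem_pBall_zero {x : P.adicCompletion F} (h : Valued.v x = 1) : x⁻¹ ∈ pBall P 0 := by
  rw [mem_pBall, map_inv₀, h]; simp

lemma valued_sub_eq_one {x y : P.adicCompletion F} (hx : Valued.v x = 1) (hy : y ∈ pBall P 1) :
    Valued.v (x - y) = 1 := by
  rw [Valuation.map_sub_eq_of_lt_left, hx]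
  refine lt_of_le_of_lt (mem_pBall.1 hy) ?_
  rw [hx, ← WithZero.exp_zero, WithZero.exp_lt_exp]; omega

lemma valued_add_eq_one {x y : P.adicCompletion F} (hx : Valued.v x = 1) (hy : y ∈ pBall P 1) :
    Valued.v (x + y) = 1 := by
  simpa using valued_sub_eq_one hx (neg_mem hy)

/-- An integral element is a unit or lies in the maximal ideal. -/
lemma valued_eq_one_or {x : P.adicCompletion F} (hx : x ∈ pBall P 0) :
    Valued.v x = 1 ∨ x ∈ pBall P 1 := by
  by_cases h0 : x = 0
  · right; simp [h0]
  have h0 : Valued.v x ≠ 0 := by simpa using h0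
  rw [mem_pBall] at *
  rw [← WithZero.exp_log h0, WithZero.exp_le_exp]
  rw [← WithZero.exp_log h0] at hx
  rw [← WithZero.exp_zero, WithZero.exp_inj]
  rw [WithZero.exp_le_exp] at hx
  omega

lemma mem_pPow_iff {k : ℕ} {a : P.adicCompletionIntegers F} :
    a ∈ pPow P k ↔ (a : P.adicCompletion F) ∈ pBall P k := by
  obtain ⟨ϖ, hϖ⟩ := IsDiscreteValuationRing.exists_irreducible (P.adicCompletionIntegers F)
  have hI := HeightOneSpectrum.adicCompletionIntegers.integers (R := 𝓞 F) (K := F) (v := P)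
  rw [pPow, hϖ.maximalIdeal_eq, Ideal.span_singleton_pow, Ideal.mem_span_singleton,
    hI.dvd_iff_le, mem_pBall]
  have : Valued.v (algebraMap (P.adicCompletionIntegers F) (P.adicCompletion F) (ϖ ^ k))
      = WithZero.exp (-(k : ℤ)) := by
    rw [← valued_uniformizer_zpow hϖ]
    simp
  rw [this]
  rfl

lemma valued_algebraMap (x : F) :
    Valued.v (algebraMap F (P.adicCompletion F) x) = P.valuation F x :=
  P.valuedAdicCompletion_eq_valuation' x

lemma algebraMap_mem_pBall {c : 𝓞 F} {n : ℕ} :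
    algebraMap F (P.adicCompletion F) (c : F) ∈ pBall P n ↔ c ∈ P.asIdeal ^ n := by
  rw [mem_pBall, valued_algebraMap]
  exact (congrArg (· ≤ _) (P.valuation_of_algebraMap (K := F) c)).to_iff.trans
    (P.intValuation_le_pow_iff_mem c n)

lemma algebraMap_mem_pBall_zero (c : 𝓞 F) :
    algebraMap F (P.adicCompletion F) (c : F) ∈ pBall P 0 := by
  simpa using (algebraMap_mem_pBall (P := P) (n := 0) (c := c)).2 (by simp)

/-- `O_F` is dense in `O_{F,𝒫}`. -/
lemma exists_integer_sub_mem_pBall {x : P.adicCompletion F} (hx : x ∈ pBall P 0) (n : ℕ) :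
    ∃ c : 𝓞 F, x - algebraMap F (P.adicCompletion F) (c : F) ∈ pBall P n := by
  -- The ball is the preimage of the valuation ring under multiplication by `ϖ ^ (-n)`. Density of
  -- `F` then gives an approximation in `F`, and a second approximation moves it into `O_F`.
  have hopen : IsOpen ((pBall P n : AddSubgroup (P.adicCompletion F)) :
      Set (P.adicCompletion F)) := by
    obtain ⟨ϖ, hϖ⟩ := IsDiscreteValuationRing.exists_irreducible (P.adicCompletionIntegers F)
    have h := (Valued.isOpen_valuationSubring (P.adicCompletion F)).preimage
      (continuous_mul_const ((ϖ : P.adicCompletion F) ^ (-(n : ℤ))))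
    convert h using 1
    ext x
    rw [SetLike.mem_coe, Set.mem_preimage, SetLike.mem_coe]
    change _ ↔ _ ∈ P.adicCompletionIntegers F
    rw [← mem_pBall_zero]
    constructor
    · exact fun hx => pBall_mul (by omega) hx (uniformizer_zpow_mem hϖ _)
    · intro hx
      have := pBall_mul (c := n) (by omega) hx (uniformizer_zpow_mem hϖ n)
      rwa [mul_assoc, ← zpow_add₀ (uniformizer_ne_zero hϖ), neg_add_cancel, zpow_zero,
        mul_one] at this
  obtain ⟨y, hy⟩ := (P.denseRange_algebraMap F).exists_mem_open
    (hopen.preimage (continuous_sub_left x))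
    ⟨x, by simp⟩
  simp only [Set.mem_preimage, SetLike.mem_coe] at hy
  have hy0 : algebraMap F (P.adicCompletion F) y ∈ pBall P 0 := by
    have := sub_mem hx (pBall_anti (by omega : (0 : ℤ) ≤ n) hy)
    simpa using this
  rw [mem_pBall, valued_algebraMap] at hy0
  obtain ⟨c, hc⟩ := P.exists_valuation_sub_lt_of_integer (K := F) (x := y) (by simpa using hy0)
    (Units.mk0 (WithZero.exp (-(n : ℤ))) (by simp))
  refine ⟨c, ?_⟩
  have h2 : algebraMap F (P.adicCompletion F) ((c : F) - y) ∈ pBall P n := by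
    rw [mem_pBall, valued_algebraMap]
    exact hc.le
  rw [map_sub] at h2
  convert sub_mem hy h2 using 1
  ring

variable (P) in
/-- Some power of `𝒫` is principal. -/
lemma exists_generator_pow :
    ∃ t : ℕ, 1 ≤ t ∧ ∃ π : 𝓞 F, P.asIdeal ^ t = Ideal.span {π} := by
  classical
  -- The exponent is the class number.
  refine ⟨Fintype.card (ClassGroup (𝓞 F)), Fintype.card_pos, ?_⟩
  have h0 : P.asIdeal ∈ nonZeroDivisors (Ideal (𝓞 F)) :=
    mem_nonZeroDivisors_of_ne_zero P.ne_bot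
  have h1 : ClassGroup.mk0 (⟨P.asIdeal, h0⟩ ^ Fintype.card (ClassGroup (𝓞 F))) = 1 := by
    rw [map_pow, pow_card_eq_one]
  have h2 := (ClassGroup.mk0_eq_one_iff (pow_mem h0 _)).1 h1
  exact (Submodule.isPrincipal_iff _).1 h2

variable (P) in
/-- For every `N` there is an element of `P ^ N` generating a power of `P`. -/
lemma exists_isolated (N : ℕ) :
    ∃ π : 𝓞 F, π ∈ P.asIdeal ^ N ∧ π ≠ 0 ∧
      (∃ t : ℕ, N ≤ t ∧ Valued.v (algebraMap F (P.adicCompletion F) (π : F)) =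
        WithZero.exp (-(t : ℤ))) ∧
      ∀ v : HeightOneSpectrum (𝓞 F), v ≠ P →
        Valued.v (algebraMap F (v.adicCompletion F) (π : F)) = 1 := by
  -- A generator of a power of `P` lies in no other prime, hence is a unit elsewhere; raising it to
  -- the power `N` makes it small at `P`.
  obtain ⟨t, ht, π, hπ⟩ := exists_generator_pow P
  have hspan : P.asIdeal ^ (t * N) = Ideal.span {π ^ N} := by
    rw [pow_mul, hπ, Ideal.span_singleton_pow]
  have hmem : π ^ N ∈ P.asIdeal ^ (t * N) := hspan ▸ Ideal.mem_span_singleton_self _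
  have h0 : π ^ N ≠ 0 := by
    intro h
    rw [h, Ideal.span_singleton_eq_bot.2 rfl] at hspan
    exact P.ne_bot (eq_zero_of_pow_eq_zero hspan)
  refine ⟨π ^ N, Ideal.pow_le_pow_right (Nat.le_mul_of_pos_left N ht) hmem, h0,
    ⟨t * N, Nat.le_mul_of_pos_left N ht, ?_⟩, ?_⟩
  · refine le_antisymm (mem_pBall.1 (algebraMap_mem_pBall.2 hmem)) ?_
    obtain ⟨ϖ, hϖ⟩ := P.intValuation_exists_uniformizer
    have h1 : ϖ ^ (t * N) ∈ P.asIdeal ^ (t * N) := by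
      refine Ideal.pow_mem_pow ?_ _
      rw [← pow_one P.asIdeal, ← P.intValuation_le_pow_iff_mem, hϖ]
      rfl
    rw [hspan, Ideal.mem_span_singleton] at h1
    obtain ⟨c, hc⟩ := h1
    have h2 : P.intValuation (ϖ ^ (t * N)) ≤ P.intValuation (π ^ N) := by
      rw [hc, map_mul]
      exact mul_le_of_le_one_right' (P.intValuation_le_one c)
    rw [valued_algebraMap]
    refine le_trans ?_ (h2.trans (P.valuation_of_algebraMap (K := F) (π ^ N)).ge)
    rw [map_pow, hϖ, ← WithZero.exp_nsmul]
    simp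
  · intro v hv
    rw [valued_algebraMap]
    refine (v.valuation_of_algebraMap (K := F) (π ^ N)).trans ?_
    rw [HeightOneSpectrum.intValuation_eq_one_iff]
    intro hmem
    apply hv
    have h1 : P.asIdeal ^ (t * N) ≤ v.asIdeal := by
      rw [hspan, Ideal.span_singleton_le_iff_mem]
      exact hmem
    have h2 := v.isPrime.le_of_pow_le h1
    exact HeightOneSpectrum.ext (P.isMaximal.eq_of_le v.isPrime.ne_top h2).symm

variable (P) in
/-- `P ^ n` contains an element of valuation exactly `n`. -/
lemma exists_mem_pow_valued_eq (n : ℕ) :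
    ∃ π : 𝓞 F, π ∈ P.asIdeal ^ n ∧
      Valued.v (algebraMap F (P.adicCompletion F) (π : F)) = WithZero.exp (-(n : ℤ)) := by
  obtain ⟨ϖ, hϖ⟩ := P.intValuation_exists_uniformizer
  have h : P.intValuation (ϖ ^ n) = WithZero.exp (-(n : ℤ)) := by
    rw [map_pow, hϖ, ← WithZero.exp_nsmul]
    simp
  refine ⟨ϖ ^ n, (P.intValuation_le_pow_iff_mem _ _).1 h.le, ?_⟩
  rw [valued_algebraMap]
  exact (P.valuation_of_algebraMap (K := F) _).trans h

/-- The powers of `𝒫` have trivial intersection. -/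
lemma eq_zero_of_forall_mem_pBall {x : P.adicCompletion F} (h : ∀ n : ℕ, x ∈ pBall P n) :
    x = 0 := by
  by_contra h0
  have h0 : Valued.v x ≠ 0 := by simpa using h0
  have := h ((-WithZero.log (Valued.v x)).toNat + 1)
  rw [mem_pBall, ← WithZero.exp_log h0, WithZero.exp_le_exp, WithZero.log_exp] at this
  omega

variable (P) in
/-- The `𝒫`-adic valuations of the rational primes are bounded. -/
lemma exists_forall_prime_notMem :
    ∃ e : ℕ, ∀ q : ℕ, q.Prime → (q : P.adicCompletion F) ∉ pBall P (e + 1) := by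
  have hcast (q : ℕ) (n : ℕ) : (q : P.adicCompletion F) ∈ pBall P n ↔
      (q : 𝓞 F) ∈ P.asIdeal ^ n := by
    rw [← algebraMap_mem_pBall]
    simp
  -- Only the residue characteristic can have positive valuation: two distinct primes are coprime
  -- and cannot both lie in `P`.
  by_cases h : ∃ p : ℕ, p.Prime ∧ (p : 𝓞 F) ∈ P.asIdeal
  · obtain ⟨p, hp, hpP⟩ := h
    have h0 : (p : P.adicCompletion F) ≠ 0 := by
      have : ((p : F) : F) ≠ 0 := by exact_mod_cast hp.ne_zero
      simpa using (map_ne_zero (algebraMap F (P.adicCompletion F))).2 this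
    obtain ⟨e, he⟩ : ∃ e : ℕ, (p : P.adicCompletion F) ∉ pBall P e := by
      by_contra! hcon
      exact h0 (eq_zero_of_forall_mem_pBall hcon)
    refine ⟨e, fun q hq hmem => ?_⟩
    by_cases hpq : q = p
    · subst hpq
      exact he (pBall_anti (by omega) hmem)
    · have hqP : (q : 𝓞 F) ∈ P.asIdeal := by
        have := (hcast q 1).1 (pBall_anti (by push_cast; omega) hmem)
        simpa using this
      have hcop : IsCoprime (q : 𝓞 F) (p : 𝓞 F) := by
        have := (Nat.isCoprime_iff_coprime.2 ((Nat.coprime_primes hq hp).2 hpq)).map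
          (Int.castRingHom (𝓞 F))
        simpa using this
      obtain ⟨a, b, hab⟩ := hcop
      apply P.isPrime.ne_top
      rw [Ideal.eq_top_iff_one, ← hab]
      exact add_mem (Ideal.mul_mem_left _ _ hqP) (Ideal.mul_mem_left _ _ hpP)
  · push Not at h
    refine ⟨0, fun q hq hmem => h q hq ?_⟩
    have := (hcast q 1).1 (pBall_anti (by simp) hmem)
    simpa using this

end LocalField

/-! ### Adelic orders: splitting off the component at `P`. -/

section Adelic

/-- Sums of tensors `y ⊗ r` with `y ∈ O` and `r ∈ R` are already closed under products, so they
exhaust the generated subring. Properties of elements of `hatOrder` and `locOrder` can therefore be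
checked on pure tensors. -/
lemma tensorClosure_induction {F C A : Type*} [Field F] [CommRing C] [Algebra F C] [Ring A]
    [Algebra F A] {O : Subring C} {R : Subring A} {p : C ⊗[F] A → Prop}
    (tmul : ∀ y ∈ O, ∀ r ∈ R, p (y ⊗ₜ r)) (add : ∀ x y, p x → p y → p (x + y))
    {x : C ⊗[F] A} (hx : x ∈ Subring.closure
      ((fun y : C => y ⊗ₜ[F] (1 : A)) '' (O : Set C) ∪
        (fun r : A => (1 : C) ⊗ₜ[F] r) '' (R : Set A))) : p x := by
  set T : Set (C ⊗[F] A) := {z | ∃ y ∈ O, ∃ r ∈ R, y ⊗ₜ r = z}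
  have h0 : p 0 := by simpa using tmul 0 O.zero_mem 0 R.zero_mem
  suffices hT : x ∈ AddSubmonoid.closure T by
    clear hx
    induction hT using AddSubmonoid.closure_induction with
    | mem z hz =>
      obtain ⟨y, hy, r, hr, rfl⟩ := hz
      exact tmul y hy r hr
    | zero => exact h0
    | add a b _ _ ha hb => exact add a b ha hb
  induction hx using Subring.closure_induction with
  | mem z hz =>
    rcases hz with ⟨y, hy, rfl⟩ | ⟨r, hr, rfl⟩
    · exact AddSubmonoid.subset_closure ⟨y, hy, 1, R.one_mem, rfl⟩
    · exact AddSubmonoid.subset_closure ⟨1, O.one_mem, r, hr, rfl⟩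
  | zero => exact zero_mem _
  | one => exact AddSubmonoid.subset_closure ⟨1, O.one_mem, 1, R.one_mem, rfl⟩
  | add a b _ _ ha hb => exact add_mem ha hb
  | neg a hmem ha =>
    clear hmem
    induction ha using AddSubmonoid.closure_induction with
    | mem z hz =>
      obtain ⟨y, hy, r, hr, rfl⟩ := hz
      exact AddSubmonoid.subset_closure ⟨-y, O.neg_mem hy, r, hr, by rw [TensorProduct.neg_tmul]⟩
    | zero => simp
    | add a b _ _ ha hb =>
      rw [neg_add]
      exact add_mem ha hb
  | mul a b hmem hmem' ha hb =>
    clear hmem hmem'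
    induction ha using AddSubmonoid.closure_induction with
    | zero => simp
    | add a₁ a₂ _ _ h₁ h₂ =>
      rw [add_mul]
      exact add_mem h₁ h₂
    | mem z hz =>
      obtain ⟨y, hy, r, hr, rfl⟩ := hz
      induction hb using AddSubmonoid.closure_induction with
      | zero => simp
      | add a₁ a₂ _ _ h₁ h₂ =>
        rw [mul_add]
        exact add_mem h₁ h₂
      | mem z hz =>
        obtain ⟨y', hy', r', hr', rfl⟩ := hz
        exact AddSubmonoid.subset_closure ⟨y * y', O.mul_mem hy hy', r * r', R.mul_mem hr hr',
          by simp⟩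

variable {F : Type*} [Field F] [NumberField F] {A : Type*} [Ring A] [Algebra F A]
  {P : HeightOneSpectrum (𝓞 F)}

lemma hatOrder_induction {R : Subalgebra (𝓞 F) A} {p : Hat F A → Prop}
    (tmul : ∀ y ∈ intAdeles F, ∀ r ∈ R, p (y ⊗ₜ r)) (add : ∀ x y, p x → p y → p (x + y))
    {x : Hat F A} (hx : x ∈ hatOrder R) : p x :=
  tensorClosure_induction (R := R.toSubring) tmul add hx

lemma locOrder_induction {R : Subalgebra (𝓞 F) A} {p : AtP P A → Prop}
    (tmul : ∀ y ∈ P.adicCompletionIntegers F, ∀ r ∈ R, p (y ⊗ₜ r))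
    (add : ∀ x y, p x → p y → p (x + y))
    {x : AtP P A} (hx : x ∈ locOrder P R) : p x :=
  tensorClosure_induction (O := (P.adicCompletionIntegers F).toSubring) (R := R.toSubring)
    tmul add hx

lemma tmul_mem_hatOrder {R : Subalgebra (𝓞 F) A} {y : FinAdeles F} (hy : y ∈ intAdeles F)
    {r : A} (hr : r ∈ R) : y ⊗ₜ[F] r ∈ hatOrder R := by
  have h := mul_mem (Subring.subset_closure (Or.inl ⟨y, hy, rfl⟩) : y ⊗ₜ[F] (1 : A) ∈ hatOrder R)
    (Subring.subset_closure (Or.inr ⟨r, hr, rfl⟩) :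
      (1 : FinAdeles F) ⊗ₜ[F] r ∈ hatOrder R)
  rwa [Algebra.TensorProduct.tmul_mul_tmul, mul_one, one_mul] at h

lemma tmul_mem_locOrder {R : Subalgebra (𝓞 F) A} {y : P.adicCompletion F}
    (hy : y ∈ P.adicCompletionIntegers F) {r : A} (hr : r ∈ R) :
    y ⊗ₜ[F] r ∈ locOrder P R := by
  have h := mul_mem
    (Subring.subset_closure (Or.inl ⟨y, hy, rfl⟩) : y ⊗ₜ[F] (1 : A) ∈ locOrder P R)
    (Subring.subset_closure (Or.inr ⟨r, hr, rfl⟩) :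
      (1 : P.adicCompletion F) ⊗ₜ[F] r ∈ locOrder P R)
  rwa [Algebra.TensorProduct.tmul_mul_tmul, mul_one, one_mul] at h

lemma smul_mem_locOrder {R : Subalgebra (𝓞 F) A} {y : P.adicCompletion F}
    (hy : y ∈ P.adicCompletionIntegers F) {x : AtP P A} (hx : x ∈ locOrder P R) :
    y • x ∈ locOrder P R := by
  have h := mul_mem
    (Subring.subset_closure (Or.inl ⟨y, hy, rfl⟩) : y ⊗ₜ[F] (1 : A) ∈ locOrder P R) hx
  rwa [← Algebra.algebraMap_eq_smul_one y |>.trans (TensorProduct.smul_tmul' _ _ _) |>.trans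
    (by simp : _ = y ⊗ₜ[F] (1 : A)), ← Algebra.smul_def] at h

lemma hatOrder_mono {R R' : Subalgebra (𝓞 F) A} (h : R' ≤ R) : hatOrder R' ≤ hatOrder R :=
  Subring.closure_mono (Set.union_subset_union le_rfl (Set.image_mono h))

lemma locOrder_mono {R R' : Subalgebra (𝓞 F) A} (h : R' ≤ R) : locOrder P R' ≤ locOrder P R :=
  Subring.closure_mono (Set.union_subset_union le_rfl (Set.image_mono h))

@[simp]
lemma evalAt_singleAt (x : P.adicCompletion F) : evalAt P (singleAt P x) = x := by
  classical
  exact Pi.single_eq_same (M := fun v : HeightOneSpectrum (𝓞 F) => v.adicCompletion F) P x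

lemma singleAt_apply_ne {v : HeightOneSpectrum (𝓞 F)} (h : v ≠ P) (x : P.adicCompletion F) :
    singleAt P x v = 0 := by
  classical
  exact Pi.single_eq_of_ne (M := fun v : HeightOneSpectrum (𝓞 F) => v.adicCompletion F) h x

lemma singleAt_mul_left (x : P.adicCompletion F) (y : FinAdeles F) :
    singleAt P x * y = singleAt P (x * y P) := by
  apply FiniteAdeleRing.ext
  intro v
  change singleAt P x v * y v = _
  by_cases h : v = P
  · subst h
    exact (congrArg (· * y v) (evalAt_singleAt x)).trans (evalAt_singleAt (x * y v)).symm
  · rw [singleAt_apply_ne h, singleAt_apply_ne h, zero_mul]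

lemma singleAt_mem {x : P.adicCompletion F} (hx : x ∈ P.adicCompletionIntegers F) :
    singleAt P x ∈ intAdeles F := by
  intro v
  by_cases h : v = P
  · subst h
    exact (evalAt_singleAt x).symm ▸ hx
  · rw [singleAt_apply_ne h]
    exact zero_mem _

@[simp]
lemma toP_fromP (x : AtP P A) : toP P (fromP P x) = x := by
  induction x using TensorProduct.induction_on with
  | zero => simp
  | add x y hx hy => simp only [map_add, hx, hy]
  | tmul a b => simp [toP, fromP]

lemma fromP_mul_left (x : AtP P A) (y : Hat F A) : fromP P x * y = fromP P (x * toP P y) := by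
  induction x using TensorProduct.induction_on with
  | zero => simp
  | add x y hx hy => simp only [map_add, add_mul, hx, hy]
  | tmul a b =>
    induction y using TensorProduct.induction_on with
    | zero => simp
    | add x y hx hy => simp only [map_add, mul_add, hx, hy]
    | tmul c d =>
      simp only [fromP, toP, TensorProduct.map_tmul, Algebra.TensorProduct.map_tmul,
        Algebra.TensorProduct.tmul_mul_tmul, singleAt_mul_left]
      rfl

lemma fromP_mul_right (x : AtP P A) (y : Hat F A) : y * fromP P x = fromP P (toP P y * x) := by
  induction x using TensorProduct.induction_on with
  | zero => simp
  | add x y hx hy => simp only [map_add, mul_add, hx, hy]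
  | tmul a b =>
    induction y using TensorProduct.induction_on with
    | zero => simp
    | add x y hx hy => simp only [map_add, add_mul, hx, hy]
    | tmul c d =>
      simp only [fromP, toP, TensorProduct.map_tmul, Algebra.TensorProduct.map_tmul,
        Algebra.TensorProduct.tmul_mul_tmul, mul_comm c, singleAt_mul_left]
      rw [mul_comm a]
      rfl

lemma fromP_mem {R : Subalgebra (𝓞 F) A} {x : AtP P A} (hx : x ∈ locOrder P R) :
    fromP P x ∈ hatOrder R := by
  refine locOrder_induction (p := fun x => fromP P x ∈ hatOrder R) (fun y hy r hr => ?_)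
    (fun x y hx hy => ?_) hx
  · exact tmul_mem_hatOrder (singleAt_mem hy) hr
  · rw [map_add]
    exact add_mem hx hy

lemma toP_mem {R : Subalgebra (𝓞 F) A} {x : Hat F A} (hx : x ∈ hatOrder R) :
    toP P x ∈ locOrder P R := by
  refine hatOrder_induction (p := fun x => toP P x ∈ locOrder P R) (fun y hy r hr => ?_)
    (fun x y hx hy => ?_) hx
  · exact tmul_mem_locOrder (hy P) hr
  · rw [map_add]
    exact add_mem hx hy

variable (P) in
/-- The endomorphism of the monoid `Â` which replaces the `𝒫`-component by `1`. -/
def away : Hat F A →* Hat F A where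
  toFun x := x - fromP P (toP P x) + fromP P 1
  map_one' := by simp
  map_mul' x y := by
    have h1 : fromP P (1 : AtP P A) * x = fromP P (toP P x) := by simp [fromP_mul_left]
    have h3 : x * fromP P (1 : AtP P A) = fromP P (toP P x) := by simp [fromP_mul_right]
    have h4 : fromP P (1 : AtP P A) * y = fromP P (toP P y) := by simp [fromP_mul_left]
    simp only [mul_add, add_mul, mul_sub, sub_mul, fromP_mul_left, fromP_mul_right, map_mul,
      toP_fromP, one_mul, mul_one, h3]
    abel

lemma away_apply (x : Hat F A) : away P x = x - fromP P (toP P x) + fromP P 1 := rfl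

/-- The idempotent `fromP P 1` belongs to the order, so the order is the product of its part at `P`
and its part away from `P`. -/
lemma mem_hatOrder_iff {R : Subalgebra (𝓞 F) A} {x : Hat F A} :
    x ∈ hatOrder R ↔ away P x ∈ hatOrder R ∧ toP P x ∈ locOrder P R := by
  have h1 : fromP P (1 : AtP P A) ∈ hatOrder R := fromP_mem (one_mem _)
  rw [away_apply]
  constructor
  · intro h
    exact ⟨add_mem (sub_mem h (fromP_mem (toP_mem h))) h1, toP_mem h⟩
  · rintro ⟨h, h2⟩
    have := add_mem (sub_mem h h1) (fromP_mem h2)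
    simpa using this

/-- The subgroup `R_𝒫ˣ` of `A_𝒫ˣ`. -/
def locUnits (P : HeightOneSpectrum (𝓞 F)) (R : Subalgebra (𝓞 F) A) : Subgroup (AtP P A)ˣ :=
  (locOrder P R).toSubmonoid.units

lemma mem_hatUnits {R : Subalgebra (𝓞 F) A} {x : (Hat F A)ˣ} :
    x ∈ hatUnits R ↔ (x : Hat F A) ∈ hatOrder R ∧ ((x⁻¹ : (Hat F A)ˣ) : Hat F A) ∈ hatOrder R :=
  Submonoid.mem_units_iff _ _

lemma mem_locUnits {R : Subalgebra (𝓞 F) A} {x : (AtP P A)ˣ} :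
    x ∈ locUnits P R ↔
      (x : AtP P A) ∈ locOrder P R ∧ ((x⁻¹ : (AtP P A)ˣ) : AtP P A) ∈ locOrder P R :=
  Submonoid.mem_units_iff _ _

variable (P) in
/-- The `𝒫`-component `Âˣ → A_𝒫ˣ`. -/
def toPUnits : (Hat F A)ˣ →* (AtP P A)ˣ :=
  Units.map ((toP P : Hat F A →ₐ[F] AtP P A) : Hat F A →* AtP P A)

variable (P) in
/-- The endomorphism of `Âˣ` which replaces the `𝒫`-component by `1`. -/
def awayUnits : (Hat F A)ˣ →* (Hat F A)ˣ := Units.map (away P)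

lemma coe_toPUnits (x : (Hat F A)ˣ) : (toPUnits P x : AtP P A) = toP P (x : Hat F A) := rfl

lemma mem_hatUnits_iff (P : HeightOneSpectrum (𝓞 F)) {R : Subalgebra (𝓞 F) A} {x : (Hat F A)ˣ} :
    x ∈ hatUnits R ↔ awayUnits P x ∈ hatUnits R ∧ toPUnits P x ∈ locUnits P R := by
  rw [mem_hatUnits, mem_hatUnits, mem_locUnits, mem_hatOrder_iff (P := P),
    mem_hatOrder_iff (P := P) (x := ((x⁻¹ : (Hat F A)ˣ) : Hat F A)), ← map_inv, ← map_inv]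
  exact and_and_and_comm

lemma coe_localUnit (u : (AtP P A)ˣ) :
    (localUnit P u : Hat F A) = 1 + fromP P ((u : AtP P A) - 1) := rfl

@[simp]
lemma toPUnits_localUnit (u : (AtP P A)ˣ) : toPUnits P (localUnit P u) = u := by
  ext
  rw [coe_toPUnits, coe_localUnit]
  simp

@[simp]
lemma awayUnits_localUnit (u : (AtP P A)ˣ) : awayUnits P (localUnit P u) = 1 := by
  ext
  change away P (localUnit P u : Hat F A) = 1
  rw [away_apply, coe_localUnit]
  simp only [map_add, map_sub, map_one, toP_fromP]
  abel

lemma localUnit_mem {R : Subalgebra (𝓞 F) A} {u : (AtP P A)ˣ} :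
    localUnit P u ∈ hatUnits R ↔ u ∈ locUnits P R := by
  rw [mem_hatUnits_iff P]
  simp

/-- An integral adele with vanishing `𝒫`-component is divisible by any element of `O_F` which is
a unit outside `𝒫`. -/
lemma exists_mul_of_apply_eq_zero {π : 𝓞 F} (h0 : π ≠ 0)
    (hπ : ∀ v : HeightOneSpectrum (𝓞 F), v ≠ P →
        Valued.v (algebraMap F (v.adicCompletion F) (π : F)) = 1)
    {y : FinAdeles F} (hy : y ∈ intAdeles F) (hyP : y P = 0) :
    ∃ z ∈ intAdeles F, (π : F) • z = y := by
  have hπ0 : (π : F) ≠ 0 := by simpa using h0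
  refine ⟨(π : F)⁻¹ • y, fun v => ?_, smul_inv_smul₀ hπ0 y⟩
  rw [Algebra.smul_def]
  change algebraMap F (v.adicCompletion F) (π : F)⁻¹ * y v ∈ _
  by_cases h : v = P
  · subst h
    rw [hyP, mul_zero]
    exact zero_mem _
  · rw [← mem_pBall_zero, map_inv₀]
    exact pBall_mul (by omega) (inv_mem_pBall_zero (hπ v h)) (mem_pBall_zero.2 (hy v))

/-- If `R' ⊆ R` are orders with `𝒫^N R ⊆ R'` then `R̂'` is cut out in `R̂` by the condition
at `𝒫`. -/
lemma mem_hatOrder_iff_of_le {R R' : Subalgebra (𝓞 F) A} (hle : R' ≤ R) {N : ℕ}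
    (hN : ∀ a ∈ P.asIdeal ^ N, ∀ r ∈ R, (a : F) • r ∈ R') {x : Hat F A} :
    x ∈ hatOrder R' ↔ x ∈ hatOrder R ∧ toP P x ∈ locOrder P R' := by
  refine ⟨fun h => ⟨hatOrder_mono hle h, toP_mem h⟩, fun ⟨h, hP⟩ => ?_⟩
  obtain ⟨π, hπN, h0, -, hπ⟩ := exists_isolated P N
  -- The part of `x` away from `P` is divisible by `π ∈ P ^ N`, which is a unit there; hence it lies
  -- in `π R̂`, which is contained in `R̂'`.
  have key : x - fromP P (toP P x) ∈ hatOrder R' := by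
    refine hatOrder_induction (p := fun x => x - fromP P (toP P x) ∈ hatOrder R')
      (fun y hy r hr => ?_) (fun x y hx hy => ?_) h
    · have h1 : y ⊗ₜ[F] r - fromP P (toP P (y ⊗ₜ[F] r)) = (y - singleAt P (y P)) ⊗ₜ[F] r := by
        rw [TensorProduct.sub_tmul]
        rfl
      obtain ⟨z, hz, hzy⟩ := exists_mul_of_apply_eq_zero h0 hπ
        (sub_mem hy (singleAt_mem (P := P) (hy P)))
        (show (y - singleAt P (y P)) P = 0 from
          sub_eq_zero.2 (evalAt_singleAt (y P)).symm)
      rw [h1, ← hzy, TensorProduct.smul_tmul]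
      exact tmul_mem_hatOrder hz (hN π hπN r hr)
    · convert add_mem hx hy using 1
      simp only [map_add]
      abel
  have := add_mem key (fromP_mem hP)
  simpa using this

lemma mem_hatUnits_iff_of_le {R R' : Subalgebra (𝓞 F) A} (hle : R' ≤ R) {N : ℕ}
    (hN : ∀ a ∈ P.asIdeal ^ N, ∀ r ∈ R, (a : F) • r ∈ R') {x : (Hat F A)ˣ} :
    x ∈ hatUnits R' ↔ x ∈ hatUnits R ∧ toPUnits P x ∈ locUnits P R' := by
  rw [mem_hatUnits, mem_hatUnits, mem_locUnits, mem_hatOrder_iff_of_le hle hN,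
    mem_hatOrder_iff_of_le hle hN, ← map_inv]
  exact and_and_and_comm

end Adelic

/-! ### The orders `O_{P^n}`, globally. -/

section CondOrder

variable {F : Type*} [Field F] [NumberField F] {K : Type*} [Field K] [NumberField K] [Algebra F K]
  {P : HeightOneSpectrum (𝓞 F)}

lemma mem_integralClosure_iff_exists {x : K} :
    x ∈ integralClosure (𝓞 F) K ↔ ∃ b : 𝓞 K, (b : K) = x := by
  rw [mem_integralClosure_iff]
  constructor
  · intro h
    exact ⟨⟨x, isIntegral_trans (R := ℤ) (A := 𝓞 F) x h⟩, rfl⟩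
  · rintro ⟨b, rfl⟩
    exact (RingOfIntegers.isIntegral_coe b).tower_top

lemma ringOfIntegers_smul_eq {A : Type*} [Ring A] [Algebra F A] (c : 𝓞 F) (x : A) :
    c • x = (c : F) • x := rfl

lemma one_tmul_algebraMap {A : Type*} [Ring A] [Algebra F A] (c : 𝓞 F) :
    (1 : P.adicCompletion F) ⊗ₜ[F] (algebraMap (𝓞 F) A c) =
      algebraMap F (P.adicCompletion F) (c : F) • (1 : AtP P A) := by
  rw [algebraMap_smul]
  change _ = (c : F) • ((1 : P.adicCompletion F) ⊗ₜ[F] (1 : A))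
  rw [TensorProduct.smul_tmul', TensorProduct.smul_tmul, ← Algebra.algebraMap_eq_smul_one]
  rfl

lemma condOrder_le (n : ℕ) : condOrder K P n ≤ integralClosure (𝓞 F) K := by
  refine Algebra.adjoin_le ?_
  rintro x ⟨b, -, rfl⟩
  exact mem_integralClosure_iff_exists.2 ⟨b, rfl⟩

lemma smul_mem_condOrder {n : ℕ} {a : 𝓞 F} (ha : a ∈ P.asIdeal ^ n) {r : K}
    (hr : r ∈ integralClosure (𝓞 F) K) : (a : F) • r ∈ condOrder K P n := by
  obtain ⟨b, rfl⟩ := mem_integralClosure_iff_exists.1 hr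
  refine Algebra.subset_adjoin ⟨algebraMap (𝓞 F) (𝓞 K) a * b,
    Ideal.mul_mem_right _ _ (Ideal.mem_map_of_mem _ ha), ?_⟩
  rw [Algebra.smul_def]
  rfl

/-- `Ô_{𝒫ⁿ}ˣ` is cut out in `Ô_{𝒫ᵏ}ˣ` by the condition at `𝒫`, for `k ≤ n`. -/
lemma mem_hatUnits_condOrder_iff {k n : ℕ} (h : k ≤ n) {x : (Hat F K)ˣ} :
    x ∈ hatUnits (condOrder K P n) ↔
      x ∈ hatUnits (condOrder K P k) ∧ toPUnits P x ∈ locUnits P (condOrder K P n) :=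
  mem_hatUnits_iff_of_le (condOrder_anti K P h) (N := n)
    fun _ ha _ hr => smul_mem_condOrder ha (condOrder_le k hr)

end CondOrder

/-! ### Coordinates on `K_P` in the basis `1, α`, and the completions of `O_{P^n}`. -/

namespace LocalData

variable {F : Type*} [Field F] [NumberField F] {K : Type*} [Field K] [NumberField K] [Algebra F K]
  {P : HeightOneSpectrum (𝓞 F)} {B : Type*} [Ring B] [Algebra F B]
  {ι : K →ₐ[F] B} (L : LocalData ι P)

/-- The embedding `K_𝒫 → B_𝒫 = M₂(F_𝒫)`. -/
def emb : AtP P K →ₐ[P.adicCompletion F] Matrix (Fin 2) (Fin 2) (P.adicCompletion F) :=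
  (L.φ : AtP P B →ₐ[P.adicCompletion F] _).comp
    (Algebra.TensorProduct.map (AlgHom.id (P.adicCompletion F) (P.adicCompletion F)) ι)

lemma emb_apply (y : AtP P K) :
    L.emb y = L.φ (Algebra.TensorProduct.map (AlgHom.id F (P.adicCompletion F)) ι y) := rfl

/-- The trace of `α`. -/
def tr : P.adicCompletion F := Algebra.trace (P.adicCompletion F) (AtP P K) L.α

/-- The norm of `α`. -/
def nm : P.adicCompletion F := Algebra.norm (P.adicCompletion F) L.α

lemma emb_α : L.emb L.α = !![L.tr, 1; -L.nm, 0] := by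
  rw [emb_apply, L.φ_α]
  rfl

/-- The coefficient of `1` in the basis `1, α` of `K_𝒫`. -/
def X : AtP P K →ₗ[P.adicCompletion F] P.adicCompletion F :=
  (LinearMap.proj 1 ∘ₗ LinearMap.proj 1) ∘ₗ L.emb.toLinearMap

/-- The coefficient of `α` in the basis `1, α` of `K_𝒫`. -/
def Y : AtP P K →ₗ[P.adicCompletion F] P.adicCompletion F :=
  (LinearMap.proj 1 ∘ₗ LinearMap.proj 0) ∘ₗ L.emb.toLinearMap

lemma X_apply (y : AtP P K) : L.X y = L.emb y 1 1 := rfl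

lemma Y_apply (y : AtP P K) : L.Y y = L.emb y 0 1 := rfl

@[simp] lemma X_one : L.X 1 = 1 := by simp [X_apply]
@[simp] lemma Y_one : L.Y 1 = 0 := by simp [Y_apply]
@[simp] lemma X_α : L.X L.α = 0 := by simp [X_apply, emb_α]
@[simp] lemma Y_α : L.Y L.α = 1 := by simp [Y_apply, emb_α]

/-- The basis hypothesis covers only integral elements. Each pure tensor is a scalar multiple of an
integral one: clear the denominator of its `K`-factor and absorb it into `F_P`. -/
lemma eq_X_add_Y (y : AtP P K) : y = L.X y • (1 : AtP P K) + L.Y y • L.α := by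
  have hint : ∀ y ∈ locOrder P (integralClosure (𝓞 F) K),
      y = L.X y • (1 : AtP P K) + L.Y y • L.α := by
    intro y hy
    obtain ⟨⟨a, b⟩, h, -⟩ := L.basis y hy
    simp only at h
    rw [h]
    simp
  induction y using TensorProduct.induction_on with
  | zero => simp
  | add x y hx hy =>
    rw [map_add, map_add, add_smul, add_smul, add_add_add_comm, ← hx, ← hy]
  | tmul a b =>
    have : Algebra.IsAlgebraic (𝓞 F) K :=
      (IsFractionRing.comap_isAlgebraic_iff (A := 𝓞 F) (K := F) (C := K)).2 inferInstance
    obtain ⟨c, hc0, hc⟩ := (Algebra.IsAlgebraic.isAlgebraic (R := 𝓞 F) b).exists_integral_multiple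
    have hc1 : (c : F) ≠ 0 := by simpa using hc0
    have h1 : a ⊗ₜ[F] b = (a * algebraMap F _ ((c : F)⁻¹)) •
        ((1 : P.adicCompletion F) ⊗ₜ[F] (c • b)) := by
      rw [ringOfIntegers_smul_eq, TensorProduct.smul_tmul', smul_eq_mul, mul_one,
        ← TensorProduct.smul_tmul, Algebra.smul_def, mul_comm, mul_assoc, ← map_mul,
        inv_mul_cancel₀ hc1, map_one, mul_one]
    have h2 := hint _ (tmul_mem_locOrder (one_mem _) hc)
    rw [h1, map_smul, map_smul, smul_assoc, smul_assoc, ← smul_add, ← h2]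

lemma emb_eq (y : AtP P K) :
    L.emb y = !![L.X y + L.Y y * L.tr, L.Y y; -(L.Y y * L.nm), L.X y] := by
  conv_lhs => rw [L.eq_X_add_Y y]
  rw [map_add, map_smul, map_smul, map_one, emb_α]
  ext i j
  fin_cases i <;> fin_cases j <;> simp

lemma ext_XY {y z : AtP P K} (hX : L.X y = L.X z) (hY : L.Y y = L.Y z) : y = z := by
  rw [L.eq_X_add_Y y, L.eq_X_add_Y z, hX, hY]

lemma X_mul (y z : AtP P K) : L.X (y * z) = L.X y * L.X z - L.Y y * L.Y z * L.nm := by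
  rw [X_apply, map_mul, emb_eq, emb_eq]
  simp [Matrix.mul_apply]
  ring

lemma Y_mul (y z : AtP P K) :
    L.Y (y * z) = L.X y * L.Y z + L.Y y * L.X z + L.Y y * L.Y z * L.tr := by
  rw [Y_apply, map_mul, emb_eq, emb_eq]
  simp [Matrix.mul_apply]
  ring

lemma mem_locOrder_integralClosure {y : AtP P K} :
    y ∈ locOrder P (integralClosure (𝓞 F) K) ↔ L.X y ∈ pBall P 0 ∧ L.Y y ∈ pBall P 0 := by
  constructor
  · intro hy
    obtain ⟨⟨a, b⟩, h, -⟩ := L.basis y hy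
    simp only at h
    rw [h]
    simp [coe_mem_pBall_zero]
  · rintro ⟨h1, h2⟩
    rw [L.eq_X_add_Y y]
    exact add_mem (smul_mem_locOrder (mem_pBall_zero.1 h1) (one_mem _))
      (smul_mem_locOrder (mem_pBall_zero.1 h2) L.α_mem)

/-- The coordinates of the integral element `α * α` are `-nm` and `tr`. -/
lemma tr_mem : L.tr ∈ pBall P 0 := by
  have h := (L.mem_locOrder_integralClosure.1 (mul_mem L.α_mem L.α_mem)).2
  rw [Y_mul] at h
  simpa using h

lemma nm_mem : L.nm ∈ pBall P 0 := by
  have h := (L.mem_locOrder_integralClosure.1 (mul_mem L.α_mem L.α_mem)).1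
  rw [X_mul] at h
  simpa using h

/-- This turns conductors into valuations: the local order is `O_{F,P} + P^n α`. -/
lemma mem_locOrder_condOrder {n : ℕ} {y : AtP P K} :
    y ∈ locOrder P (condOrder K P n) ↔ L.X y ∈ pBall P 0 ∧ L.Y y ∈ pBall P n := by
  constructor
  · intro hy
    refine ⟨(L.mem_locOrder_integralClosure.1 (locOrder_mono (condOrder_le n) hy)).1, ?_⟩
    refine locOrder_induction (p := fun y => L.Y y ∈ pBall P n) (fun y hy r hr => ?_)
      (fun x y hx hy => by rw [map_add]; exact add_mem hx hy) hy
    have hyr : y ⊗ₜ[F] r = y • ((1 : P.adicCompletion F) ⊗ₜ[F] r) := by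
      rw [TensorProduct.smul_tmul', smul_eq_mul, mul_one]
    rw [hyr, map_smul, smul_eq_mul]
    refine pBall_mul (b := n) (by omega) (mem_pBall_zero.2 hy) ?_
    clear hyr hy y
    -- In the product formula for `Y` each term contains `Y x` or `Y y`, so the condition is
    -- multiplicative on integral elements.
    have hmul {x y : AtP P K} (hx : x ∈ locOrder P (integralClosure (𝓞 F) K))
        (hy : y ∈ locOrder P (integralClosure (𝓞 F) K)) (hx' : L.Y x ∈ pBall P n)
        (hy' : L.Y y ∈ pBall P n) : L.Y (x * y) ∈ pBall P n := by
      rw [L.mem_locOrder_integralClosure] at hx hy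
      rw [Y_mul]
      exact add_mem (add_mem (pBall_mul (b := n) (by omega) hx.1 hy')
          (pBall_mul (a := n) (by omega) hx' hy.1))
        (pBall_mul (a := n) (by omega) (pBall_mul (a := n) le_rfl hx' hy.2) L.tr_mem)
    induction hr using Algebra.adjoin_induction with
    | algebraMap c =>
      rw [one_tmul_algebraMap (A := K)]
      simp
    | add x y _ _ hx hy =>
      rw [TensorProduct.tmul_add, map_add]
      exact add_mem hx hy
    | mul x y hx' hy' hx hy =>
      have : (1 : P.adicCompletion F) ⊗ₜ[F] (x * y) =
          ((1 : P.adicCompletion F) ⊗ₜ[F] x) * ((1 : P.adicCompletion F) ⊗ₜ[F] y) := by simp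
      rw [this]
      exact hmul (tmul_mem_locOrder (one_mem _) (condOrder_le n hx'))
        (tmul_mem_locOrder (one_mem _) (condOrder_le n hy')) hx hy
    | mem x hx =>
      obtain ⟨b, hb, rfl⟩ := hx
      -- Multiplication by `O_K` mixes the two coordinates, so the induction over the extended ideal
      -- has to control both.
      suffices L.X ((1 : P.adicCompletion F) ⊗ₜ[F] (b : K)) ∈ pBall P n ∧
        L.Y ((1 : P.adicCompletion F) ⊗ₜ[F] (b : K)) ∈ pBall P n from this.2
      induction hb using Submodule.span_induction with
      | zero => simp
      | add x y _ _ hx hy =>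
        have hxy : ((x + y : 𝓞 K) : K) = x + y := rfl
        rw [hxy, TensorProduct.tmul_add, map_add, map_add]
        exact ⟨add_mem hx.1 hy.1, add_mem hx.2 hy.2⟩
      | mem x hx =>
        obtain ⟨a, ha, rfl⟩ := hx
        change L.X ((1 : P.adicCompletion F) ⊗ₜ[F] algebraMap (𝓞 F) K a) ∈ _ ∧
          L.Y ((1 : P.adicCompletion F) ⊗ₜ[F] algebraMap (𝓞 F) K a) ∈ _
        rw [one_tmul_algebraMap (A := K)]
        rw [map_smul, map_smul, X_one, Y_one, smul_eq_mul, mul_one, smul_zero]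
        exact ⟨algebraMap_mem_pBall.2 ha, zero_mem _⟩
      | smul c x hx' hx =>
        have hc := L.mem_locOrder_integralClosure.1 (tmul_mem_locOrder
          (one_mem (P.adicCompletionIntegers F)) (mem_integralClosure_iff_exists.2 ⟨c, rfl⟩))
        have : (1 : P.adicCompletion F) ⊗ₜ[F] ((c • x : 𝓞 K) : K) =
            ((1 : P.adicCompletion F) ⊗ₜ[F] (c : K)) *
              ((1 : P.adicCompletion F) ⊗ₜ[F] (x : K)) := by simp
        rw [this, X_mul, Y_mul]
        exact ⟨sub_mem (pBall_mul (b := n) (by omega) hc.1 hx.1)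
          (pBall_mul (by omega) (pBall_mul (b := n) le_rfl hc.2 hx.2) L.nm_mem),
          add_mem (add_mem (pBall_mul (b := n) (by omega) hc.1 hx.2) (pBall_mul (b := n) (by omega) hc.2 hx.1))
          (pBall_mul (by omega) (pBall_mul (b := n) le_rfl hc.2 hx.2) L.tr_mem)⟩
  · rintro ⟨h1, h2⟩
    -- With `π` of valuation exactly `n`, `Y y · α` is an integral multiple of `π α`, and `π α` lies
    -- in the order.
    obtain ⟨π, hπ, hv⟩ := exists_mem_pow_valued_eq P n
    have hα : algebraMap F (P.adicCompletion F) (π : F) • L.α ∈ locOrder P (condOrder K P n) := by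
      refine locOrder_induction (p := fun y => algebraMap F (P.adicCompletion F) (π : F) • y ∈
        locOrder P (condOrder K P n)) (fun y hy r hr => ?_)
        (fun x y hx hy => by rw [smul_add]; exact add_mem hx hy) L.α_mem
      rw [algebraMap_smul, TensorProduct.smul_tmul', TensorProduct.smul_tmul]
      exact tmul_mem_locOrder hy (smul_mem_condOrder hπ hr)
    rw [L.eq_X_add_Y y]
    refine add_mem (smul_mem_locOrder (mem_pBall_zero.1 h1) (one_mem _)) ?_
    have h3 := div_mem_pBall h2 hv
    rw [sub_self] at h3
    have h4 := smul_mem_locOrder (mem_pBall_zero.1 h3) hα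
    rwa [smul_smul, div_mul_cancel₀] at h4
    intro h0
    rw [h0, map_zero] at hv
    exact WithZero.exp_ne_zero hv.symm

end LocalData

/-! ### Global units: for large conductor they come from `O_F`. -/

section Units

variable {F : Type*} [Field F] [NumberField F] {K : Type*} [Field K] [NumberField K] [Algebra F K]

/-- Elements of `R_v` are integral over `O_{F,v}` if `R` consists of integral elements. -/
lemma isIntegral_of_mem_locOrder {v : HeightOneSpectrum (𝓞 F)} {x : AtP v K}
    (hx : x ∈ locOrder v (integralClosure (𝓞 F) K)) :
    IsIntegral (v.adicCompletionIntegers F) x := by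
  refine locOrder_induction (p := fun x => IsIntegral (v.adicCompletionIntegers F) x)
    (fun y hy r hr => ?_) (fun x y hx hy => hx.add hy) hx
  have h1 : y ⊗ₜ[F] r = (y ⊗ₜ[F] (1 : K)) * ((1 : v.adicCompletion F) ⊗ₜ[F] r) := by simp
  rw [h1]
  refine IsIntegral.mul ?_ ?_
  · exact isIntegral_algebraMap (R := v.adicCompletionIntegers F) (A := AtP v K) (x := ⟨y, hy⟩)
  · obtain ⟨p, hp, hp0⟩ := hr
    refine ⟨p.map (algebraMap (𝓞 F) (v.adicCompletionIntegers F)), hp.map _, ?_⟩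
    rw [Polynomial.eval₂_map]
    have h2 : (algebraMap (v.adicCompletionIntegers F) (AtP v K)).comp
        (algebraMap (𝓞 F) (v.adicCompletionIntegers F)) =
        ((Algebra.TensorProduct.includeRight : K →ₐ[F] AtP v K) : K →+* AtP v K).comp
          (algebraMap (𝓞 F) K) := by
      ext c
      change (algebraMap F (v.adicCompletion F) (c : F)) ⊗ₜ[F] (1 : K) =
        (1 : v.adicCompletion F) ⊗ₜ[F] algebraMap (𝓞 F) K c
      rw [one_tmul_algebraMap, Algebra.TensorProduct.one_def, TensorProduct.smul_tmul',
        smul_eq_mul, mul_one]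
    rw [h2]
    change Polynomial.eval₂ _ (((Algebra.TensorProduct.includeRight : K →ₐ[F] AtP v K) :
      K →+* AtP v K) r) p = 0
    rw [← Polynomial.hom_eval₂, hp0, map_zero]

/-- `F ∩ Ô_K = O_F`. -/
lemma exists_integer_of_mem_hatOrder {c : F}
    (h : (1 : FinAdeles F) ⊗ₜ[F] (algebraMap F K c) ∈ hatOrder (integralClosure (𝓞 F) K)) :
    ∃ b : 𝓞 F, (b : F) = c := by
  refine HeightOneSpectrum.mem_integers_of_valuation_le_one F c fun v => ?_
  have h1 := isIntegral_of_mem_locOrder (toP_mem (P := v) h)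
  have h2 : toP v ((1 : FinAdeles F) ⊗ₜ[F] (algebraMap F K c)) =
      algebraMap (v.adicCompletion F) (AtP v K) (algebraMap F _ c) := by
    rw [Algebra.algebraMap_eq_smul_one, Algebra.algebraMap_eq_smul_one,
      ← TensorProduct.smul_tmul, algebraMap_smul]
    simp [toP, Algebra.TensorProduct.one_def, TensorProduct.smul_tmul']
  rw [h2, isIntegral_algebraMap_iff (algebraMap (v.adicCompletion F) (AtP v K)).injective,
    IsIntegrallyClosed.isIntegral_iff] at h1
  obtain ⟨y, hy⟩ := h1
  rw [← valued_algebraMap, ← hy]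
  exact y.2

lemma map_mem_hatOrder (σ : K →ₐ[F] K) {x : K}
    (h : (1 : FinAdeles F) ⊗ₜ[F] x ∈ hatOrder (integralClosure (𝓞 F) K)) :
    (1 : FinAdeles F) ⊗ₜ[F] σ x ∈ hatOrder (integralClosure (𝓞 F) K) := by
  have key : ∀ z ∈ hatOrder (integralClosure (𝓞 F) K),
      Algebra.TensorProduct.map (AlgHom.id F (FinAdeles F)) σ z ∈
        hatOrder (integralClosure (𝓞 F) K) := by
    intro z hz
    refine hatOrder_induction (p := fun z => Algebra.TensorProduct.map
      (AlgHom.id F (FinAdeles F)) σ z ∈ hatOrder (integralClosure (𝓞 F) K))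
      (fun y hy r hr => ?_) (fun x y hx hy => by rw [map_add]; exact add_mem hx hy) hz
    rw [Algebra.TensorProduct.map_tmul]
    exact tmul_mem_hatOrder hy (hr.map (σ.restrictScalars (𝓞 F)))
  simpa using key _ h

variable (F K) in
/-- Complex conjugation on the CM extension `K/F`, and the finiteness of `O_Kˣ / O_Fˣ`. -/
lemma exists_conj [IsTotallyReal F] [IsTotallyComplex K] [Algebra.IsQuadraticExtension F K] :
    ∃ σ : K →ₐ[F] K, (∀ x, σ (σ x) = x) ∧ (∃ x, σ x ≠ x) ∧
      (∀ x, σ x = x → ∃ c : F, algebraMap F K c = x) ∧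
      ∃ f : (𝓞 K)ˣ →* Units.torsion K, ∀ u, f u = 1 → σ ((u : 𝓞 K) : K) = (u : 𝓞 K) := by
  have := IsCMField.ofCMExtension F K
  have hF (x : K) : x ∈ maximalRealSubfield K ↔ ∃ c : F, algebraMap F K c = x := by
    constructor
    · intro hx
      exact ⟨_, CMExtension.algebraMap_equivMaximalRealSubfield_symm_apply F K ⟨x, hx⟩⟩
    · rintro ⟨c, rfl⟩
      rw [← CMExtension.equivMaximalRealSubfield_apply]
      exact ((CMExtension.equivMaximalRealSubfield F K) c).2
  have hfix (x : K) : IsCMField.complexConj K x = x ↔ ∃ c : F, algebraMap F K c = x := by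
    rw [IsCMField.complexConj_eq_self_iff, hF]
  -- The homomorphism to roots of unity is `u ↦ u / ū`; its kernel consists of the units fixed by
  -- conjugation.
  refine ⟨{ (IsCMField.complexConj K : K →+* K) with
    commutes' := fun c => (hfix _).2 ⟨c, rfl⟩ }, IsCMField.complexConj_apply_apply K, ?_,
    fun x hx => (hfix x).1 hx, IsCMField.unitsMulComplexConjInv K, fun u hu => ?_⟩
  · by_contra! hcon
    exact IsCMField.complexConj_ne_one K (AlgEquiv.ext hcon)
  · have h1 : u ∈ IsCMField.realUnits K := by
      rw [← IsCMField.unitsMulComplexConjInv_ker]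
      exact hu
    rw [← IsCMField.unitsComplexConj_eq_self_iff] at h1
    exact congrArg (fun u : (𝓞 K)ˣ => ((u : 𝓞 K) : K)) h1

/-- `K ∩ Ô_K = O_K`. -/
lemma isIntegral_of_one_tmul_mem [IsTotallyReal F] [IsTotallyComplex K]
    [Algebra.IsQuadraticExtension F K] {x : K}
    (h : (1 : FinAdeles F) ⊗ₜ[F] x ∈ hatOrder (integralClosure (𝓞 F) K)) :
    ∃ b : 𝓞 K, (b : K) = x := by
  obtain ⟨σ, hσ, -, hfix, -⟩ := exists_conj F K
  have hσx := map_mem_hatOrder σ h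
  -- The trace and norm of `x` lie in `F` and are adelically integral, hence in `O_F`; so `x` is a
  -- root of a monic quadratic over `O_F`.
  obtain ⟨s, hs⟩ := hfix (x + σ x) (by rw [map_add, hσ, add_comm])
  obtain ⟨n, hn⟩ := hfix (x * σ x) (by rw [map_mul, hσ, mul_comm])
  obtain ⟨s, rfl⟩ := exists_integer_of_mem_hatOrder (c := s) (by
    rw [hs, TensorProduct.tmul_add]
    exact add_mem h hσx)
  obtain ⟨n, rfl⟩ := exists_integer_of_mem_hatOrder (c := n) (by
    rw [hn]
    have := mul_mem h hσx
    rwa [Algebra.TensorProduct.tmul_mul_tmul, one_mul] at this)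
  refine (mem_integralClosure_iff_exists (F := F)).1 ?_
  refine ⟨Polynomial.X ^ 2 - Polynomial.C s * Polynomial.X + Polynomial.C n, ?_, ?_⟩
  · monicity!
  · change algebraMap (𝓞 F) K s = _ at hs
    change algebraMap (𝓞 F) K n = _ at hn
    simp only [Polynomial.eval₂_add, Polynomial.eval₂_sub, Polynomial.eval₂_mul,
      Polynomial.eval₂_pow, Polynomial.eval₂_X, Polynomial.eval₂_C, hs, hn]
    ring

variable {P : HeightOneSpectrum (𝓞 F)} {B : Type*} [Ring B] [Algebra F B]
  {ι : K →ₐ[F] B} (L : LocalData ι P)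

lemma LocalData.Y_algebraMap (c : F) :
    L.Y ((1 : P.adicCompletion F) ⊗ₜ[F] algebraMap F K c) = 0 := by
  rw [Algebra.algebraMap_eq_smul_one, ← TensorProduct.smul_tmul, ← TensorProduct.smul_tmul',
    ← algebraMap_smul (P.adicCompletion F), map_smul]
  exact (congrArg (_ • ·) L.Y_one).trans (smul_zero _)

lemma LocalData.Y_algebraMap_mul (c : F) (x : K) :
    L.Y ((1 : P.adicCompletion F) ⊗ₜ[F] (algebraMap F K c * x)) =
      algebraMap F (P.adicCompletion F) c * L.Y ((1 : P.adicCompletion F) ⊗ₜ[F] x) := by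
  rw [← Algebra.smul_def, ← TensorProduct.smul_tmul, ← TensorProduct.smul_tmul',
    ← algebraMap_smul (P.adicCompletion F), map_smul, smul_eq_mul]

/-- `K ∩ F_𝒫 = F`. -/
lemma LocalData.map_eq_of_Y_eq_zero {σ : K →ₐ[F] K} (hσ : ∀ x, σ (σ x) = x)
    (hfix : ∀ x, σ x = x → ∃ c : F, algebraMap F K c = x) {u : K}
    (hu : L.Y ((1 : P.adicCompletion F) ⊗ₜ[F] u) = 0) : σ u = u := by
  by_contra hne
  have hd : u - σ u ≠ 0 := sub_ne_zero.2 (Ne.symm hne)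
  -- If `u` is not fixed, `u - σ u` spans the anti-invariant line of `K` over `F`. Then `Y` vanishes
  -- on `F` and on that line, hence on all of `K_P`, contradicting `Y α = 1`.
  have hYd : L.Y ((1 : P.adicCompletion F) ⊗ₜ[F] (u - σ u)) = 0 := by
    obtain ⟨s, hs⟩ := hfix (u + σ u) (by rw [map_add, hσ, add_comm])
    have h1 : u - σ u = u + u - algebraMap F K s := by rw [hs]; ring
    rw [h1, TensorProduct.tmul_sub, TensorProduct.tmul_add, map_sub, map_add, hu, L.Y_algebraMap]
    simp
  have hall (x : K) : L.Y ((1 : P.adicCompletion F) ⊗ₜ[F] x) = 0 := by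
    obtain ⟨a, ha⟩ := hfix (x + σ x) (by rw [map_add, hσ, add_comm])
    obtain ⟨b, hb⟩ := hfix ((x - σ x) / (u - σ u)) (by
      rw [map_div₀, map_sub, map_sub, hσ, hσ, ← neg_sub, ← neg_sub u, neg_div_neg_eq])
    have h1 : x + x = algebraMap F K a + algebraMap F K b * (u - σ u) := by
      rw [ha, hb, div_mul_cancel₀ _ hd]; ring
    have h2 : L.Y ((1 : P.adicCompletion F) ⊗ₜ[F] (x + x)) = 0 := by
      rw [h1, TensorProduct.tmul_add, map_add, L.Y_algebraMap, L.Y_algebraMap_mul, hYd]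
      simp
    have : CharZero (P.adicCompletion F) :=
      charZero_of_injective_algebraMap (algebraMap F (P.adicCompletion F)).injective
    rw [TensorProduct.tmul_add, map_add] at h2
    exact add_self_eq_zero.1 h2
  have h0 : L.Y = 0 := by
    refine LinearMap.ext fun y => ?_
    induction y using TensorProduct.induction_on with
    | zero => simp
    | add x y hx hy => simp only [map_add, hx, hy]
    | tmul a b =>
      have : a ⊗ₜ[F] b = a • ((1 : P.adicCompletion F) ⊗ₜ[F] b) := by
        rw [TensorProduct.smul_tmul', smul_eq_mul, mul_one]
      rw [this, map_smul, hall]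
      simp
  have := L.Y_α
  rw [h0] at this
  simp at this

/-- For large `k`, the only units of `O_{𝒫ᵏ}` are those of `O_F`. -/
lemma LocalData.exists_conductor [IsTotallyReal F] [IsTotallyComplex K]
    [Algebra.IsQuadraticExtension F K] (L : LocalData ι P) :
    ∃ k : ℕ, ∀ t ∈ rationalUnits F K, t ∈ hatUnits (condOrder K P k) →
      ∀ n, t ∈ hatUnits (condOrder K P n) := by
  obtain ⟨σ, hσ, -, hfix, f, hf⟩ := exists_conj F K
  set y : (𝓞 K)ˣ → P.adicCompletion F :=
    fun u => L.Y ((1 : P.adicCompletion F) ⊗ₜ[F] ((u : 𝓞 K) : K)) with hy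
  have hreal (u : (𝓞 K)ˣ) (hu : σ ((u : 𝓞 K) : K) = (u : 𝓞 K)) :
      ∃ c : 𝓞 F, algebraMap F K c = (u : 𝓞 K) := by
    obtain ⟨c, hc⟩ := hfix _ hu
    obtain ⟨b, rfl⟩ := exists_integer_of_mem_hatOrder (K := K) (c := c) (by
      rw [hc]
      exact tmul_mem_hatOrder (one_mem _) (mem_integralClosure_iff_exists.2 ⟨u, rfl⟩))
    exact ⟨b, hc⟩
  -- Units with the same image under `f` differ by a factor in `O_F`, which scales `Y` by an
  -- integral number. By symmetry the valuation of `Y` is constant on each fibre of `f`.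
  have hscale (u u' : (𝓞 K)ˣ) (h : f u = f u') {k : ℕ} (hk : y u ∈ pBall P k) :
      y u' ∈ pBall P k := by
    obtain ⟨c, hc⟩ := hreal (u' * u⁻¹) (hf _ (by rw [map_mul, map_inv, h, mul_inv_cancel]))
    have h1 : ((u' : 𝓞 K) : K) = algebraMap F K c * ((u : 𝓞 K) : K) := by
      rw [hc, ← map_mul, ← Units.val_mul, inv_mul_cancel_right]
    rw [hy]
    simp only
    rw [h1, L.Y_algebraMap_mul]
    exact pBall_mul (by omega) (algebraMap_mem_pBall_zero c) hk
  have hζ (ζ : Units.torsion K) : ∃ k : ℕ, ∀ u, f u = ζ → y u ∈ pBall P k → y u = 0 := by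
    by_cases hex : ∃ u, f u = ζ ∧ y u ≠ 0
    · obtain ⟨u, hu, hu0⟩ := hex
      have h1 : ∃ k : ℕ, y u ∉ pBall P k := by
        by_contra! hcon
        exact hu0 (eq_zero_of_forall_mem_pBall hcon)
      obtain ⟨k, hk⟩ := h1
      exact ⟨k, fun u' hu' hmem => absurd (hscale u' u (hu'.trans hu.symm) hmem) hk⟩
    · push Not at hex
      exact ⟨0, fun u hu _ => hex u hu⟩
  choose k hk using hζ
  -- The group of roots of unity is finite, so one bound serves all fibres.
  obtain ⟨k₀, hk₀⟩ := (Set.finite_range k).bddAbove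
  refine ⟨k₀, ?_⟩
  rintro _ ⟨κ, rfl⟩ hκ n
  have h1 := mem_hatUnits.1 hκ
  obtain ⟨b, hb⟩ := isIntegral_of_one_tmul_mem (hatOrder_mono (condOrder_le k₀) h1.1)
  obtain ⟨b', hb'⟩ := isIntegral_of_one_tmul_mem (x := ((κ⁻¹ : Kˣ) : K))
    (hatOrder_mono (condOrder_le k₀) h1.2)
  have hbb' : b * b' = 1 := by
    apply RingOfIntegers.ext
    change (b : K) * (b' : K) = 1
    rw [hb, hb']
    simp
  set u : (𝓞 K)ˣ := ⟨b, b', hbb', by rw [mul_comm, hbb']⟩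
  -- Beyond the bound `Y` must vanish, so the unit is fixed by conjugation and lies in `O_F`.
  -- Applied to `u` and `u⁻¹`, this puts both into every `O_{P^n}`.
  have hfixed (u : (𝓞 K)ˣ) (h : y u ∈ pBall P k₀) : ∃ c : 𝓞 F, algebraMap F K c = (u : 𝓞 K) :=
    hreal u (L.map_eq_of_Y_eq_zero hσ hfix
      (hk _ u rfl (pBall_anti (by exact_mod_cast hk₀ ⟨f u, rfl⟩) h)))
  have hmem (c : 𝓞 F) : (1 : FinAdeles F) ⊗ₜ[F] algebraMap F K c ∈ hatOrder (condOrder K P n) :=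
    tmul_mem_hatOrder (one_mem _) ((condOrder K P n).algebraMap_mem c)
  obtain ⟨c, hc⟩ := hfixed u (by
    have := (L.mem_locOrder_condOrder.1 (toP_mem (P := P) h1.1)).2
    simp only [hy]
    change L.Y (1 ⊗ₜ[F] (b : K)) ∈ _
    rw [hb]
    simpa [toP] using this)
  obtain ⟨c', hc'⟩ := hfixed u⁻¹ (by
    have := (L.mem_locOrder_condOrder.1 (toP_mem (P := P) h1.2)).2
    simp only [hy]
    change L.Y (1 ⊗ₜ[F] (b' : K)) ∈ _
    rw [hb']
    rw [← map_inv] at this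
    simpa [toP] using this)
  rw [mem_hatUnits]
  constructor
  · have := hmem c
    rw [hc] at this
    change (1 : FinAdeles F) ⊗ₜ[F] (b : K) ∈ _ at this
    rwa [hb] at this
  · have := hmem c'
    rw [hc'] at this
    change (1 : FinAdeles F) ⊗ₜ[F] (b' : K) ∈ _ at this
    rwa [hb'] at this

end Units

/-! ### More on valuations, and the filtration of local units by conductor. -/

section LocalField

variable {F : Type*} [Field F] [NumberField F] {P : HeightOneSpectrum (𝓞 F)}

lemma mem_pBall_of_mul_mem {n e : ℤ} {x g : P.adicCompletion F} (h : x * g ∈ pBall P n)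
    (hg : g ∉ pBall P (e + 1)) : x ∈ pBall P (n - e) := by
  by_cases hx : x = 0
  · rw [hx]; exact zero_mem _
  have hx : Valued.v x ≠ 0 := by simpa using hx
  have hg0 : Valued.v g ≠ 0 := by
    intro h0
    rw [Valuation.zero_iff] at h0
    exact hg (h0 ▸ zero_mem _)
  rw [mem_pBall] at *
  rw [map_mul] at h
  rw [← WithZero.exp_log hg0] at h hg
  rw [← WithZero.exp_log hx] at h ⊢
  rw [← WithZero.exp_add, WithZero.exp_le_exp] at h
  rw [WithZero.exp_le_exp] at hg ⊢
  omega

lemma mem_pBall_zero_of_valued_eq_one {x : P.adicCompletion F} (h : Valued.v x = 1) :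
    x ∈ pBall P 0 := by
  rw [mem_pBall, h]; simp

lemma ne_zero_of_valued_eq_one {x : P.adicCompletion F} (h : Valued.v x = 1) : x ≠ 0 := by
  rintro rfl
  simp at h

lemma valued_eq_one_of_mul {x y : P.adicCompletion F} (hx : x ∈ pBall P 0) (hy : y ∈ pBall P 0)
    (h : Valued.v (x * y) = 1) : Valued.v x = 1 := by
  rw [map_mul] at h
  rw [mem_pBall, neg_zero, WithZero.exp_zero] at hx hy
  refine le_antisymm hx ?_
  rw [← h]
  exact mul_le_of_le_one_right' hy

lemma unit_mul_mem_pBall {n : ℤ} {x y : P.adicCompletion F} (hx : Valued.v x = 1) :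
    x * y ∈ pBall P n ↔ y ∈ pBall P n := by
  rw [mem_pBall, mem_pBall, map_mul, hx, one_mul]

end LocalField

namespace LocalData

variable {F : Type*} [Field F] [NumberField F] {K : Type*} [Field K] [NumberField K] [Algebra F K]
  {P : HeightOneSpectrum (𝓞 F)} {B : Type*} [Ring B] [Algebra F B]
  {ι : K →ₐ[F] B} (L : LocalData ι P)

/-- The norm of `x + zα`. -/
def normXY (x z : P.adicCompletion F) : P.adicCompletion F := x * (x + z * L.tr) + z * z * L.nm

lemma exists_unit {x z : P.adicCompletion F} (h : L.normXY x z ≠ 0) :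
    ∃ w : (AtP P K)ˣ, L.X w = x ∧ L.Y w = z ∧
      L.X (w⁻¹ : (AtP P K)ˣ) = (x + z * L.tr) / L.normXY x z ∧
      L.Y (w⁻¹ : (AtP P K)ˣ) = -z / L.normXY x z := by
  have h1 : (x • (1 : AtP P K) + z • L.α) *
      (((x + z * L.tr) / L.normXY x z) • (1 : AtP P K) + (-z / L.normXY x z) • L.α) = 1 := by
    refine L.ext_XY ?_ ?_
    · simp only [X_mul, map_add, map_smul, X_one, Y_one, X_α, Y_α, smul_eq_mul]
      field_simp
      rw [normXY]
      ring
    · simp only [Y_mul, map_add, map_smul, X_one, Y_one, X_α, Y_α, smul_eq_mul]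
      field_simp
      ring
  refine ⟨⟨_, _, h1, ?_⟩, ?_⟩
  · exact (mul_comm (G := P.adicCompletion F ⊗[F] K) _ _).trans h1
  · simp

lemma X_mul_X_inv (w : (AtP P K)ˣ) :
    L.X w * L.X (w⁻¹ : (AtP P K)ˣ) = 1 + L.Y w * L.Y (w⁻¹ : (AtP P K)ˣ) * L.nm := by
  have h := L.X_mul w (w⁻¹ : (AtP P K)ˣ)
  rw [Units.mul_inv, X_one] at h
  rw [h]
  ring

lemma mem_locUnits_condOrder {n : ℕ} {w : (AtP P K)ˣ} :
    w ∈ locUnits P (condOrder K P n) ↔ (L.X w ∈ pBall P 0 ∧ L.Y w ∈ pBall P n) ∧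
      L.X (w⁻¹ : (AtP P K)ˣ) ∈ pBall P 0 ∧ L.Y (w⁻¹ : (AtP P K)ˣ) ∈ pBall P n := by
  rw [mem_locUnits, L.mem_locOrder_condOrder, L.mem_locOrder_condOrder]

/-- Modulo `P` both `Y w` and `Y w⁻¹` vanish, so `X w` and `X w⁻¹` are inverse to each other there.
-/
lemma valued_X {k : ℕ} (hk : 1 ≤ k) {w : (AtP P K)ˣ} (hw : w ∈ locUnits P (condOrder K P k)) :
    Valued.v (L.X w) = 1 := by
  rw [L.mem_locUnits_condOrder] at hw
  obtain ⟨⟨h1, h2⟩, h3, h4⟩ := hw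
  refine valued_eq_one_of_mul h1 h3 ?_
  rw [X_mul_X_inv]
  refine valued_add_eq_one (map_one _) ?_
  exact pBall_mul (a := 1) (by omega)
    (pBall_mul (a := k) (b := k) (by omega) h2 h4) L.nm_mem

/-- The relation `Y (w w⁻¹) = 0`, with `X w` a unit, makes `Y w⁻¹` an integral multiple of `Y w`; no
separate condition on the inverse remains. -/
lemma mem_locUnits_condOrder_iff_of_mem {k n : ℕ} (hk : 1 ≤ k) {w : (AtP P K)ˣ}
    (hw : w ∈ locUnits P (condOrder K P k)) :
    w ∈ locUnits P (condOrder K P n) ↔ L.Y w ∈ pBall P n := by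
  have hX := L.valued_X hk hw
  rw [L.mem_locUnits_condOrder] at hw
  obtain ⟨⟨h1, h2⟩, h3, h4⟩ := hw
  refine ⟨fun h => (L.mem_locUnits_condOrder.1 h).1.2, fun h => ?_⟩
  refine L.mem_locUnits_condOrder.2 ⟨⟨h1, h⟩, h3, ?_⟩
  have h5 := L.Y_mul w (w⁻¹ : (AtP P K)ˣ)
  rw [Units.mul_inv, Y_one] at h5
  have h6 : L.X w * L.Y (w⁻¹ : (AtP P K)ˣ) = -(L.Y w * (L.X (w⁻¹ : (AtP P K)ˣ) +
      L.Y (w⁻¹ : (AtP P K)ˣ) * L.tr)) := by linear_combination -h5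
  rw [← unit_mul_mem_pBall hX, h6]
  refine neg_mem (pBall_mul (a := n) (b := 0) (by omega) h (add_mem h3 ?_))
  exact pBall_mul (a := 0) (b := 0) (by omega) (pBall_anti (by omega) h4) L.tr_mem

lemma exists_mem_locUnits {k : ℕ} (hk : 1 ≤ k) {x z : P.adicCompletion F} (hx : Valued.v x = 1)
    (hz : z ∈ pBall P k) :
    ∃ w ∈ locUnits P (condOrder K P k), L.X w = x ∧ L.Y w = z := by
  have hx0 := mem_pBall_zero_of_valued_eq_one hx
  have hz0 : z ∈ pBall P 0 := pBall_anti (by omega) hz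
  have hv : Valued.v (L.normXY x z) = 1 := by
    have h1 : L.normXY x z = x * x + z * (x * L.tr + z * L.nm) := by rw [normXY]; ring
    rw [h1]
    refine valued_add_eq_one (by rw [map_mul, hx, one_mul]) ?_
    exact pBall_mul (a := k) (b := 0) (by omega) hz
      (add_mem (pBall_mul le_rfl hx0 L.tr_mem) (pBall_mul le_rfl hz0 L.nm_mem))
  obtain ⟨w, h1, h2, h3, h4⟩ := L.exists_unit (ne_zero_of_valued_eq_one hv)
  refine ⟨w, L.mem_locUnits_condOrder.2 ⟨⟨?_, ?_⟩, ?_, ?_⟩, h1, h2⟩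
  · rwa [h1]
  · rwa [h2]
  · rw [h3, div_eq_mul_inv]
    exact pBall_mul (a := 0) (by omega)
      (add_mem hx0 (pBall_mul (a := 0) (by omega) hz0 L.tr_mem)) (inv_mem_pBall_zero hv)
  · rw [h4, div_eq_mul_inv]
    exact pBall_mul (a := k) (by omega) (neg_mem hz) (inv_mem_pBall_zero hv)

/-- The first terms of the binomial expansion of `(x + zα)^q`. -/
lemma exists_Y_pow (y : AtP P K) (hX : L.X y ∈ pBall P 0) (hY : L.Y y ∈ pBall P 0) (q : ℕ) :
    ∃ c ∈ pBall P 0, ∃ c' ∈ pBall P 0, L.X (y ^ (q + 1)) = L.X y ^ (q + 1) + L.Y y * c' ∧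
      L.Y (y ^ (q + 1)) = L.Y y * ((q + 1 : ℕ) * L.X y ^ q + L.Y y * c) := by
  have hpow (i : ℕ) : L.X y ^ i ∈ pBall P 0 :=
    mem_pBall_zero.2 (pow_mem (mem_pBall_zero.1 hX) i)
  have hnat (i : ℕ) : (i : P.adicCompletion F) ∈ pBall P 0 :=
    mem_pBall_zero.2 (natCast_mem _ i)
  have hm {a b : P.adicCompletion F} (ha : a ∈ pBall P 0) (hb : b ∈ pBall P 0) :
      a * b ∈ pBall P 0 := pBall_mul (by omega) ha hb
  induction q with
  | zero => exact ⟨0, zero_mem _, 0, zero_mem _, by simp, by simp⟩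
  | succ q ih =>
    obtain ⟨c, hc, c', hc', h1, h2⟩ := ih
    have hg : ((q + 1 : ℕ) * L.X y ^ q + L.Y y * c) ∈ pBall P 0 :=
      add_mem (hm (hnat _) (hpow _)) (hm hY hc)
    refine ⟨c' + c * L.X y + ((q + 1 : ℕ) * L.X y ^ q + L.Y y * c) * L.tr,
      add_mem (add_mem hc' (hm hc hX)) (hm hg L.tr_mem),
      c' * L.X y - L.Y y * ((q + 1 : ℕ) * L.X y ^ q + L.Y y * c) * L.nm,
      sub_mem (hm hc' hX) (hm (hm hY hg) L.nm_mem), ?_, ?_⟩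
    · rw [pow_succ, X_mul, h1, h2]
      ring
    · rw [pow_succ, Y_mul, h1, h2]
      push_cast
      ring

/-- By the binomial expansion `Y (w ^ q)` is `Y w` times `q X^(q-1) + Y w · c`. Since `Y w` is
divisible by `P^(e+1)` and `q` is not, the second factor has valuation at most `e`, so dividing by
it loses at most `e`. -/
lemma mem_locUnits_of_pow_mem (L : LocalData ι P) {e : ℕ} {q : ℕ} (hq0 : q ≠ 0)
    (hq : (q : P.adicCompletion F) ∉ pBall P (e + 1)) {k n : ℕ} (hk : e + 1 ≤ k)
    {w : (AtP P K)ˣ} (hw : w ∈ locUnits P (condOrder K P k))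
    (h : w ^ q ∈ locUnits P (condOrder K P (n + e))) : w ∈ locUnits P (condOrder K P n) := by
  have hX := L.valued_X (by omega) hw
  rw [L.mem_locUnits_condOrder_iff_of_mem (by omega) hw]
  obtain ⟨q, rfl⟩ := Nat.exists_eq_succ_of_ne_zero hq0
  have hw1 := (L.mem_locUnits_condOrder.1 hw).1
  obtain ⟨c, hc, -, -, -, hY⟩ := L.exists_Y_pow (w : AtP P K) hw1.1 (pBall_anti (by omega) hw1.2) q
  have h1 := (L.mem_locUnits_condOrder.1 h).1.2
  rw [Units.val_pow_eq_pow_val, Nat.succ_eq_add_one, hY] at h1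
  have h2 := mem_pBall_of_mul_mem (e := e) h1 (fun hg => hq ?_)
  · simpa using h2
  · have h3 : L.Y w * c ∈ pBall P (e + 1) := pBall_mul (a := k) (b := 0) (by omega) hw1.2 hc
    have h4 := sub_mem hg h3
    rw [add_sub_cancel_right, mul_comm, unit_mul_mem_pBall (by rw [map_pow, hX, one_pow])] at h4
    exact h4

end LocalData

/-! ### Ring class groups: kernels of the projections and torsion of `G(∞)`. -/

section RingClassGroup

variable {F : Type*} [Field F] [NumberField F] {K : Type*} [Field K] [NumberField K] [Algebra F K]
  {P : HeightOneSpectrum (𝓞 F)} {B : Type*} [Ring B] [Algebra F B]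
  {ι : K →ₐ[F] B}

lemma hatUnits_condOrder_anti {k n : ℕ} (h : k ≤ n) :
    hatUnits (condOrder K P n) ≤ hatUnits (condOrder K P k) :=
  Submonoid.units_mono (hatOrder_mono (condOrder_anti K P h))

lemma mem_ringClassSubgroup {n : ℕ} {s : (Hat F K)ˣ} :
    s ∈ ringClassSubgroup K P n ↔
      ∃ t ∈ rationalUnits F K, ∃ u ∈ hatUnits (condOrder K P n), t * u = s := by
  have : (rationalUnits F K).Normal := ⟨fun t ht s => by
    rw [torus_mul_comm F K s t, mul_assoc, mul_inv_cancel, mul_one]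
    exact ht⟩
  rw [ringClassSubgroup]
  exact Subgroup.mem_sup_of_normal_left

/-- `k` is large enough for all units of `O_{𝒫ᵏ}` to come from `O_F`. -/
def UnitsTrivial (K : Type*) [Field K] [NumberField K] [Algebra F K]
    (P : HeightOneSpectrum (𝓞 F)) (k : ℕ) : Prop :=
  ∀ t ∈ rationalUnits F K, t ∈ hatUnits (condOrder K P k) → ∀ n, t ∈ hatUnits (condOrder K P n)

/-- A global factor relating the local unit to `Ô_{P^n}^×` would be a unit of `O_{P^k}`, hence a
unit of every `O_{P^n}`, so it can be absorbed. -/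
lemma mk_localUnit_eq_one {k₀ k n : ℕ} (h₀ : UnitsTrivial K P k₀) (hk : k₀ ≤ k) (hn : k ≤ n)
    {w : (AtP P K)ˣ} (hw : w ∈ locUnits P (condOrder K P k)) :
    (QuotientGroup.mk (localUnit P w) : GalGroup K P n) = 1 ↔
      w ∈ locUnits P (condOrder K P n) := by
  rw [QuotientGroup.eq_one_iff, mem_ringClassSubgroup, ← localUnit_mem]
  constructor
  · rintro ⟨t, ht, u, hu, htu⟩
    rw [← htu]
    refine mul_mem (h₀ t ht (hatUnits_condOrder_anti hk ?_) n) hu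
    rw [← eq_mul_inv_iff_mul_eq] at htu
    rw [htu]
    exact mul_mem (localUnit_mem.2 hw) (inv_mem (hatUnits_condOrder_anti hn hu))
  · intro h
    exact ⟨1, one_mem _, _, h, one_mul _⟩

/-- Outside `P` the orders of conductor `P^k` and `P^n` agree, so after removing a global factor
only the `P`-component of the representative matters. -/
lemma exists_localUnit_of_galProj_eq_one {k n : ℕ} (hn : k ≤ n) {σ : GalGroup K P n}
    (h : galProj K P hn σ = 1) :
    ∃ w ∈ locUnits P (condOrder K P k), σ = QuotientGroup.mk (localUnit P w) := by
  induction σ using QuotientGroup.induction_on with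
  | H s =>
    have h1 : s ∈ ringClassSubgroup K P k := (QuotientGroup.eq_one_iff s).1 h
    obtain ⟨t, ht, u, hu, rfl⟩ := mem_ringClassSubgroup.1 h1
    have hu' := (mem_hatUnits_iff P).1 hu
    refine ⟨toPUnits P u, hu'.2, (QuotientGroup.eq.2 ?_).symm⟩
    refine mem_ringClassSubgroup.2 ⟨t, ht, (localUnit P (toPUnits P u))⁻¹ * u, ?_, ?_⟩
    · rw [mem_hatUnits_condOrder_iff hn]
      refine ⟨mul_mem (inv_mem (localUnit_mem.2 hu'.2)) hu, ?_⟩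
      simp
    · rw [← mul_assoc, ← mul_assoc, torus_mul_comm F K t]

lemma galProj_galInf (s : GalInf K P) {k n : ℕ} (h : k ≤ n) :
    galProj K P h (s.1 n) = s.1 k := s.2 k n h

/-- For large `k`, no nontrivial torsion element of `G(∞)` becomes trivial in `G(k)`. -/
lemma LocalData.exists_torsionFree [IsTotallyReal F] [IsTotallyComplex K]
    [Algebra.IsQuadraticExtension F K] (L : LocalData ι P) :
    ∃ k₀ : ℕ, 1 ≤ k₀ ∧ UnitsTrivial K P k₀ ∧ ∀ k ≥ k₀, ∀ s : GalInf K P,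
      IsOfFinOrder s → s.1 k = 1 → s = 1 := by
  obtain ⟨k₀, hk₀⟩ := L.exists_conductor
  obtain ⟨e, he⟩ := exists_forall_prime_notMem P
  -- The level must exceed `k₀` to control global units, and be at least `e + 1` for taking `q`-th
  -- roots of local units.
  refine ⟨k₀ + e + 1, by omega,
    fun t ht htk => hk₀ t ht (hatUnits_condOrder_anti (by omega) htk), fun k hk => ?_⟩
  have hprime (q : ℕ) (hq : q.Prime) (s : GalInf K P) (hs : s ^ q = 1) (hsk : s.1 k = 1) :
      s = 1 := by
    -- The relation `s ^ q = 1` is read at level `n + e`, because extracting a `q`-th root costs up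
    -- to `e` levels.
    have hlarge (n : ℕ) (hn : k ≤ n) : s.1 n = 1 := by
      obtain ⟨w, hw, hsw⟩ := exists_localUnit_of_galProj_eq_one (k := k) (n := n + e)
        (σ := s.1 (n + e)) (by omega) (by rw [galProj_galInf, hsk])
      have h1 : (s.1 (n + e)) ^ q = 1 := congrFun (congrArg Subtype.val hs) (n + e)
      rw [hsw, ← QuotientGroup.mk_pow, ← map_pow,
        mk_localUnit_eq_one hk₀ (by omega) (by omega) (pow_mem hw q)] at h1
      have h2 := L.mem_locUnits_of_pow_mem hq.ne_zero (he q hq) (by omega) hw h1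
      rw [← galProj_galInf s (by omega : n ≤ n + e), hsw]
      exact (mk_localUnit_eq_one hk₀ (by omega) hn hw).2 h2
    apply Subtype.ext
    funext n
    rw [← galProj_galInf s (le_max_left n k), hlarge _ (le_max_right n k), map_one]
    rfl
  intro s hs hsk
  by_contra hne
  have hd : orderOf s ≠ 1 := by rwa [ne_eq, orderOf_eq_one_iff]
  have hq := Nat.minFac_prime hd
  have hdvd := Nat.minFac_dvd (orderOf s)
  -- A nontrivial element of finite order has a power of prime order, and this power also dies at
  -- level `k`.
  have h1 := hprime _ hq (s ^ (orderOf s / (orderOf s).minFac))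
    (by rw [← pow_mul, Nat.div_mul_cancel hdvd, pow_orderOf_eq_one])
    (by
      change (s.1 k) ^ _ = 1
      rw [hsk, one_pow])
  have h2 := Nat.le_of_dvd (Nat.div_pos (Nat.le_of_dvd hs.orderOf_pos hdvd) hq.pos)
    (orderOf_dvd_of_pow_eq_one h1)
  exact absurd h2 (not_le.2 (Nat.div_lt_self hs.orderOf_pos hq.one_lt))

/-- Injectivity: an element of the kernel which comes from a torsion `s` has `s` trivial at level `n
- m`, so `s = 1`. Surjectivity: if the image of `σ` at level `n - m` comes from a torsion `s`, then
`σ` times the inverse of the `n`-th component of `s` is in the kernel and has the same class as `σ`.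
-/
lemma exists_galKer_equiv {k₀ : ℕ}
    (h₀ : ∀ k ≥ k₀, ∀ s : GalInf K P, IsOfFinOrder s → s.1 k = 1 → s = 1)
    {n m : ℕ} (hnm : k₀ ≤ n - m) :
    ∃ e : galKer K P n m ≃* Z K P n m,
      ∀ σ : galKer K P n m, (e σ : AntiGroup K P n) = QuotientGroup.mk (σ : GalGroup K P n) := by
  let f : galKer K P n m →* Z K P n m :=
    ((QuotientGroup.mk' (torsionImage K P n)).comp (galKer K P n m).subtype).codRestrict _ <| by
      rintro ⟨σ, hσ⟩
      change (QuotientGroup.mk (galProj K P _ σ) : AntiGroup K P (n - m)) = 1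
      have : galProj K P (Nat.sub_le n m) σ = 1 := hσ
      rw [this]
      rfl
  have hf (σ : galKer K P n m) : (f σ : AntiGroup K P n) =
      QuotientGroup.mk (σ : GalGroup K P n) := rfl
  refine ⟨MulEquiv.ofBijective f ⟨?_, ?_⟩, hf⟩
  · rw [injective_iff_map_eq_one]
    rintro ⟨σ, hσ⟩ h
    have h1 : (QuotientGroup.mk σ : AntiGroup K P n) = 1 := congrArg Subtype.val h
    rw [QuotientGroup.eq_one_iff] at h1
    obtain ⟨s, hs, rfl⟩ := h1
    have h2 : s.1 (n - m) = 1 := by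
      rw [← galProj_galInf s (Nat.sub_le n m)]
      exact hσ
    have h3 := h₀ _ hnm s hs h2
    apply Subtype.ext
    exact congrFun (congrArg Subtype.val h3) n
  · rintro ⟨z, hz⟩
    induction z using QuotientGroup.induction_on with
    | H σ =>
      have h1 : galProj K P (Nat.sub_le n m) σ ∈ torsionImage K P (n - m) :=
        (QuotientGroup.eq_one_iff _).1 hz
      obtain ⟨s, hs, hsσ⟩ := h1
      have hsσ' : s.1 (n - m) = galProj K P (Nat.sub_le n m) σ := hsσ
      refine ⟨⟨σ * (s.1 n)⁻¹, ?_⟩, ?_⟩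
      · change galProj K P (Nat.sub_le n m) _ = 1
        rw [map_mul, map_inv, galProj_galInf, hsσ', mul_inv_cancel]
      · apply Subtype.ext
        rw [hf]
        change (QuotientGroup.mk (σ * (s.1 n)⁻¹) : AntiGroup K P n) = QuotientGroup.mk σ
        rw [QuotientGroup.eq]
        have : (σ * (s.1 n)⁻¹)⁻¹ * σ = s.1 n := by simp
        rw [this]
        exact ⟨s, hs, rfl⟩

end RingClassGroup

/-! ### The congruences defining `H_m`. -/

section Level

variable {F : Type*} [Field F] [NumberField F] (P : HeightOneSpectrum (𝓞 F))

/-- The subring of `M₂(O_{F,𝒫})` with group of units `levelK P δ m`. -/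
def levelRing (δ m : ℕ) : Subring (Matrix (Fin 2) (Fin 2) (P.adicCompletionIntegers F)) :=
  if δ < m then lowerRing P (2 * m - δ)
  else if δ < 2 * m then lowerRing P m
  else upperRing P m

lemma levelK_eq (δ m : ℕ) : levelK P δ m = (levelRing P δ m).toSubmonoid.units := by
  rw [levelK, levelRing]
  split_ifs <;> rfl

variable {P}

/-- The conditions defining `M⁰(𝒫^δ)`, for matrices over `F_𝒫`. -/
def IsM0 (δ : ℕ) (M : Matrix (Fin 2) (Fin 2) (P.adicCompletion F)) : Prop :=
  (M 0 0 ∈ pBall P 0 ∧ M 0 1 ∈ pBall P δ) ∧ M 1 0 ∈ pBall P 0 ∧ M 1 1 ∈ pBall P 0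

/-- The congruences which define `levelRing` inside the integral matrices. -/
def IsLevel (δ m : ℕ) (M : Matrix (Fin 2) (Fin 2) (P.adicCompletion F)) : Prop :=
  if δ < m then M 1 0 ∈ pBall P (2 * m - δ) ∧ M 0 0 - M 1 1 ∈ pBall P (2 * m - δ)
  else if δ < 2 * m then M 1 0 ∈ pBall P m ∧ M 0 0 - M 1 1 ∈ pBall P m
  else M 0 1 ∈ pBall P m ∧ M 0 0 - M 1 1 ∈ pBall P m

lemma mem_M0_iff {δ : ℕ} {M : Matrix (Fin 2) (Fin 2) (P.adicCompletionIntegers F)} :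
    M ∈ M0 P δ ↔ IsM0 δ (M.map (P.adicCompletionIntegers F).subtype) := by
  have : M ∈ M0 P δ ↔ M 0 1 ∈ pPow P δ := Iff.rfl
  rw [this, mem_pPow_iff, IsM0]
  simp [coe_mem_pBall_zero]

lemma mem_levelRing_iff {δ m : ℕ} {M : Matrix (Fin 2) (Fin 2) (P.adicCompletionIntegers F)} :
    M ∈ levelRing P δ m ↔ IsLevel δ m (M.map (P.adicCompletionIntegers F).subtype) := by
  have hl (k : ℕ) : M ∈ lowerRing P k ↔ M 1 0 ∈ pPow P k ∧ M 0 0 - M 1 1 ∈ pPow P k := Iff.rfl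
  have hu (k : ℕ) : M ∈ upperRing P k ↔ M 0 1 ∈ pPow P k ∧ M 0 0 - M 1 1 ∈ pPow P k := Iff.rfl
  rw [levelRing, IsLevel]
  split_ifs with h1 h2
  · rw [hl, mem_pPow_iff, mem_pPow_iff]
    push_cast [Nat.cast_sub (by omega : δ ≤ 2 * m)]
    rfl
  · rw [hl, mem_pPow_iff, mem_pPow_iff]
    rfl
  · rw [hu, mem_pPow_iff, mem_pPow_iff]
    rfl

lemma IsM0.exists_map {δ : ℕ} {M : Matrix (Fin 2) (Fin 2) (P.adicCompletion F)}
    (h : IsM0 δ M) : ∃ N : Matrix (Fin 2) (Fin 2) (P.adicCompletionIntegers F),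
      N.map (P.adicCompletionIntegers F).subtype = M := by
  obtain ⟨⟨h00, h01⟩, h10, h11⟩ := h
  refine ⟨!![⟨_, mem_pBall_zero.1 h00⟩, ⟨_, mem_pBall_zero.1 (pBall_anti (by omega) h01)⟩;
    ⟨_, mem_pBall_zero.1 h10⟩, ⟨_, mem_pBall_zero.1 h11⟩], ?_⟩
  ext i j
  fin_cases i <;> fin_cases j <;> rfl

variable (P) in
/-- The matrices over `F_𝒫` that lie in both `M⁰(𝒫^δ)` and `levelRing P δ m`. -/
def fieldLevelRing (δ m : ℕ) : Subring (Matrix (Fin 2) (Fin 2) (P.adicCompletion F)) :=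
  (M0 P δ ⊓ levelRing P δ m).map (P.adicCompletionIntegers F).subtype.mapMatrix

lemma mem_fieldLevelRing {δ m : ℕ} {M : Matrix (Fin 2) (Fin 2) (P.adicCompletion F)} :
    M ∈ fieldLevelRing P δ m ↔ IsM0 δ M ∧ IsLevel δ m M := by
  constructor
  · rintro ⟨N, ⟨h1, h2⟩, rfl⟩
    exact ⟨mem_M0_iff.1 h1, mem_levelRing_iff.1 h2⟩
  · rintro ⟨h1, h2⟩
    obtain ⟨N, rfl⟩ := h1.exists_map
    exact ⟨N, ⟨mem_M0_iff.2 h1, mem_levelRing_iff.2 h2⟩, rfl⟩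

lemma smul_one_mem_fieldLevelRing {δ m : ℕ} {c : P.adicCompletion F} (hc : c ∈ pBall P 0) :
    c • (1 : Matrix (Fin 2) (Fin 2) (P.adicCompletion F)) ∈ fieldLevelRing P δ m := by
  rw [mem_fieldLevelRing, IsM0, IsLevel]
  refine ⟨by simp [hc], ?_⟩
  split_ifs <;> simp

lemma smul_mem_fieldLevelRing {δ m : ℕ} {c : P.adicCompletion F} (hc : c ∈ pBall P 0)
    {M : Matrix (Fin 2) (Fin 2) (P.adicCompletion F)} (hM : M ∈ fieldLevelRing P δ m) :
    c • M ∈ fieldLevelRing P δ m := by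
  have := mul_mem (smul_one_mem_fieldLevelRing (δ := δ) (m := m) hc) hM
  rwa [smul_mul_assoc, one_mul] at this

/-- In all three cases the modulus of the congruences divides `P^(2m)`. -/
lemma IsM0.smul_mem_fieldLevelRing {δ m : ℕ} {c : P.adicCompletion F}
    (hc : c ∈ pBall P (2 * m)) {M : Matrix (Fin 2) (Fin 2) (P.adicCompletion F)}
    (hM : IsM0 δ M) : c • M ∈ fieldLevelRing P δ m := by
  obtain ⟨⟨h00, h01⟩, h10, h11⟩ := hM
  have hc0 : c ∈ pBall P 0 := pBall_anti (by omega) hc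
  rw [mem_fieldLevelRing]
  refine ⟨⟨⟨?_, ?_⟩, ?_, ?_⟩, ?_⟩
  · exact pBall_mul le_rfl hc0 h00
  · exact pBall_mul (b := δ) (by omega) hc0 h01
  · exact pBall_mul le_rfl hc0 h10
  · exact pBall_mul le_rfl hc0 h11
  · simp only [IsLevel, Matrix.smul_apply, smul_eq_mul, ← mul_sub]
    split_ifs
    · exact ⟨pBall_mul (by omega) hc h10, pBall_mul (by omega) hc (sub_mem h00 h11)⟩
    · exact ⟨pBall_mul (by omega) hc h10, pBall_mul (by omega) hc (sub_mem h00 h11)⟩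
    · exact ⟨pBall_mul (by omega) hc h01, pBall_mul (by omega) hc (sub_mem h00 h11)⟩

/-- Matrices of level `m` stay in `M⁰(𝒫^δ)` after conjugation by `!![1, x; 0, 1]`, for
`x ∈ 𝒫^{δ-m}`. -/
lemma isM0_conj_unipotent {δ m : ℕ} {M : Matrix (Fin 2) (Fin 2) (P.adicCompletion F)}
    (hM : M ∈ fieldLevelRing P δ m) {x : P.adicCompletion F} (hx : x ∈ pBall P (δ - m)) :
    IsM0 δ (!![1, -x; 0, 1] * M * !![1, x; 0, 1]) := by
  rw [mem_fieldLevelRing] at hM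
  obtain ⟨⟨⟨h00, h01⟩, h10, h11⟩, hl⟩ := hM
  -- Conjugation sends `!![a, b; c, d]` to `!![a - xc, b + (a-d)x - x²c; c, d + cx]`. The term `x²c`
  -- explains the three cases: `x²` lies in `P^(2δ-2m)`, so `c ∈ P^(2m-δ)` is needed for `δ < m`, `c
  -- ∈ P^m` suffices for `m ≤ δ`, and integrality of `c` is enough once `δ ≥ 2m`.
  have key : M 1 0 * x ∈ pBall P 0 ∧ (M 0 0 - M 1 1) * x ∈ pBall P δ ∧
      x * x * M 1 0 ∈ pBall P δ := by
    have hxx : x * x ∈ pBall P (2 * δ - 2 * m) := pBall_mul (by omega) hx hx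
    rw [IsLevel] at hl
    split_ifs at hl
    · exact ⟨pBall_mul (by omega) hl.1 hx, pBall_mul (by omega) hl.2 hx,
        pBall_mul (by omega) hxx hl.1⟩
    · exact ⟨pBall_mul (by omega) hl.1 hx, pBall_mul (by omega) hl.2 hx,
        pBall_mul (by omega) hxx hl.1⟩
    · exact ⟨pBall_mul (by omega) h10 hx, pBall_mul (by omega) hl.2 hx,
        pBall_mul (by omega) hxx h10⟩
  obtain ⟨k1, k2, k3⟩ := key
  refine ⟨⟨?_, ?_⟩, ?_, ?_⟩
  · simp only [Matrix.mul_apply, Fin.sum_univ_two, Matrix.cons_val', Matrix.cons_val_zero,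
      Matrix.cons_val_one, Matrix.of_apply, Matrix.cons_val_fin_one]
    convert sub_mem h00 k1 using 1
    ring
  · simp only [Matrix.mul_apply, Fin.sum_univ_two, Matrix.cons_val', Matrix.cons_val_zero,
      Matrix.cons_val_one, Matrix.of_apply, Matrix.cons_val_fin_one]
    convert sub_mem (add_mem h01 k2) k3 using 1
    ring
  · simp only [Matrix.mul_apply, Fin.sum_univ_two, Matrix.cons_val', Matrix.cons_val_zero,
      Matrix.cons_val_one, Matrix.of_apply, Matrix.cons_val_fin_one]
    convert h10 using 1
    ring
  · simp only [Matrix.mul_apply, Fin.sum_univ_two, Matrix.cons_val', Matrix.cons_val_zero,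
      Matrix.cons_val_one, Matrix.of_apply, Matrix.cons_val_fin_one]
    convert add_mem h11 k1 using 1
    ring

end Level

/-! ### The order `R_m` and its unit group. -/

namespace LocalData

variable {F : Type*} [Field F] [NumberField F] {K : Type*} [Field K] [NumberField K] [Algebra F K]
  {P : HeightOneSpectrum (𝓞 F)} {B : Type*} [Ring B] [Algebra F B]
  {ι : K →ₐ[F] B} (L : LocalData ι P)

/-- The identification of `B_𝒫` with `M₂(F_𝒫)` followed by conjugation by `h⁻¹`. -/
def conj : AtP P B →ₐ[P.adicCompletion F] Matrix (Fin 2) (Fin 2) (P.adicCompletion F) :=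
  AlgHom.ofLinearMap
    (LinearMap.mulLeft _ ((L.h⁻¹ : GL (Fin 2) (P.adicCompletion F)) : Matrix _ _ _) ∘ₗ
      LinearMap.mulRight _ (L.h : Matrix (Fin 2) (Fin 2) (P.adicCompletion F)) ∘ₗ
        L.φ.toLinearMap)
    (by simp)
    (by
      intro x y
      simp only [LinearMap.comp_apply, LinearMap.mulLeft_apply, LinearMap.mulRight_apply,
        AlgEquiv.toLinearMap_apply, map_mul, mul_assoc]
      simp only [← mul_assoc]
      simp only [mul_assoc _ (L.h : Matrix (Fin 2) (Fin 2) (P.adicCompletion F)), Units.mul_inv,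
        mul_one])

lemma conj_apply (y : AtP P B) :
    L.conj y = ((L.h⁻¹ : GL (Fin 2) (P.adicCompletion F)) : Matrix _ _ _) *
      (L.φ y * (L.h : Matrix (Fin 2) (Fin 2) (P.adicCompletion F))) := rfl

lemma φ_eq_iff {y : AtP P B} {M : Matrix (Fin 2) (Fin 2) (P.adicCompletion F)} :
    L.φ y = (L.h : Matrix (Fin 2) (Fin 2) (P.adicCompletion F)) * M *
      ((L.h⁻¹ : GL (Fin 2) (P.adicCompletion F)) : Matrix _ _ _) ↔ L.conj y = M := by
  rw [conj_apply, Units.inv_mul_eq_iff_eq_mul, Units.eq_mul_inv_iff_mul_eq]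

variable {L} in
lemma IsEichler.mem_locOrder_iff {δ : ℕ} {R : Subalgebra (𝓞 F) B} (hR : L.IsEichler δ R)
    {y : AtP P B} : y ∈ locOrder P R ↔ IsM0 δ (L.conj y) := by
  rw [hR y]
  constructor
  · rintro ⟨M, hM, h⟩
    rw [L.φ_eq_iff.1 h]
    exact mem_M0_iff.1 hM
  · intro h
    obtain ⟨N, hN⟩ := h.exists_map
    exact ⟨N, mem_M0_iff.2 (hN ▸ h), L.φ_eq_iff.2 hN.symm⟩

/-- The order `R_m`. -/
def levelOrder (δ m : ℕ) (R : Subalgebra (𝓞 F) B) : Subalgebra (𝓞 F) B where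
  toSubsemiring := R.toSubsemiring ⊓ ((fieldLevelRing P δ m).comap
    ((L.conj : AtP P B →+* _).comp
      ((Algebra.TensorProduct.includeRight : B →ₐ[F] AtP P B) : B →+* AtP P B))).toSubsemiring
  algebraMap_mem' c := by
    refine ⟨R.algebraMap_mem c, ?_⟩
    change L.conj ((1 : P.adicCompletion F) ⊗ₜ[F] algebraMap (𝓞 F) B c) ∈ fieldLevelRing P δ m
    rw [one_tmul_algebraMap, map_smul, map_one]
    exact smul_one_mem_fieldLevelRing (algebraMap_mem_pBall_zero c)

lemma levelOrder_le (δ m : ℕ) (R : Subalgebra (𝓞 F) B) : L.levelOrder δ m R ≤ R :=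
  fun _ h => h.1

variable {L}

/-- Because `R_m` contains `P^(2m) R`, it has full rank and differs from `R` only at `P`. -/
lemma IsEichler.smul_mem_levelOrder {δ m : ℕ} {R : Subalgebra (𝓞 F) B} (hR : L.IsEichler δ R)
    {a : 𝓞 F} (ha : a ∈ P.asIdeal ^ (2 * m)) {r : B} (hr : r ∈ R) :
    (a : F) • r ∈ L.levelOrder δ m R := by
  refine ⟨R.smul_mem hr a, ?_⟩
  change L.conj ((1 : P.adicCompletion F) ⊗ₜ[F] ((a : F) • r)) ∈ fieldLevelRing P δ m
  rw [TensorProduct.tmul_smul, ← algebraMap_smul (P.adicCompletion F), map_smul]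
  refine IsM0.smul_mem_fieldLevelRing (δ := δ) ?_
    (hR.mem_locOrder_iff.1 (tmul_mem_locOrder (one_mem _) hr))
  exact_mod_cast algebraMap_mem_pBall.2 ha

lemma IsEichler.mem_locOrder_levelOrder {δ m : ℕ} {R : Subalgebra (𝓞 F) B}
    (hR : L.IsEichler δ R) {y : AtP P B} :
    y ∈ locOrder P (L.levelOrder δ m R) ↔ L.conj y ∈ fieldLevelRing P δ m := by
  have h1 : ∀ y ∈ locOrder P (L.levelOrder δ m R), L.conj y ∈ fieldLevelRing P δ m := by
    intro y hy
    refine locOrder_induction (p := fun y => L.conj y ∈ fieldLevelRing P δ m)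
      (fun y hy r hr => ?_) (fun x y hx hy => by rw [map_add]; exact add_mem hx hy) hy
    have h1 : y ⊗ₜ[F] r = y • ((1 : P.adicCompletion F) ⊗ₜ[F] r) := by
      rw [TensorProduct.smul_tmul', smul_eq_mul, mul_one]
    rw [h1, map_smul]
    exact smul_mem_fieldLevelRing (mem_pBall_zero.2 hy) hr.2
  refine ⟨h1 y, fun hy => ?_⟩
  obtain ⟨π, hπ, -, ⟨t, ht, hv⟩, -⟩ := exists_isolated P (2 * m)
  -- Approximation: modulo `π R_P`, which is contained in the completion of `R_m`, each element of
  -- `R_P` comes from `R`. Approximating scalars modulo `P^t`, with `t` the valuation of `π`, makes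
  -- the error divisible by `π`. If `y` satisfies the congruences, so does its approximation.
  have h2 : ∀ y ∈ locOrder P R, ∃ r ∈ R,
      y - (1 : P.adicCompletion F) ⊗ₜ[F] r ∈ locOrder P (L.levelOrder δ m R) := by
    intro y hy
    refine locOrder_induction (p := fun y => ∃ r ∈ R,
      y - (1 : P.adicCompletion F) ⊗ₜ[F] r ∈ locOrder P (L.levelOrder δ m R))
      (fun y hy r hr => ?_) ?_ hy
    · obtain ⟨c, hc⟩ := exists_integer_sub_mem_pBall (mem_pBall_zero.2 hy) t
      refine ⟨(c : F) • r, R.smul_mem hr c, ?_⟩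
      have hz := div_mem_pBall hc hv
      rw [sub_self, mem_pBall_zero] at hz
      have h3 := tmul_mem_locOrder hz (hR.smul_mem_levelOrder (m := m) hπ hr)
      convert h3 using 1
      rw [← TensorProduct.smul_tmul, ← TensorProduct.smul_tmul, ← TensorProduct.sub_tmul,
        Algebra.smul_def, Algebra.smul_def, mul_one, mul_div_cancel₀]
      intro h0
      rw [h0, map_zero] at hv
      exact WithZero.exp_ne_zero hv.symm
    · rintro x y ⟨r, hr, hx⟩ ⟨r', hr', hy⟩
      refine ⟨r + r', R.add_mem hr hr', ?_⟩
      convert add_mem hx hy using 1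
      rw [TensorProduct.tmul_add]
      abel
  obtain ⟨r, hr, h3⟩ := h2 y (hR.mem_locOrder_iff.2 (mem_fieldLevelRing.1 hy).1)
  have h4 : r ∈ L.levelOrder δ m R := by
    refine ⟨hr, ?_⟩
    have := sub_mem hy (h1 _ h3)
    rwa [← map_sub, sub_sub_cancel] at this
  have := add_mem h3 (tmul_mem_locOrder (one_mem _) h4)
  rwa [sub_add_cancel] at this

lemma IsEichler.isOrder_levelOrder {δ : ℕ} (m : ℕ) {R : Subalgebra (𝓞 F) B}
    (hR : L.IsEichler δ R) (h : IsOrder R) : IsOrder (L.levelOrder δ m R) := by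
  -- Finite generation passes to submodules because `O_F` is Noetherian.
  refine ⟨h.1.of_le (L.levelOrder_le δ m R), ?_⟩
  obtain ⟨π, hπ, h0, -, -⟩ := exists_isolated P (2 * m)
  rw [eq_top_iff, ← h.2, Submodule.span_le]
  intro r hr
  have h1 := Submodule.smul_mem _ (π : F)⁻¹
    (Submodule.subset_span (R := F) (hR.smul_mem_levelOrder (m := m) hπ hr))
  rwa [inv_smul_smul₀ (by simpa using h0)] at h1

/-- This trades the subgroup of integral invertible matrices for conditions on an element and its
inverse over `F_P`, where valuations can be computed. -/
lemma mem_levelH {δ m : ℕ} {R : Subalgebra (𝓞 F) B} (hR : L.IsEichler δ R) {x : (Hat F B)ˣ} :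
    x ∈ L.levelH δ m R ↔ x ∈ hatUnits R ∧
      L.conj (toPUnits P x) ∈ fieldLevelRing P δ m ∧
      L.conj (toPUnits P x⁻¹) ∈ fieldLevelRing P δ m := by
  rw [levelH, Subgroup.mem_inf, Subgroup.mem_comap]
  refine and_congr_right fun hx => ?_
  have hx' := mem_locUnits.1 ((mem_hatUnits_iff P).1 hx).2
  rw [hR.mem_locOrder_iff, hR.mem_locOrder_iff, ← map_inv] at hx'
  have hcomp (x : (Hat F B)ˣ) :
      L.φ (toPUnits P x) = (L.comp x : Matrix (Fin 2) (Fin 2) (P.adicCompletion F)) := rfl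
  constructor
  · rintro ⟨_, ⟨κ, hκ, rfl⟩, h⟩
    rw [SetLike.mem_coe, levelK_eq, Submonoid.mem_units_iff] at hκ
    have h1 : L.conj (toPUnits P x) =
        (κ : Matrix (Fin 2) (Fin 2) (P.adicCompletionIntegers F)).map
          (P.adicCompletionIntegers F).subtype := by
      rw [← L.φ_eq_iff, hcomp, ← h]
      rfl
    have h2 : L.conj (toPUnits P x⁻¹) =
        ((κ⁻¹ : GL (Fin 2) (P.adicCompletionIntegers F)) :
          Matrix (Fin 2) (Fin 2) (P.adicCompletionIntegers F)).map
          (P.adicCompletionIntegers F).subtype := by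
      rw [← L.φ_eq_iff, hcomp, map_inv, ← h, ← map_inv, ← map_inv]
      rfl
    rw [h1, h2] at hx' ⊢
    exact ⟨⟨_, ⟨mem_M0_iff.2 hx'.1, hκ.1⟩, rfl⟩, ⟨_, ⟨mem_M0_iff.2 hx'.2, hκ.2⟩, rfl⟩⟩
  · rintro ⟨⟨M, ⟨-, hM⟩, h1⟩, ⟨N, ⟨-, hN⟩, h2⟩⟩
    have hinj : Function.Injective
        ((P.adicCompletionIntegers F).subtype.mapMatrix : Matrix (Fin 2) (Fin 2) _ →+* _) :=
      Matrix.map_injective Subtype.val_injective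
    have hMN : M * N = 1 := by
      apply hinj
      rw [map_mul, h1, h2, ← map_mul, map_inv, Units.mul_inv, map_one, map_one]
    have hNM : N * M = 1 := by
      apply hinj
      rw [map_mul, h1, h2, ← map_mul, map_inv, Units.inv_mul, map_one, map_one]
    refine ⟨_, ⟨⟨M, N, hMN, hNM⟩, ?_, rfl⟩, ?_⟩
    · rw [SetLike.mem_coe, levelK_eq, Submonoid.mem_units_iff]
      exact ⟨hM, hN⟩
    · ext1
      exact (L.φ_eq_iff.2 h1.symm).symm

lemma IsEichler.hatUnits_levelOrder {δ m : ℕ} {R : Subalgebra (𝓞 F) B} (hR : L.IsEichler δ R) :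
    hatUnits (L.levelOrder δ m R) = L.levelH δ m R := by
  ext x
  rw [mem_levelH hR, mem_hatUnits_iff_of_le (L.levelOrder_le δ m R)
    (fun a ha r hr => hR.smul_mem_levelOrder ha hr), mem_locUnits, hR.mem_locOrder_levelOrder,
    hR.mem_locOrder_levelOrder, ← map_inv]

end LocalData

/-! ### Lattices in `K_P` and their multipliers. -/

section Lattice

lemma lower_mul_lower {k : Type*} [CommRing k] (a b c d : k) :
    !![a, 0; b, 1] * !![c, 0; d, 1] = !![a * c, 0; b * c + d, 1] := by
  simp

lemma lower_eq_one {k : Type*} [CommRing k] {a b : k} (ha : a = 1) (hb : b = 0) :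
    !![a, 0; b, 1] = (1 : Matrix (Fin 2) (Fin 2) k) := by
  rw [ha, hb, Matrix.one_fin_two]

variable {F : Type*} [Field F] [NumberField F] {P : HeightOneSpectrum (𝓞 F)}

lemma IsM0.mul {M N : Matrix (Fin 2) (Fin 2) (P.adicCompletion F)} {δ : ℕ} (hM : IsM0 δ M)
    (hN : IsM0 δ N) : IsM0 δ (M * N) := by
  obtain ⟨M, rfl⟩ := hM.exists_map
  obtain ⟨N, rfl⟩ := hN.exists_map
  rw [← Matrix.map_mul]
  exact mem_M0_iff.1 (mul_mem (mem_M0_iff.2 hM) (mem_M0_iff.2 hN))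

lemma two_notMem_pBall (hP : (2 : 𝓞 F) ∉ P.asIdeal) : (2 : P.adicCompletion F) ∉ pBall P 1 := by
  intro h
  refine hP ?_
  have := (algebraMap_mem_pBall (P := P) (c := 2) (n := 1)).1 (by
    rw [show ((2 : 𝓞 F) : F) = 2 from rfl, map_ofNat]
    exact h)
  simpa using this

/-- In odd residue characteristic, a monic quadratic polynomial over `O_{F,𝒫}` takes a unit
value. -/
lemma exists_quadratic_eq_unit (hP : (2 : 𝓞 F) ∉ P.asIdeal) {s d : P.adicCompletion F}
    (hs : s ∈ pBall P 0) (hd : d ∈ pBall P 0) :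
    ∃ u ∈ pBall P 0, Valued.v (u * u + u * s + d) = 1 := by
  have h1 : (1 : P.adicCompletion F) ∈ pBall P 0 := mem_pBall_zero.2 (one_mem _)
  by_contra! hcon
  have hmem (u : P.adicCompletion F) (hu : u ∈ pBall P 0) : u * u + u * s + d ∈ pBall P 1 :=
    (valued_eq_one_or (add_mem (add_mem (pBall_mul le_rfl hu hu) (pBall_mul le_rfl hu hs))
      hd)).resolve_left (hcon u hu)
  -- For `f(u) = u² + us + d` one has `f(1) + f(-1) - 2 f(0) = 2`, a unit at `P`; so `f` cannot be a
  -- nonunit at `0`, `1` and `-1` simultaneously.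
  have h0 := hmem 0 (zero_mem _)
  have h2 := hmem 1 h1
  have h3 := hmem (-1) (neg_mem h1)
  refine two_notMem_pBall hP ?_
  convert sub_mem (add_mem h2 h3) (add_mem h0 h0) using 1
  ring

lemma div_mem_pBall_zero {x y : P.adicCompletion F} (h : Valued.v x ≤ Valued.v y) :
    x / y ∈ pBall P 0 := by
  rw [mem_pBall, map_div₀]
  by_cases hy : Valued.v y = 0
  · simp [hy]
  · rw [div_le_iff₀ (zero_lt_iff.2 hy)]
    simpa using h

lemma inv_mem_pBall_of_valued {x : P.adicCompletion F} (hx : Valued.v x = 1)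
    {y : P.adicCompletion F} {n : ℤ} (hy : y ∈ pBall P n) : y / x ∈ pBall P n := by
  rw [mem_pBall, map_div₀, hx, div_one]
  exact mem_pBall.1 hy

namespace LocalData

variable {K : Type*} [Field K] [NumberField K] [Algebra F K]
  {B : Type*} [Ring B] [Algebra F B]
  {ι : K →ₐ[F] B} (L : LocalData ι P)

/-- Every lattice has a basis in which the second vector has minimal norm. -/
lemma exists_basis_minimal (G : Matrix (Fin 2) (Fin 2) (P.adicCompletion F)) :
    ∃ κ : Matrix (Fin 2) (Fin 2) (P.adicCompletion F), IsM0 0 κ ∧ κ * κ = 1 ∧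
      Valued.v (L.normXY ((G * κ) 1 0) ((G * κ) 0 0)) ≤
        Valued.v (L.normXY ((G * κ) 1 1) ((G * κ) 0 1)) ∧
      Valued.v (L.normXY ((G * κ) 1 0 - (G * κ) 1 1) ((G * κ) 0 0 - (G * κ) 0 1)) ≤
        Valued.v (L.normXY ((G * κ) 1 1) ((G * κ) 0 1)) := by
  have h1 : (1 : P.adicCompletion F) ∈ pBall P 0 := mem_pBall_zero.2 (one_mem _)
  have hneg (x z : P.adicCompletion F) : L.normXY (-x) (-z) = L.normXY x z := by
    simp only [normXY]; ring
  set a := L.normXY (G 1 0) (G 0 0)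
  set b := L.normXY (G 1 1) (G 0 1)
  set c := L.normXY (G 1 0 - G 1 1) (G 0 0 - G 0 1) with hc
  have hc' : L.normXY (G 1 1 - G 1 0) (G 0 1 - G 0 0) = c := by
    rw [hc, ← hneg, neg_sub, neg_sub]
  -- Among the two columns and their difference, the one whose norm has the largest absolute value
  -- is moved to the second place; each change of basis used is an involution.
  by_cases hb : Valued.v a ≤ Valued.v b ∧ Valued.v c ≤ Valued.v b
  · exact ⟨1, by simp [IsM0, h1], by simp, by simpa using hb.1, by simpa using hb.2⟩
  · by_cases ha : Valued.v b ≤ Valued.v a ∧ Valued.v c ≤ Valued.v a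
    · refine ⟨!![0, 1; 1, 0], by simp [IsM0, h1], by simp [Matrix.one_fin_two], ?_, ?_⟩
      · simpa [Matrix.mul_apply] using ha.1
      · simpa [Matrix.mul_apply, hc'] using ha.2
    · refine ⟨!![1, 1; 0, -1], by simp [IsM0, h1], by simp [Matrix.one_fin_two], ?_, ?_⟩
      · have : Valued.v a ≤ Valued.v c := by
          rcases le_total (Valued.v a) (Valued.v b) with h | h
          · exact h.trans (le_of_not_ge fun h' => hb ⟨h, h'⟩)
          · exact le_of_not_ge fun h' => ha ⟨h, h'⟩
        simpa [Matrix.mul_apply, ← sub_eq_add_neg] using this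
      · have : Valued.v b ≤ Valued.v c := by
          rcases le_total (Valued.v a) (Valued.v b) with h | h
          · exact le_of_not_ge fun h' => hb ⟨h, h'⟩
          · exact h.trans (le_of_not_ge fun h' => ha ⟨h, h'⟩)
        simpa [Matrix.mul_apply, ← sub_eq_add_neg] using this

/-- `emb w` preserves the norm form up to a factor. -/
lemma normXY_emb_mul (w : AtP P K) (M : Matrix (Fin 2) (Fin 2) (P.adicCompletion F))
    (i : Fin 2) : L.normXY ((L.emb w * M) 1 i) ((L.emb w * M) 0 i) =
      L.normXY (L.X w) (L.Y w) * L.normXY (M 1 i) (M 0 i) := by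
  rw [emb_eq]
  simp only [normXY, Matrix.mul_apply, Fin.sum_univ_two, Matrix.cons_val', Matrix.cons_val_zero,
    Matrix.cons_val_one, Matrix.of_apply, Matrix.cons_val_fin_one]
  ring

/-- A lattice in `K_𝒫` is, up to a unit of `K_𝒫`, of the form `⟨1, p + q α⟩` with
`p + q α` integral. -/
lemma exists_emb_mul_lower (G G' : Matrix (Fin 2) (Fin 2) (P.adicCompletion F))
    (hG : G * G' = 1) :
    ∃ κ : Matrix (Fin 2) (Fin 2) (P.adicCompletion F), IsM0 0 κ ∧ κ * κ = 1 ∧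
      ∃ w : (AtP P K)ˣ, ∃ p q : P.adicCompletion F, q ≠ 0 ∧ G = L.emb w * !![q, 0; p, 1] * κ ∧
        L.normXY p q ∈ pBall P 0 ∧ 2 * p + q * L.tr ∈ pBall P 0 := by
  obtain ⟨κ, hκ, hκκ, hmin1, hmin2⟩ := L.exists_basis_minimal G
  set M := G * κ with hM
  have hMM : M * (κ * G') = 1 := by
    rw [hM, mul_assoc, ← mul_assoc κ, hκκ, one_mul, hG]
  -- Otherwise the norm form would vanish on both basis vectors and on their difference, hence
  -- identically, whereas `1` has norm `1`.
  have hv0 : L.normXY (M 1 1) (M 0 1) ≠ 0 := by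
    intro h0
    rw [h0, map_zero, le_zero_iff, Valuation.zero_iff] at hmin1 hmin2
    set N := κ * G'
    have e0 : M 0 0 * N 0 1 + M 0 1 * N 1 1 = 0 := by
      have := congrFun (congrFun hMM 0) 1
      simpa [Matrix.mul_apply] using this
    have e1 : M 1 0 * N 0 1 + M 1 1 * N 1 1 = 1 := by
      have := congrFun (congrFun hMM 1) 1
      simpa [Matrix.mul_apply] using this
    have h1 : L.normXY (M 1 0 * N 0 1 + M 1 1 * N 1 1) (M 0 0 * N 0 1 + M 0 1 * N 1 1) = 1 := by
      rw [e0, e1]; simp [normXY]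
    have h2 : L.normXY (M 1 0 * N 0 1 + M 1 1 * N 1 1) (M 0 0 * N 0 1 + M 0 1 * N 1 1) =
        (N 0 1 * N 0 1 + N 0 1 * N 1 1) * L.normXY (M 1 0) (M 0 0) +
        (N 1 1 * N 1 1 + N 0 1 * N 1 1) * L.normXY (M 1 1) (M 0 1) -
        N 0 1 * N 1 1 * L.normXY (M 1 0 - M 1 1) (M 0 0 - M 0 1) := by
      simp only [normXY]; ring
    rw [h2, hmin1, hmin2, h0] at h1
    simp at h1
  obtain ⟨w, hX, hY, -, -⟩ := L.exists_unit hv0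
  -- The column `(z, x)` stands for the element `x + zα`. Dividing by the element `w` of the second
  -- column turns that column into `1`.
  set Q := L.emb (w⁻¹ : (AtP P K)ˣ) * M with hQ
  have hMQ : M = L.emb w * Q := by
    rw [hQ, ← mul_assoc, ← map_mul, Units.mul_inv, map_one, one_mul]
  have hcol : ∀ i, (L.emb w) i 1 = M i 1 := by
    intro i
    rw [emb_eq, hX, hY]
    fin_cases i <;> simp
  have hQcol : ∀ i, Q i 1 = (1 : Matrix (Fin 2) (Fin 2) (P.adicCompletion F)) i 1 := by
    intro i
    rw [← map_one L.emb, ← Units.inv_mul w, map_mul, hQ]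
    simp only [Matrix.mul_apply, hcol]
  have hQ01 : Q 0 1 = 0 := by simpa using hQcol 0
  have hQ11 : Q 1 1 = 1 := by simpa using hQcol 1
  have hQeq : Q = !![Q 0 0, 0; Q 1 0, 1] := by
    ext i j
    fin_cases i <;> fin_cases j <;> simp [hQ01, hQ11]
  have hn0 := L.normXY_emb_mul w Q 0
  have hn1 : L.normXY (M 1 0 - M 1 1) (M 0 0 - M 0 1) =
      L.normXY (L.X w) (L.Y w) * L.normXY (Q 1 0 - 1) (Q 0 0) := by
    have h := L.normXY_emb_mul w (Q * !![1, 0; -1, 1]) 0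
    rw [← mul_assoc, ← hMQ] at h
    simpa [Matrix.mul_apply, hQ01, hQ11, ← sub_eq_add_neg] using h
  rw [← hMQ] at hn0
  have hd : L.normXY (Q 1 0) (Q 0 0) ∈ pBall P 0 := by
    have h := div_mem_pBall_zero hmin1
    rwa [hn0, hX, hY, mul_div_cancel_left₀ _ hv0] at h
  have hd' : L.normXY (Q 1 0 - 1) (Q 0 0) ∈ pBall P 0 := by
    have h := div_mem_pBall_zero hmin2
    rwa [hn1, hX, hY, mul_div_cancel_left₀ _ hv0] at h
  refine ⟨κ, hκ, hκκ, w, Q 1 0, Q 0 0, ?_, ?_, hd, ?_⟩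
  · intro h0
    have h := congrFun (congrFun (show Q * (κ * G' * L.emb w) = 1 by
      rw [hQ, mul_assoc, ← mul_assoc M, hMM, one_mul, ← map_mul, Units.inv_mul, map_one]) 0) 0
    rw [hQeq] at h
    simp [Matrix.mul_apply, h0] at h
  · rw [← hQeq, ← hMQ, hM, mul_assoc, hκκ, mul_one]
  -- The trace of `ζ = p + qα` is `N(ζ) - N(ζ - 1) + 1`, so integrality of these two norms suffices.
  · have h1 : (1 : P.adicCompletion F) ∈ pBall P 0 := mem_pBall_zero.2 (one_mem _)
    convert add_mem (sub_mem hd hd') h1 using 1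
    simp only [normXY]
    ring

/-- This is multiplication by `y` in the basis `p + qα, 1`; its integrality decides whether `y` is a
multiplier of the lattice. -/
lemma conj_lower (y : AtP P K) {p q : P.adicCompletion F} (hq : q ≠ 0) :
    !![q⁻¹, 0; -(p / q), 1] * L.emb y * !![q, 0; p, 1] =
      !![L.X y + L.Y y * L.tr + L.Y y * p / q, L.Y y / q;
        -(L.Y y / q * L.normXY p q), L.X y - L.Y y * p / q] := by
  rw [emb_eq]
  ext i j
  fin_cases i <;> fin_cases j <;>
    simp only [normXY, Matrix.mul_apply, Fin.sum_univ_two, Matrix.cons_val', Matrix.cons_val_zero,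
      Matrix.cons_val_one, Matrix.of_apply, Matrix.cons_val_fin_one, Fin.zero_eta, Fin.mk_one,
      Fin.isValue] <;> field_simp <;> ring_nf

/-- A lattice in `K_𝒫` with multiplier ring `O_{𝒫ⁿ}` is a multiple of `O_{𝒫ⁿ}`. -/
lemma exists_eq_emb_mul (hP : (2 : 𝓞 F) ∉ P.asIdeal) {n : ℕ}
    {G G' : Matrix (Fin 2) (Fin 2) (P.adicCompletion F)} (hGG' : G * G' = 1)
    (hG : ∀ w : (AtP P K)ˣ, (IsM0 0 (G' * L.emb w * G) ∧
      IsM0 0 (G' * L.emb (w⁻¹ : (AtP P K)ˣ) * G)) ↔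
        w ∈ locUnits P (condOrder K P n)) :
    ∃ w : (AtP P K)ˣ, ∃ κ κ' : Matrix (Fin 2) (Fin 2) (P.adicCompletion F), IsM0 0 κ ∧
      IsM0 0 κ' ∧ κ * κ' = 1 ∧ κ' * κ = 1 ∧
      G =
        L.emb w * !![(L.ϖ : P.adicCompletion F) ^ n, 0; 0, 1] * κ := by
  obtain ⟨κ, hκ, hκκ, w, p, q, hq, hGeq, hd, hs⟩ := L.exists_emb_mul_lower G G' hGG'
  have h1 : (1 : P.adicCompletion F) ∈ pBall P 0 := mem_pBall_zero.2 (one_mem _)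
  have hlow : !![q⁻¹, 0; -(p / q), 1] * !![q, 0; p, 1] = 1 := by
    rw [lower_mul_lower]
    exact lower_eq_one (inv_mul_cancel₀ hq) (by field_simp; ring)
  have hGinv : G' =
      κ * !![q⁻¹, 0; -(p / q), 1] * L.emb (w⁻¹ : (AtP P K)ˣ) := by
    have h2 : κ * !![q⁻¹, 0; -(p / q), 1] * L.emb (w⁻¹ : (AtP P K)ˣ) * G = 1 := by
      rw [hGeq]
      calc _ = κ * (!![q⁻¹, 0; -(p / q), 1] * (L.emb (w⁻¹ : (AtP P K)ˣ) * L.emb w) *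
          !![q, 0; p, 1]) * κ := by simp only [mul_assoc]
        _ = 1 := by
          rw [← map_mul, Units.inv_mul, map_one, mul_one, hlow, mul_one, hκκ]
    rw [← mul_one (_ * _ * _ : Matrix (Fin 2) (Fin 2) (P.adicCompletion F)), ← hGG',
      ← mul_assoc, h2, one_mul]
  have hconj (y : AtP P K) : G' * L.emb y * G =
      κ * (!![q⁻¹, 0; -(p / q), 1] * L.emb y * !![q, 0; p, 1]) * κ := by
    have hcomm : L.emb (w⁻¹ : (AtP P K)ˣ) * L.emb y * L.emb w = L.emb y := by
      rw [← map_mul, ← map_mul]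
      congr 1
      rw [mul_comm (G := P.adicCompletion F ⊗[F] K) ((w⁻¹ : (AtP P K)ˣ) : AtP P K) y, mul_assoc,
        Units.inv_mul, mul_one]
    rw [hGinv, hGeq]
    calc _ = κ * (!![q⁻¹, 0; -(p / q), 1] * (L.emb (w⁻¹ : (AtP P K)ˣ) * L.emb y * L.emb w) *
          !![q, 0; p, 1]) * κ := by simp only [mul_assoc]
      _ = _ := by rw [hcomm]
  have hconj' (y : AtP P K) : IsM0 0 (G' * L.emb y * G) ↔
      IsM0 0 (!![q⁻¹, 0; -(p / q), 1] * L.emb y * !![q, 0; p, 1]) := by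
    rw [hconj]
    refine ⟨fun h => ?_, fun h => (hκ.mul h).mul hκ⟩
    have h2 := (hκ.mul h).mul hκ
    rwa [← mul_assoc κ, ← mul_assoc κ κ, hκκ, one_mul, mul_assoc, hκκ, mul_one] at h2
  simp only [hconj', L.conj_lower _ hq] at hG
  -- Choose an integral `u` such that `u + p + qα` has unit norm. This element and its inverse
  -- preserve the lattice, so it is a unit of `O_{P^n}`, and its coordinates give the claim.
  have hp_q : p ∈ pBall P 0 ∧ q ∈ pBall P n := by
    obtain ⟨u, hu, hu1⟩ := exists_quadratic_eq_unit hP hs hd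
    have hnorm : L.normXY (u + p) q = u * u + u * (2 * p + q * L.tr) + L.normXY p q := by
      simp only [normXY]; ring
    rw [← hnorm] at hu1
    have hn0 := ne_zero_of_valued_eq_one hu1
    obtain ⟨w₁, hX, hY, hX', hY'⟩ := L.exists_unit hn0
    have h3 := (hG w₁).1 (by
      rw [hX, hY, hX', hY']
      refine ⟨⟨⟨?_, ?_⟩, ?_, ?_⟩, ⟨?_, ?_⟩, ?_, ?_⟩
      · convert add_mem hu hs using 1
        simp only [Matrix.cons_val', Matrix.cons_val_zero, Matrix.of_apply,
          Matrix.cons_val_fin_one]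
        field_simp
        ring
      · rw [Nat.cast_zero]
        convert h1 using 1
        simp [hq]
      · convert neg_mem hd using 1
        simp [hq]
      · convert hu using 1
        simp only [Matrix.cons_val', Matrix.cons_val_one, Matrix.of_apply,
          Matrix.cons_val_fin_one]
        field_simp
        ring
      · convert inv_mem_pBall_of_valued hu1 hu using 1
        simp only [Matrix.cons_val', Matrix.cons_val_zero, Matrix.of_apply,
          Matrix.cons_val_fin_one]
        field_simp
        ring
      · rw [Nat.cast_zero]
        convert neg_mem (inv_mem_pBall_of_valued hu1 h1) using 1
        simp only [Matrix.cons_val', Matrix.cons_val_zero, Matrix.cons_val_one, Matrix.of_apply,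
          Matrix.cons_val_fin_one]
        field_simp
      · convert inv_mem_pBall_of_valued hu1 hd using 1
        simp only [Matrix.cons_val', Matrix.cons_val_zero, Matrix.cons_val_one, Matrix.of_apply,
          Matrix.cons_val_fin_one]
        field_simp
      · convert inv_mem_pBall_of_valued hu1 (add_mem hu hs) using 1
        simp only [Matrix.cons_val', Matrix.cons_val_one, Matrix.of_apply,
          Matrix.cons_val_fin_one]
        field_simp
        ring)
    have h4 := (L.mem_locUnits_condOrder.1 h3).1
    rw [hX, hY] at h4
    exact ⟨by simpa using sub_mem h4.1 hu, h4.2⟩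
  obtain ⟨hp, hqn⟩ := hp_q
  set ϖn := (L.ϖ : P.adicCompletion F) ^ n with hϖn
  have hϖ0 : ϖn ≠ 0 := pow_ne_zero _ (uniformizer_ne_zero L.irreducible_ϖ)
  have hϖmem : ϖn ∈ pBall P n := uniformizer_pow_mem L.irreducible_ϖ n
  -- Conversely, `u + ϖ^n α` of unit norm is a unit of `O_{P^n}`, so it preserves the lattice. Hence
  -- `q` and `ϖ^n` agree up to a unit.
  have hqinv : ϖn / q ∈ pBall P 0 := by
    have hϖ : ϖn ∈ pBall P 0 := pBall_anti (by omega) hϖmem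
    obtain ⟨u, hu, hu1⟩ := exists_quadratic_eq_unit hP
      (s := ϖn * L.tr) (d := ϖn * ϖn * L.nm) (pBall_mul le_rfl hϖ L.tr_mem)
      (pBall_mul le_rfl (pBall_mul le_rfl hϖ hϖ) L.nm_mem)
    have hnorm : L.normXY u ϖn = u * u + u * (ϖn * L.tr) + ϖn * ϖn * L.nm := by
      simp only [normXY]; ring
    rw [← hnorm] at hu1
    obtain ⟨w₂, hX, hY, hX', hY'⟩ := L.exists_unit (ne_zero_of_valued_eq_one hu1)
    have h3 : w₂ ∈ locUnits P (condOrder K P n) := by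
      rw [L.mem_locUnits_condOrder, hX, hY, hX', hY']
      exact ⟨⟨hu, hϖmem⟩, inv_mem_pBall_of_valued hu1 (add_mem hu (pBall_mul le_rfl hϖ L.tr_mem)),
        inv_mem_pBall_of_valued hu1 (neg_mem hϖmem)⟩
    have h4 := ((hG w₂).2 h3).1.1.2
    rw [hY] at h4
    simpa using h4
  have hε : q / ϖn ∈ pBall P 0 := by
    have hv : Valued.v ϖn = WithZero.exp (-(n : ℤ)) := by
      rw [hϖn, ← zpow_natCast, valued_uniformizer_zpow L.irreducible_ϖ]
    have h := div_mem_pBall hqn hv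
    rwa [sub_self] at h
  refine ⟨w, !![q / ϖn, 0; p, 1] * κ, κ * !![ϖn / q, 0; -(p * (ϖn / q)), 1], ?_, ?_, ?_, ?_, ?_⟩
  · exact IsM0.mul (by simp [IsM0, hε, hp, h1]) hκ
  · refine hκ.mul ?_
    have : p * (ϖn / q) ∈ pBall P 0 := pBall_mul le_rfl hp hqinv
    simp [IsM0, hqinv, h1, this]
  · rw [mul_assoc, ← mul_assoc κ, hκκ, one_mul, lower_mul_lower]
    exact lower_eq_one (by field_simp) (by ring)
  · have : !![ϖn / q, 0; -(p * (ϖn / q)), 1] * !![q / ϖn, 0; p, 1] = 1 := by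
      rw [lower_mul_lower]
      exact lower_eq_one (by field_simp) (by field_simp; ring)
    rw [mul_assoc, ← mul_assoc _ _ κ, this, one_mul, hκκ]
  · rw [hGeq, ← mul_assoc _ _ κ, mul_assoc (L.emb w) _ (!![q / ϖn, 0; p, 1]), lower_mul_lower,
      mul_div_cancel₀ _ hϖ0, zero_mul, zero_add]

end LocalData

end Lattice

lemma MSpace.mk_eq {F : Type*} [Field F] [NumberField F] {B : Type*} [Ring B] [Algebra F B]
    {H : Subgroup (Hat F B)ˣ} {a b : (Hat F B)ˣ} :
    MSpace.mk H a = MSpace.mk H b ↔ ∃ t ∈ rationalUnits F B, ∃ u ∈ H, b = t * a * u :=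
  DoubleCoset.eq (rationalUnits F B) H a b

namespace LocalData

variable {F : Type*} [Field F] [NumberField F] {K : Type*} [Field K] [NumberField K] [Algebra F K]
  {P : HeightOneSpectrum (𝓞 F)} {B : Type*} [Ring B] [Algebra F B]
  {ι : K →ₐ[F] B} (L : LocalData ι P)

/-! ### The elements `λ_a` and the kernel of `G(n) → G(n-m)`. -/

section Lambda

lemma mul_uniformizer_pow_mem (a : P.adicCompletionIntegers F) (k : ℕ) :
    (a : P.adicCompletion F) * (L.ϖ : P.adicCompletion F) ^ k ∈ pBall P k :=
  pBall_mul (a := 0) (by omega) (mem_pBall_zero.2 a.2) (uniformizer_pow_mem L.irreducible_ϖ k)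

lemma mul_uniformizer_pow_mem_iff {a : P.adicCompletion F} {k m : ℕ} :
    a * (L.ϖ : P.adicCompletion F) ^ k ∈ pBall P (m + k) ↔ a ∈ pBall P m := by
  constructor
  · intro h
    have hv : Valued.v ((L.ϖ : P.adicCompletion F) ^ k) = WithZero.exp (-(k : ℤ)) := by
      rw [← zpow_natCast, valued_uniformizer_zpow L.irreducible_ϖ]
    have := div_mem_pBall h hv
    rwa [mul_div_cancel_right₀ _ (pow_ne_zero _ (uniformizer_ne_zero L.irreducible_ϖ)),
      add_sub_cancel_right] at this
  · exact fun h => pBall_mul le_rfl h (uniformizer_pow_mem L.irreducible_ϖ k)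

/-- The element `1 + a α ϖ^(n-m)` has unit norm for `n > m`, so the default value in `lamLoc` does
not occur. -/
lemma lamLoc_spec {n m : ℕ} (hnm : 1 ≤ n - m) (a : P.adicCompletionIntegers F) :
    L.lamLoc n m a ∈ locUnits P (condOrder K P (n - m)) ∧ L.X (L.lamLoc n m a) = 1 ∧
      L.Y (L.lamLoc n m a) = a * (L.ϖ : P.adicCompletion F) ^ (n - m) := by
  obtain ⟨w, hw, hX, hY⟩ := L.exists_mem_locUnits hnm (map_one _)
    (L.mul_uniformizer_pow_mem a (n - m))
  have h1 : 1 + ((a : P.adicCompletion F) * (L.ϖ : P.adicCompletion F) ^ (n - m)) • L.α = w :=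
    L.ext_XY (by simp [hX]) (by simp [hY])
  have h2 : L.lamLoc n m a = w := by
    have hu : IsUnit
        (1 + ((a : P.adicCompletion F) * (L.ϖ : P.adicCompletion F) ^ (n - m)) • L.α) :=
      h1 ▸ w.isUnit
    rw [lamLoc, dif_pos hu]
    exact Units.ext h1
  rw [h2]
  exact ⟨hw, hX, hY⟩

/-- The class of `λ_a` in `ker (G(n) → G(n-m))`. -/
def lamKer {n m : ℕ} (hnm : 1 ≤ n - m) (a : P.adicCompletionIntegers F) : galKer K P n m :=
  ⟨QuotientGroup.mk (localUnit P (L.lamLoc n m a)), by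
    change (QuotientGroup.mk (localUnit P (L.lamLoc n m a)) : GalGroup K P (n - m)) = 1
    rw [QuotientGroup.eq_one_iff, mem_ringClassSubgroup]
    exact ⟨1, one_mem _, _, localUnit_mem.2 (L.lamLoc_spec hnm a).1, one_mul _⟩⟩

lemma coe_lamKer {n m : ℕ} (hnm : 1 ≤ n - m) (a : P.adicCompletionIntegers F) :
    (L.lamKer hnm a : GalGroup K P n) = QuotientGroup.mk (localUnit P (L.lamLoc n m a)) := rfl

lemma mk_localUnit_lamLoc_eq_iff {k₀ n m : ℕ} (h₀ : UnitsTrivial K P k₀) (hk : k₀ ≤ n - m)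
    (hnm : 1 ≤ n - m) {a : P.adicCompletionIntegers F} {w : (AtP P K)ˣ}
    (hw : w ∈ locUnits P (condOrder K P (n - m))) :
    (QuotientGroup.mk (localUnit P (L.lamLoc n m a)) : GalGroup K P n) =
        QuotientGroup.mk (localUnit P w) ↔
      L.Y w - L.X w * (a * (L.ϖ : P.adicCompletion F) ^ (n - m)) ∈ pBall P n := by
  obtain ⟨hl, hX, hY⟩ := L.lamLoc_spec hnm a
  have hv : (L.lamLoc n m a)⁻¹ * w ∈ locUnits P (condOrder K P (n - m)) :=
    mul_mem (inv_mem hl) hw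
  rw [QuotientGroup.eq, ← QuotientGroup.eq_one_iff, ← map_inv, ← map_mul,
    mk_localUnit_eq_one h₀ hk (Nat.sub_le n m) hv, L.mem_locUnits_condOrder_iff_of_mem hnm hv]
  set v := (L.lamLoc n m a)⁻¹ * w with hv_def
  set y := (a : P.adicCompletion F) * (L.ϖ : P.adicCompletion F) ^ (n - m)
  have hy : y ∈ pBall P 1 := pBall_anti (by omega) (L.mul_uniformizer_pow_mem a (n - m))
  have hwv : w = L.lamLoc n m a * v := by rw [hv_def, mul_inv_cancel_left]
  -- The first factor on the right is the norm of `λ_a = 1 + yα`, a unit.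
  have h1 : L.Y w - L.X w * y = (1 + y * (L.tr + y * L.nm)) * L.Y v := by
    rw [hwv, Units.val_mul, X_mul, Y_mul, hX, hY]
    ring
  rw [h1, unit_mul_mem_pBall]
  exact valued_add_eq_one (map_one _) (pBall_mul (a := 1) (b := 0) (by omega) hy
    (add_mem L.tr_mem (pBall_mul (a := 1) (by omega) hy L.nm_mem)))

/-- A kernel element given by a local unit `w` is the class of `λ_a` with `a = Y w / (X w ϖ^(n-m))`;
two values of `a` give the same class exactly when they agree modulo `P^m`. -/
lemma lamKer_bijective {k₀ n m : ℕ} (h₀ : UnitsTrivial K P k₀) (hk : k₀ ≤ n - m)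
    (hnm : 1 ≤ n - m) :
    Function.Bijective fun c : P.adicCompletionIntegers F ⧸ pPow P m =>
      L.lamKer hnm (Function.surjInv (Ideal.Quotient.mk_surjective (I := pPow P m)) c) := by
  have hn : (n : ℤ) = (m : ℤ) + ((n - m : ℕ) : ℤ) := by omega
  have hiff (a b : P.adicCompletionIntegers F) :
      L.lamKer hnm a = L.lamKer hnm b ↔ b - a ∈ pPow P m := by
    obtain ⟨hl, hX, hY⟩ := L.lamLoc_spec hnm b
    rw [Subtype.ext_iff, coe_lamKer, coe_lamKer, L.mk_localUnit_lamLoc_eq_iff h₀ hk hnm hl,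
      hX, hY, one_mul, ← sub_mul, hn, mul_uniformizer_pow_mem_iff, mem_pPow_iff]
    rfl
  constructor
  · intro c d h
    have h1 := (hiff _ _).1 h
    rw [← Ideal.Quotient.eq, Function.surjInv_eq Ideal.Quotient.mk_surjective,
      Function.surjInv_eq Ideal.Quotient.mk_surjective] at h1
    exact h1.symm
  · rintro ⟨σ, hσ⟩
    obtain ⟨w, hw, rfl⟩ := exists_localUnit_of_galProj_eq_one (Nat.sub_le n m) hσ
    have hXw := L.valued_X hnm hw
    have hYw := (L.mem_locUnits_condOrder.1 hw).1.2
    set g := L.X w * (L.ϖ : P.adicCompletion F) ^ (n - m) with hg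
    have hvg : Valued.v g = WithZero.exp (-((n - m : ℕ) : ℤ)) := by
      rw [hg, map_mul, hXw, one_mul, ← zpow_natCast, valued_uniformizer_zpow L.irreducible_ϖ]
    have hg0 : g ≠ 0 := mul_ne_zero (ne_zero_of_valued_eq_one hXw)
      (pow_ne_zero _ (uniformizer_ne_zero L.irreducible_ϖ))
    have ha := div_mem_pBall hYw hvg
    rw [sub_self, mem_pBall_zero] at ha
    let a : P.adicCompletionIntegers F := ⟨L.Y w / g, ha⟩
    refine ⟨Ideal.Quotient.mk _ a, ?_⟩
    refine ((hiff _ a).2 ?_).trans ?_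
    · rw [← Ideal.Quotient.eq, Function.surjInv_eq Ideal.Quotient.mk_surjective]
    · rw [Subtype.ext_iff, coe_lamKer, L.mk_localUnit_lamLoc_eq_iff h₀ hk hnm hw]
      have : L.Y w - L.X w * (L.Y w / g * (L.ϖ : P.adicCompletion F) ^ (n - m)) = 0 := by
        have : L.X w * (L.Y w / g * (L.ϖ : P.adicCompletion F) ^ (n - m)) = L.Y w / g * g := by
          rw [hg]; ring
        rw [this, div_mul_cancel₀ _ hg0, sub_self]
      change L.Y w - L.X w * (L.Y w / g * (L.ϖ : P.adicCompletion F) ^ (n - m)) ∈ pBall P n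
      rw [this]
      exact zero_mem _

end Lambda

/-! ### Components at `P` of torus elements and of `α_{a,m}`. -/

section Components

lemma torusMap_localUnit (w : (AtP P K)ˣ) :
    torusMap ι (localUnit P w) = localUnit P (Units.map
      ((Algebra.TensorProduct.map (AlgHom.id F (P.adicCompletion F)) ι : AtP P K →ₐ[F] AtP P B) :
        AtP P K →* AtP P B) w) := by
  have h (x : AtP P K) :
      Algebra.TensorProduct.map (AlgHom.id F (FinAdeles F)) ι (fromP P x) =
        fromP P (Algebra.TensorProduct.map (AlgHom.id F (P.adicCompletion F)) ι x) := by
    induction x using TensorProduct.induction_on with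
    | zero => simp
    | add x y hx hy => simp only [map_add, hx, hy]
    | tmul x y => simp [fromP]
  ext
  rw [coe_localUnit]
  change Algebra.TensorProduct.map (AlgHom.id F (FinAdeles F)) ι (localUnit P w : Hat F K) = _
  rw [coe_localUnit, map_add, map_one, h, map_sub, map_one]
  rfl

lemma comp_torusMap (t : (Hat F K)ˣ) :
    (L.comp (torusMap ι t) : Matrix (Fin 2) (Fin 2) (P.adicCompletion F)) =
      L.emb (toPUnits P t) := by
  have h (x : Hat F K) : toP P (Algebra.TensorProduct.map (AlgHom.id F (FinAdeles F)) ι x) =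
      Algebra.TensorProduct.map (AlgHom.id F (P.adicCompletion F)) ι (toP P x) := by
    induction x using TensorProduct.induction_on with
    | zero => simp
    | add x y hx hy => simp only [map_add, hx, hy]
    | tmul x y => simp [toP]
  exact congrArg L.φ (h t)

lemma conj_toPUnits (x : (Hat F B)ˣ) :
    L.conj (toPUnits P x) = ((L.h⁻¹ * L.comp x * L.h : GL (Fin 2) (P.adicCompletion F)) :
      Matrix (Fin 2) (Fin 2) (P.adicCompletion F)) := by
  rw [conj_apply, Units.val_mul, Units.val_mul, mul_assoc]
  rfl

/-- The conductor of `g` at `P` thus depends on the lattice spanned by the columns of `L.comp g *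
L.h`. -/
lemma conj_inv_mul_torusMap_mul {g : (Hat F B)ˣ}
    {G G' : Matrix (Fin 2) (Fin 2) (P.adicCompletion F)}
    (hG : ((L.comp g * L.h : GL (Fin 2) (P.adicCompletion F)) :
      Matrix (Fin 2) (Fin 2) (P.adicCompletion F)) = G) (hGG' : G * G' = 1) (t : (Hat F K)ˣ) :
    L.conj (toPUnits P (g⁻¹ * torusMap ι t * g)) = G' * L.emb (toPUnits P t) * G := by
  have hG' : G' = ((L.comp g * L.h)⁻¹ : GL (Fin 2) (P.adicCompletion F)) := by
    rw [← hG] at hGG'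
    exact (Units.inv_eq_of_mul_eq_one_right hGG').symm
  rw [conj_toPUnits, hG', ← hG, ← comp_torusMap, ← Units.val_mul, ← Units.val_mul]
  congr 1
  simp only [map_mul, map_inv, mul_inv_rev, mul_assoc]

lemma conj_unip (δ m : ℕ) (a : P.adicCompletionIntegers F) :
    L.conj (toPUnits P (L.unip δ m a)) =
      !![1, (a : P.adicCompletion F) * (L.ϖ : P.adicCompletion F) ^ ((δ : ℤ) - (m : ℤ)); 0, 1] := by
  rw [unip, toPUnits_localUnit, ← L.φ_eq_iff]
  simp [Matrix.GeneralLinearGroup.upperRightHom]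

lemma conj_unip_inv (δ m : ℕ) (a : P.adicCompletionIntegers F) :
    L.conj (toPUnits P (L.unip δ m a)⁻¹) =
      !![1, -((a : P.adicCompletion F) * (L.ϖ : P.adicCompletion F) ^ ((δ : ℤ) - (m : ℤ)));
        0, 1] := by
  have h : L.conj (toPUnits P (L.unip δ m a)⁻¹) * L.conj (toPUnits P (L.unip δ m a)) = 1 := by
    rw [map_inv, ← map_mul, Units.inv_mul, map_one]
  rw [conj_unip] at h
  refine (mul_one _).symm.trans ?_
  rw [← show !![1, (a : P.adicCompletion F) * (L.ϖ : P.adicCompletion F) ^ ((δ : ℤ) - (m : ℤ));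
      0, 1] * !![1, -((a : P.adicCompletion F) * (L.ϖ : P.adicCompletion F) ^
        ((δ : ℤ) - (m : ℤ))); 0, 1] = 1 by simp [Matrix.one_fin_two], ← mul_assoc, h, one_mul]

lemma awayUnits_unip (δ m : ℕ) (a : P.adicCompletionIntegers F) :
    awayUnits P (L.unip δ m a) = 1 := by
  rw [unip, awayUnits_localUnit]

lemma awayUnits_torusMap_localUnit (w : (AtP P K)ˣ) :
    awayUnits P (torusMap ι (localUnit P w)) = 1 := by
  rw [torusMap_localUnit, awayUnits_localUnit]

lemma mul_uniformizer_zpow_mem (a : P.adicCompletionIntegers F) (k : ℤ) :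
    (a : P.adicCompletion F) * (L.ϖ : P.adicCompletion F) ^ k ∈ pBall P k :=
  pBall_mul (a := 0) (by omega) (mem_pBall_zero.2 a.2) (uniformizer_zpow_mem L.irreducible_ϖ k)

variable {L}

lemma IsEichler.mem_hatUnits_iff {δ : ℕ} {R : Subalgebra (𝓞 F) B} (hR : L.IsEichler δ R)
    {x : (Hat F B)ˣ} : x ∈ hatUnits R ↔ awayUnits P x ∈ hatUnits R ∧
      IsM0 δ (L.conj (toPUnits P x)) ∧ IsM0 δ (L.conj (toPUnits P x⁻¹)) := by
  rw [CMPoints.mem_hatUnits_iff P, mem_locUnits, hR.mem_locOrder_iff, hR.mem_locOrder_iff, map_inv]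

/-- This is what `H_m` is designed for: it makes each translate `α_{a,m} · θ` separately invariant
under `H_m`. -/
lemma IsEichler.unip_conj_mem {δ m : ℕ} {R : Subalgebra (𝓞 F) B} (hR : L.IsEichler δ R)
    {γ : (Hat F B)ˣ} (hγ : γ ∈ L.levelH δ m R) (a : P.adicCompletionIntegers F) :
    (L.unip δ m a)⁻¹ * γ * L.unip δ m a ∈ hatUnits R := by
  have hx := L.mul_uniformizer_zpow_mem a (δ - m)
  obtain ⟨h1, h2, h3⟩ := (mem_levelH hR).1 hγ
  refine hR.mem_hatUnits_iff.2 ⟨?_, ?_, ?_⟩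
  · simpa [awayUnits_unip] using ((CMPoints.mem_hatUnits_iff P).1 h1).1
  · rw [map_mul, map_mul, Units.val_mul, Units.val_mul, map_mul, map_mul, conj_unip,
      conj_unip_inv]
    exact isM0_conj_unipotent h2 hx
  · rw [show ((L.unip δ m a)⁻¹ * γ * L.unip δ m a)⁻¹ =
      (L.unip δ m a)⁻¹ * γ⁻¹ * L.unip δ m a by group, map_mul, map_mul, Units.val_mul,
      Units.val_mul, map_mul, map_mul, conj_unip, conj_unip_inv]
    exact isM0_conj_unipotent h3 hx

end Components

section Theta

variable {L}

lemma IsEichler.thetaM_mul {δ n m : ℕ} {R : Subalgebra (𝓞 F) B} (hR : L.IsEichler δ R)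
    {A : Type*} [CommRing A] (θ : MSpace (hatUnits R) → A) (χ₁ : AntiGroup K P n →* Aˣ)
    {t γ : (Hat F B)ˣ} (ht : t ∈ rationalUnits F B) (hγ : γ ∈ L.levelH δ m R) (g : (Hat F B)ˣ) :
    L.thetaM δ n m θ χ₁ (t * g * γ) = L.thetaM δ n m θ χ₁ g := by
  refine finsum_congr fun c => ?_
  refine congrArg (fun y => _ * θ y) (Eq.symm ?_)
  rw [MSpace.mk_eq]
  exact ⟨t, ht, _, hR.unip_conj_mem hγ (Function.surjInv Ideal.Quotient.mk_surjective c),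
    by group⟩

end Theta

end LocalData

namespace LocalData

variable {F : Type*} [Field F] [NumberField F] {K : Type*} [Field K] [NumberField K] [Algebra F K]
  {P : HeightOneSpectrum (𝓞 F)} {B : Type*} [Ring B] [Algebra F B]
  {ι : K →ₐ[F] B} {L : LocalData ι P}

/-! ### Base points: conductor, action of `λ_a`, and the case of a maximal order. -/

section BaseOrbit

lemma conj_diag {k : Type*} [Field k] (a b c d : k) {p : k} (hp : p ≠ 0) :
    !![p⁻¹, 0; 0, 1] * !![a, b; c, d] * !![p, 0; 0, 1] = !![a, p⁻¹ * b; c * p, d] := by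
  simp [mul_comm p⁻¹, hp]

/-- The components at `𝒫` of the torus, seen from a base point of conductor `𝒫ⁿ`. -/
lemma conj_base {δ n : ℕ} (hn : δ ≤ n) {g₀ : (Hat F B)ˣ}
    (hg₀ : (L.comp g₀ : Matrix (Fin 2) (Fin 2) (P.adicCompletion F)) =
      !![(L.ϖ : P.adicCompletion F) ^ ((n : ℤ) - (δ : ℤ)), 0; 0, 1] *
        ((L.h⁻¹ : GL (Fin 2) (P.adicCompletion F)) : Matrix _ _ _)) (t : (Hat F K)ˣ) :
    L.conj (toPUnits P (g₀⁻¹ * torusMap ι t * g₀)) =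
      !![L.X (toPUnits P t) + L.Y (toPUnits P t) * L.tr,
          ((L.ϖ : P.adicCompletion F) ^ (n - δ))⁻¹ * L.Y (toPUnits P t);
        -(L.Y (toPUnits P t) * L.nm) * (L.ϖ : P.adicCompletion F) ^ (n - δ),
          L.X (toPUnits P t)] := by
  have hp : (L.ϖ : P.adicCompletion F) ^ (n - δ) ≠ 0 :=
    pow_ne_zero _ (uniformizer_ne_zero L.irreducible_ϖ)
  have hz : (L.ϖ : P.adicCompletion F) ^ ((n : ℤ) - (δ : ℤ)) =
      (L.ϖ : P.adicCompletion F) ^ (n - δ) := by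
    rw [← zpow_natCast]
    congr 1
    omega
  rw [hz] at hg₀
  rw [L.conj_inv_mul_torusMap_mul (G := !![(L.ϖ : P.adicCompletion F) ^ (n - δ), 0; 0, 1])
    (G' := !![((L.ϖ : P.adicCompletion F) ^ (n - δ))⁻¹, 0; 0, 1])
    (by rw [Units.val_mul, hg₀, mul_assoc, Units.inv_mul, mul_one])
    (by simp [Matrix.one_fin_two, hp]), emb_eq, conj_diag _ _ _ _ hp]

lemma inv_uniformizer_pow_mul_mem {k : ℕ} {n : ℤ} {y : P.adicCompletion F} (hy : y ∈ pBall P n) :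
    ((L.ϖ : P.adicCompletion F) ^ k)⁻¹ * y ∈ pBall P (n - k) := by
  rw [mul_comm, ← div_eq_mul_inv]
  refine div_mem_pBall hy ?_
  rw [← zpow_natCast, valued_uniformizer_zpow L.irreducible_ϖ]

/-- A base point has the same conductor for `H_m` as for `H`. -/
lemma IsEichler.hasConductor_levelH {δ m n : ℕ} {R : Subalgebra (𝓞 F) B} (hR : L.IsEichler δ R)
    (hn : 2 * m + 2 * δ ≤ n) {g₀ : (Hat F B)ˣ}
    (hg₀ : (L.comp g₀ : Matrix (Fin 2) (Fin 2) (P.adicCompletion F)) =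
      !![(L.ϖ : P.adicCompletion F) ^ ((n : ℤ) - (δ : ℤ)), 0; 0, 1] *
        ((L.h⁻¹ : GL (Fin 2) (P.adicCompletion F)) : Matrix _ _ _))
    (h : HasConductor P ι (hatUnits R) n g₀) : HasConductor P ι (L.levelH δ m R) n g₀ := by
  have key (t : (Hat F K)ˣ) (ht : t ∈ hatUnits (condOrder K P n)) :
      L.conj (toPUnits P (g₀⁻¹ * torusMap ι t * g₀)) ∈ fieldLevelRing P δ m := by
    have ht' := (L.mem_locUnits_condOrder.1 ((CMPoints.mem_hatUnits_iff P).1 ht).2).1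
    have hM := (hR.mem_hatUnits_iff.1 ((h t).2 ht)).2.1
    rw [mem_fieldLevelRing]
    refine ⟨hM, ?_⟩
    rw [conj_base (by omega) hg₀, IsLevel]
    -- As `Y ∈ P^n`, the difference of the diagonal entries and the lower left entry lie in `P^n`,
    -- while the upper right one lies only in `P^δ`; the latter suffices because its congruence
    -- modulo `P^m` is imposed only for `δ ≥ 2m`.
    have h1 : L.Y (toPUnits P t) * L.tr ∈ pBall P n := pBall_mul (by omega) ht'.2 L.tr_mem
    have h2 : -(L.Y (toPUnits P t) * L.nm) * (L.ϖ : P.adicCompletion F) ^ (n - δ) ∈ pBall P n :=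
      pBall_mul (a := n) (by omega) (neg_mem (pBall_mul (by omega) ht'.2 L.nm_mem))
        (uniformizer_pow_mem L.irreducible_ϖ _)
    have h3 := inv_uniformizer_pow_mul_mem (L := L) (k := n - δ) ht'.2
    simp only [Matrix.cons_val', Matrix.cons_val_zero, Matrix.cons_val_one, Matrix.of_apply,
      Matrix.cons_val_fin_one, add_sub_cancel_left]
    split_ifs with h4 h5
    · exact ⟨pBall_anti (by omega) h2, pBall_anti (by omega) h1⟩
    · exact ⟨pBall_anti (by omega) h2, pBall_anti (by omega) h1⟩
    · exact ⟨pBall_anti (by omega) h3, pBall_anti (by omega) h1⟩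
  intro t
  refine ⟨fun ht => (h t).1 ((mem_levelH hR).1 ht).1, fun ht => ?_⟩
  refine (mem_levelH hR).2 ⟨(h t).2 ht, key t ht, ?_⟩
  rw [show (g₀⁻¹ * torusMap ι t * g₀)⁻¹ = g₀⁻¹ * torusMap ι t⁻¹ * g₀ by rw [map_inv]; group]
  exact key _ (inv_mem ht)

/-- At a base point, `λ_a` acts as `α_{a,m}` up to an element of `H`. -/
lemma IsEichler.unip_inv_mul_mem {δ m n : ℕ} {R : Subalgebra (𝓞 F) B} (hR : L.IsEichler δ R)
    (hn : 2 * m + 2 * δ + 1 ≤ n) {g₀ : (Hat F B)ˣ}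
    (hg₀ : (L.comp g₀ : Matrix (Fin 2) (Fin 2) (P.adicCompletion F)) =
      !![(L.ϖ : P.adicCompletion F) ^ ((n : ℤ) - (δ : ℤ)), 0; 0, 1] *
        ((L.h⁻¹ : GL (Fin 2) (P.adicCompletion F)) : Matrix _ _ _))
    (a : P.adicCompletionIntegers F) :
    (L.unip δ m a)⁻¹ * (g₀⁻¹ * torusMap ι (localUnit P (L.lamLoc n m a)) * g₀) ∈ hatUnits R := by
  obtain ⟨hl, hX, hY⟩ := L.lamLoc_spec (n := n) (m := m) (by omega) a
  set w := L.lamLoc n m a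
  obtain ⟨⟨-, hYm⟩, hX'm, hY'm⟩ := L.mem_locUnits_condOrder.1 hl
  set ϖ := (L.ϖ : P.adicCompletion F) with hϖ_def
  have hϖ : ϖ ≠ 0 := uniformizer_ne_zero L.irreducible_ϖ
  -- The key coincidence: the upper right entry of `λ_a` at the base point equals that of the
  -- unipotent matrix in `α_{a,m}`, so it cancels in the quotient.
  have hx : (a : P.adicCompletion F) * ϖ ^ ((δ : ℤ) - (m : ℤ)) = (ϖ ^ (n - δ))⁻¹ * L.Y w := by
    rw [hY, ← zpow_natCast, ← zpow_natCast, ← zpow_neg, mul_left_comm, ← zpow_add₀ hϖ]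
    congr 2
    omega
  have h1 : (1 : P.adicCompletion F) ∈ pBall P 0 := mem_pBall_zero.2 (one_mem _)
  have hp : ϖ ^ (n - δ) ≠ 0 := pow_ne_zero _ hϖ
  have hpm : ϖ ^ (n - δ) ∈ pBall P 0 :=
    pBall_anti (by omega) (uniformizer_pow_mem L.irreducible_ϖ _)
  have hY0 : L.Y w ∈ pBall P 0 := pBall_anti (by omega) hYm
  have hY'0 : L.Y (w⁻¹ : (AtP P K)ˣ) ∈ pBall P 0 := pBall_anti (by omega) hY'm
  have hYT : L.Y w * L.tr ∈ pBall P 0 := pBall_mul le_rfl hY0 L.tr_mem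
  have hYN : L.Y w * L.nm ∈ pBall P 0 := pBall_mul le_rfl hY0 L.nm_mem
  have hY'T : L.Y (w⁻¹ : (AtP P K)ˣ) * L.tr ∈ pBall P 0 := pBall_mul le_rfl hY'0 L.tr_mem
  have hY'N : L.Y (w⁻¹ : (AtP P K)ˣ) * L.nm ∈ pBall P 0 := pBall_mul le_rfl hY'0 L.nm_mem
  have hinv := L.Y_mul w (w⁻¹ : (AtP P K)ˣ)
  rw [Units.mul_inv, Y_one, hX] at hinv
  set q := (ϖ ^ (n - δ))⁻¹ with hq
  have hqp : q * ϖ ^ (n - δ) = 1 := inv_mul_cancel₀ hp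
  refine hR.mem_hatUnits_iff.2 ⟨?_, ?_, ?_⟩
  · simp only [map_mul, map_inv, awayUnits_unip, awayUnits_torusMap_localUnit]
    simp
  · rw [map_mul, Units.val_mul, map_mul, conj_unip_inv, conj_base (by omega) hg₀,
      toPUnits_localUnit, hx, hX]
    have e1 : 1 + L.Y w * L.tr + q * L.Y w * (L.Y w * L.nm * ϖ ^ (n - δ)) =
        1 + L.Y w * L.tr + L.Y w * (L.Y w * L.nm) := by
      linear_combination (L.Y w * (L.Y w * L.nm)) * hqp
    have e2 : 1 + L.Y w * L.tr + L.Y w * (L.Y w * L.nm) ∈ pBall P 0 :=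
      add_mem (add_mem h1 hYT) (pBall_mul le_rfl hY0 hYN)
    have e3 : L.Y w * L.nm * ϖ ^ (n - δ) ∈ pBall P 0 := pBall_mul le_rfl hYN hpm
    rw [← e1] at e2
    simpa [IsM0, h1, ← hϖ_def, ← hq] using ⟨e2, e3⟩
  · rw [show ((L.unip δ m a)⁻¹ * (g₀⁻¹ * torusMap ι (localUnit P w) * g₀))⁻¹ =
      (g₀⁻¹ * torusMap ι (localUnit P w)⁻¹ * g₀) * L.unip δ m a by rw [map_inv]; group,
      map_mul, Units.val_mul, map_mul, conj_unip, conj_base (by omega) hg₀, map_inv,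
      toPUnits_localUnit, hx]
    -- For the inverse, the upper right entry vanishes by the relation `Y (w w⁻¹) = 0`.
    have e1 : (L.X (w⁻¹ : (AtP P K)ˣ) + L.Y (w⁻¹ : (AtP P K)ˣ) * L.tr) * (q * L.Y w) +
        q * L.Y (w⁻¹ : (AtP P K)ˣ) = 0 := by
      linear_combination -q * hinv
    have e2 : -(L.Y (w⁻¹ : (AtP P K)ˣ) * L.nm * ϖ ^ (n - δ) * (q * L.Y w)) +
        L.X (w⁻¹ : (AtP P K)ˣ) =
        L.X (w⁻¹ : (AtP P K)ˣ) - L.Y (w⁻¹ : (AtP P K)ˣ) * L.nm * L.Y w := by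
      linear_combination (-(L.Y (w⁻¹ : (AtP P K)ˣ) * L.nm * L.Y w)) * hqp
    have e3 : L.X (w⁻¹ : (AtP P K)ˣ) - L.Y (w⁻¹ : (AtP P K)ˣ) * L.nm * L.Y w ∈ pBall P 0 :=
      sub_mem hX'm (pBall_mul le_rfl hY'N hY0)
    have e4 : L.Y (w⁻¹ : (AtP P K)ˣ) * L.nm * ϖ ^ (n - δ) ∈ pBall P 0 := pBall_mul le_rfl hY'N hpm
    rw [← e2] at e3
    have e5 := add_mem hX'm hY'T
    simpa [IsM0, ← hϖ_def, ← hq, e1] using ⟨e5, e4, e3⟩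

/-- If `R_𝒫` is maximal, every CM point of conductor `𝒫ⁿ` is in the orbit of a base point. -/
lemma IsEichler.inBaseOrbit (hP : (2 : 𝓞 F) ∉ P.asIdeal) {n : ℕ} {R : Subalgebra (𝓞 F) B}
    (hR : L.IsEichler 0 R) (x : CMSet P ι (hatUnits R) n) : L.InBaseOrbit 0 n x := by
  obtain ⟨_, g, rfl, hg⟩ := x
  set γ : GL (Fin 2) (P.adicCompletion F) := L.comp g * L.h with hγ
  have hγγ : (γ : Matrix (Fin 2) (Fin 2) (P.adicCompletion F)) *
    ((γ⁻¹ : GL (Fin 2) (P.adicCompletion F)) : Matrix _ _ _) = 1 := Units.mul_inv γ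
  -- Testing the conductor condition on torus elements concentrated at `P` gives the multiplier
  -- condition for the lattice of `g`.
  obtain ⟨w, κ, κ', hκ, hκ', hκκ', hκ'κ, hG⟩ := L.exists_eq_emb_mul hP (n := n) hγγ (fun w => by
    rw [← localUnit_mem, ← hg, hR.mem_hatUnits_iff,
      show (g⁻¹ * torusMap ι (localUnit P w) * g)⁻¹ = g⁻¹ * torusMap ι (localUnit P w)⁻¹ * g by
        rw [map_inv]; group,
      L.conj_inv_mul_torusMap_mul rfl hγγ, L.conj_inv_mul_torusMap_mul rfl hγγ, map_inv,
      toPUnits_localUnit]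
    refine (and_iff_right ?_).symm
    simp [awayUnits_torusMap_localUnit])
  let k : GL (Fin 2) (P.adicCompletion F) := ⟨κ', κ, hκ'κ, hκκ'⟩
  let u : (Hat F B)ˣ := localUnit P <|
    Units.map (L.φ.symm : Matrix (Fin 2) (Fin 2) (P.adicCompletion F) →* AtP P B) <|
      L.h * k * L.h⁻¹
  have hucomp : L.comp u = L.h * k * L.h⁻¹ := by
    ext1
    change L.φ (toPUnits P u) = _
    rw [toPUnits_localUnit]
    simp
  have huM : L.conj (toPUnits P u) = κ' := by
    rw [conj_toPUnits, hucomp]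
    simp [mul_assoc, k]
  have huM' : L.conj (toPUnits P u⁻¹) = κ := by
    rw [conj_toPUnits, map_inv, hucomp]
    simp [mul_assoc, k]
  have hu : u ∈ hatUnits R := by
    refine hR.mem_hatUnits_iff.2 ⟨?_, huM ▸ hκ', huM' ▸ hκ⟩
    rw [awayUnits_localUnit]
    exact one_mem _
  let s := localUnit P w
  -- Dividing by the torus factor and correcting by an element of `H` leaves exactly the component
  -- of a base point.
  let g₀ := torusMap ι s⁻¹ * g * u
  have hg₀ : HasConductor P ι (hatUnits R) n g₀ := by
    intro t
    rw [← (hg.smul s⁻¹) t]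
    have : g₀⁻¹ * torusMap ι t * g₀ =
        u⁻¹ * ((torusMap ι s⁻¹ * g)⁻¹ * torusMap ι t * (torusMap ι s⁻¹ * g)) * u := by
      simp only [g₀]; group
    rw [this, Subgroup.mul_mem_cancel_right _ hu, Subgroup.mul_mem_cancel_left _ (inv_mem hu)]
  refine ⟨g₀, hg₀, ?_, QuotientGroup.mk s, ?_⟩
  · have h1 : L.comp g₀ * L.h = L.comp (torusMap ι s⁻¹) * γ * k := by
      simp only [g₀, map_mul, hucomp, hγ, mul_assoc, inv_mul_cancel, mul_one]
    have h2 : ((L.comp g₀ * L.h : GL (Fin 2) (P.adicCompletion F)) :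
        Matrix (Fin 2) (Fin 2) (P.adicCompletion F)) =
        !![(L.ϖ : P.adicCompletion F) ^ n, 0; 0, 1] := by
      rw [h1, Units.val_mul, Units.val_mul, hG, comp_torusMap, map_inv, toPUnits_localUnit]
      change L.emb (w⁻¹ : (AtP P K)ˣ) * (L.emb w * _ * κ) * κ' = _
      rw [mul_assoc, mul_assoc _ κ, hκκ', mul_one, ← mul_assoc, ← map_mul, Units.inv_mul, map_one,
        one_mul]
    have hz : (L.ϖ : P.adicCompletion F) ^ ((n : ℤ) - ((0 : ℕ) : ℤ)) =
        (L.ϖ : P.adicCompletion F) ^ n := by simp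
    rw [hz, Units.eq_mul_inv_iff_mul_eq, ← h2]
    rfl
  · apply Subtype.ext
    change CMSpace.mk ι (hatUnits R) g = CMSpace.mk ι (hatUnits R) (torusMap ι s * g₀)
    rw [CMSpace.mk_eq]
    exact ⟨1, one_mem _, u, hu, by simp only [g₀, map_inv, map_one]; group⟩

end BaseOrbit

end LocalData

/-! ### The orbit sum formula. -/

namespace LocalData

variable {F : Type*} [Field F] [NumberField F] {K : Type*} [Field K] [NumberField K] [Algebra F K]
  {P : HeightOneSpectrum (𝓞 F)} {B : Type*} [Ring B] [Algebra F B]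
  {ι : K →ₐ[F] B} {L : LocalData ι P}

/-- `θ_m` as a function on `M_{H_m}`. -/
def IsEichler.thetaQuot {δ : ℕ} {R : Subalgebra (𝓞 F) B} (hR : L.IsEichler δ R) {n m : ℕ}
    {A : Type*} [CommRing A] (θ : MSpace (hatUnits R) → A) (χ₁ : AntiGroup K P n →* Aˣ)
    (y : MSpace (L.levelH δ m R)) : A :=
  Quotient.liftOn' y (L.thetaM δ n m θ χ₁) fun a b h => by
    rw [DoubleCoset.rel_iff] at h
    obtain ⟨t, ht, γ, hγ, rfl⟩ := h
    exact (hR.thetaM_mul θ χ₁ ht hγ a).symm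

/-- The value of `θ_m` at a point of the base orbit is a twisted orbit sum. -/
lemma IsEichler.exists_cmPoint {δ n m k₀ : ℕ} {R : Subalgebra (𝓞 F) B} (hR : L.IsEichler δ R)
    (h₀ : UnitsTrivial K P k₀) (hk : k₀ ≤ n - m) (hn : 2 * m + 2 * δ + 1 ≤ n)
    {e : galKer K P n m ≃* Z K P n m}
    (he : ∀ σ : galKer K P n m,
      (e σ : AntiGroup K P n) = QuotientGroup.mk (σ : GalGroup K P n))
    {A : Type*} [CommRing A] (θ : MSpace (hatUnits R) → A) (χ₁ : AntiGroup K P n →* Aˣ)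
    {x : CMSet P ι (hatUnits R) n} (hx : L.InBaseOrbit δ n x) :
    ∃ xm : CMSet P ι (L.levelH δ m R) n,
      hR.thetaQuot θ χ₁ (red ι (L.levelH δ m R) xm) =
        ∑ᶠ τ : Z K P n m, (χ₁ τ : A) *
          θ (red ι (hatUnits R) (galAction ι (hatUnits R) n (e.symm τ) x)) := by
  obtain ⟨g₀, hg₀, hcomp, σ, rfl⟩ := hx
  induction σ using QuotientGroup.induction_on with
  | H s =>
    have hnm : 1 ≤ n - m := by omega
    refine ⟨⟨CMSpace.mk ι _ (torusMap ι s * g₀), _, rfl,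
      (hR.hasConductor_levelH (by omega) hcomp hg₀).smul s⟩, ?_⟩
    -- Reindexing by `a ↦ τ_a` reduces the formula to an equality of single terms.
    refine finsum_eq_of_bijective _ (e.bijective.comp (L.lamKer_bijective h₀ hk hnm)) fun c => ?_
    set a := Function.surjInv (Ideal.Quotient.mk_surjective (I := pPow P m)) c with ha
    simp only [Function.comp_apply, ← ha, he, MulEquiv.symm_apply_apply, coe_lamKer]
    refine congrArg (fun y => _ * θ y) ?_
    change MSpace.mk (hatUnits R) (torusMap ι s * g₀ * L.unip δ m a) = MSpace.mk (hatUnits R)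
      (torusMap ι (localUnit P (L.lamLoc n m a)) * (torusMap ι s * g₀))
    rw [MSpace.mk_eq]
    -- Since `λ_a` commutes with `s`, the relation `λ_a g₀ ∈ g₀ α_{a,m} H` carries over from `g₀` to
    -- `s g₀`.
    refine ⟨1, one_mem _, _, hR.unip_inv_mul_mem hn hcomp a, ?_⟩
    rw [← mul_assoc, ← map_mul, torus_mul_comm F K, map_mul]
    group

end LocalData

end CMPoints

end

open CMPoints in
theorem mainTheorem3
    {F : Type*} [Field F] [NumberField F] [IsTotallyReal F]
    {K : Type*} [Field K] [NumberField K] [IsTotallyComplex K]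
    [Algebra F K] [Algebra.IsQuadraticExtension F K]
    {B : Type*} [Ring B] [Algebra F B] [Algebra.IsCentral F B] [IsSimpleRing B]
    (hB : Module.finrank F B = 4) (ι : K →ₐ[F] B)
    (P : HeightOneSpectrum (𝓞 F)) (hP : (2 : 𝓞 F) ∉ P.asIdeal)
    (L : LocalData ι P) (δ : ℕ)
    (R : Subalgebra (𝓞 F) B) (hR : IsOrder R) (hRP : L.IsEichler δ R)
    {A : Type*} [CommRing A] (θ : MSpace (hatUnits R) → A)
    (m : ℕ) (hm : 1 ≤ m) :
    (∃ Rm : Subalgebra (𝓞 F) B, IsOrder Rm ∧ Rm ≤ R ∧ hatUnits Rm = L.levelH δ m R) ∧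
    ∃ n₀ : ℕ, ∀ n ≥ n₀,
      ∃ e : galKer K P n m ≃* Z K P n m,
        (∀ σ : galKer K P n m, (e σ : AntiGroup K P n) = QuotientGroup.mk (σ : GalGroup K P n)) ∧
        ∀ χ₁ : AntiGroup K P n →* Aˣ,
          (∀ γ ∈ L.levelH δ m R, ∀ g, L.thetaM δ n m θ χ₁ (g * γ) = L.thetaM δ n m θ χ₁ g) ∧
          ∃ Θ : MSpace (L.levelH δ m R) → A,
            (∀ g, Θ (MSpace.mk (L.levelH δ m R) g) = L.thetaM δ n m θ χ₁ g) ∧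
            ∀ x : CMSet P ι (hatUnits R) n, (δ = 0 ∨ L.InBaseOrbit δ n x) →
              ∃ xm : CMSet P ι (L.levelH δ m R) n,
                Θ (red ι (L.levelH δ m R) xm) =
                  ∑ᶠ τ : Z K P n m, (χ₁ τ : A) *
                    θ (red ι (hatUnits R) (galAction ι (hatUnits R) n (e.symm τ) x)) := by
  obtain ⟨k₀, -, h₀, htf⟩ := L.exists_torsionFree
  -- The bound on `n` gives `k₀ ≤ n - m`, for units and torsion, and `2m + 2δ + 1 ≤ n`, for the
  -- matrix computations at base points.
  refine ⟨⟨L.levelOrder δ m R, hRP.isOrder_levelOrder m hR, L.levelOrder_le δ m R,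
    hRP.hatUnits_levelOrder⟩, k₀ + 2 * m + 2 * δ + 1, fun n hn => ?_⟩
  obtain ⟨e, he⟩ := exists_galKer_equiv htf (n := n) (m := m) (by omega)
  refine ⟨e, he, fun χ₁ => ⟨fun γ hγ g => ?_, hRP.thetaQuot θ χ₁, fun g => rfl, fun x hx => ?_⟩⟩
  · simpa using hRP.thetaM_mul θ χ₁ (one_mem _) hγ g
  · refine hRP.exists_cmPoint h₀ (by omega) (by omega) he θ χ₁ ?_
    rcases hx with rfl | hx
    · exact hRP.inBaseOrbit hP x
    · exact hx
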